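/- **Setting.** Let $n\le K$ be positive integers, let $\ell_1\ge\dots\ge\ell_K>0$, and let $V$ be a random vector in $\mathbb R^n$ with distribution $P$, $E\|V\|^2<\infty$, which is not almost surely constant. A *dictionary* is a sequence $D=(d_1,\dots,d_K)$ in $\mathbb R^n$ with $\langle d_i,d_i\rangle=\ell_i$ for all $i$; we also write $D$ for the $n\times K$ matrix with these columns. The *$\ell_2$-optimal dictionary problem* is to minimize $E\langle f(V),f(V)\rangle$ over all triples $(c,D,f)$, where $c\in\mathbb R^n$, $D$ is a dictionary with $\{v : v+c\in\operatorname{supp}P\}\subset\operatorname{span}(d_i)_{i=1}^K$, and $f:\mathbb R^n\to\mathbb R^K$ is a ($P$-almost everywhere) measurable map (the scheme) with $V-c=D f(V)$ almost surely. A dictionary is called optimal if it belongs to a minimizing triple. Let $\mu=E[V]$, $\Sigma=\operatorname{Var}(V)$, and let $\sigma_1\ge\dots\ge\sigma_m>0$ be the positive eigenvalues of $\Sigma$, with multiplicity. Put $\ell_i'=\ell_i$ for $i<m$ and $\ell_m'=\sum_{j=m}^K\ell_j$. **(i)** The quadratic program $$\text{minimize } \sum_{t=1}^m \bigl(\ell_t'x_t^2-2\sqrt{\sigma_t}\,x_t\bigr)\quad\text{subject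 to } 0\le x_1\le\dots\le x_m$$ has a unique solution $x^*$. Let $q^*$ be its optimal value. **(ii)** Let $n_1=1$ and $n_l=\min\{t : n_{l-1}<t\le m,\ x^*_{t-1}<x^*_t\}$ as long as such $t$ exist; let $n_L$ be the last of these numbers and $n_{L+1}=m+1$. For $n_l\le i<n_{l+1}$ put $$\lambda_i^*=\sqrt{\sigma_i}\;\frac{\sum_{j=n_l}^{n_{l+1}-1}\ell_j'}{\sum_{j=n_l}^{n_{l+1}-1}\sqrt{\sigma_j}} .$$ Then $(\lambda_i^*)_{i=1}^m$ is a non-increasing sequence of positive numbers, and: * The problem has an optimal solution, and $c^*=\mu$ in every optimal solution. * A dictionary $(d_i)$ is optimal if and only if $\sum_{i=1}^K d_id_i^\top=\sum_{i=1}^m\lambda_i^*u_iu_i^\top$ for some orthonormal eigenvectors $u_1,\dots,u_m$ of $\Sigma$ with $\Sigma u_i=\sigma_iu_i$. * For an optimal dictionary $D$, the optimal scheme is unique up to $P$-null sets and is given by $f^*(v)=D^+(v-\mu)$, where $D^+$ is the Moore–Penrose pseudo-inverse. * The optimal value is $$p^*=\sum_{l=1}^L\frac{\bigl(\sum_{j=n_l}^{n_{l+1}-1}\sqrt{\sigma_j}\bigr)^2}{\sum_{j=n_l}^{n_{l+1}-1}\ell_j'}=-q^*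 .$$ * The following algorithm computes from $\Sigma$ and $(\ell_i)$ an optimal dictionary $D$ together with $D^+$, in polynomial time. (1) Compute the eigenvalues of $\Sigma$ in non-increasing order and orthonormal eigenvectors; keep the $m$ pairs $(\sigma_i,u_i)$ with $\sigma_i>0$. (2) Solve the quadratic program (by pooling adjacent violators) and compute the blocks and $(\lambda_i^*)$. (3) Let $\Lambda=\operatorname{diag}(\lambda_1^*,\dots,\lambda_m^*,0,\dots,0)\in\mathbb R^{K\times K}$, and start with the standard basis of $\mathbb R^K$ as the list of current vectors $w_1,w_2,\dots$, always kept sorted so that $b_j=\langle w_j,\Lambda w_j\rangle$ is non-increasing. For $t=1,\dots,K$: if $b_1=\ell_t$, put $y_t=w_1$ and delete $w_1$; if $b_1>\ell_t$, take the first $i$ with $b_i\le\ell_t$, put $\Theta=\sqrt{\ell_t-b_i}\,/\,(\sqrt{\ell_t-b_i}+\sqrt{b_1-\ell_t})$ and $r=\sqrt{\Theta^2+(1-\Theta)^2}$, put $y_t=(\Theta w_1+(1-\Theta)w_i)/r$, and replace $w_1,w_i$ by the single vector $((1-\Theta)w_1-\Theta w_i)/r$. Put $d_t=\sum_{i\le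 m}\sqrt{\lambda_i^*}\,(y_t)_i\,u_i$. (4) Output $D=(d_t)$ and $D^+$, whose $t$-th row is $\sum_{i\le m}\frac{\langle d_t,u_i\rangle}{\lambda_i^*}u_i^\top$. Precisely: there is one polynomial $p$ such that for all data as above, in exact real arithmetic with unit cost for each arithmetic operation, square root, comparison and recursive procedure call, and with a subroutine that computes ordered orthonormal spectral decompositions of symmetric $n\times n$ matrices in time $T(n)$, the algorithm takes at most $T(n)+p(K)$ steps. Moreover for every optimal dictionary $D$ the eigenvectors in step (1) can be chosen such that the computed dictionary $D'$ satisfies $D'D'^\top=DD^\top$. -/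

import Mathlib

open MeasureTheory

namespace L2Dictionary

noncomputable section

/-! ## The `ℓ²`-optimal dictionary problem -/

/-- The variance matrix `Var(V)` of a random vector `V` with distribution `P`. -/
def varianceMatrix {n : ℕ} (P : Measure (EuclideanSpace ℝ (Fin n))) : Matrix (Fin n) (Fin n) ℝ :=
  Matrix.of fun i j => ProbabilityTheory.covariance (fun v => v i) (fun v => v j) P

/-- A dictionary `d` with the squared lengths `len` is feasible for the constant `c` if its span
contains `{v | v + c ∈ supp P}`. -/
def IsFeasibleDictionary {n K : ℕ} (P : Measure (EuclideanSpace ℝ (Fin n))) (len : Fin K → ℝ)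
    (c : EuclideanSpace ℝ (Fin n)) (d : Fin K → EuclideanSpace ℝ (Fin n)) : Prop :=
  (∀ i, inner ℝ (d i) (d i) = len i) ∧
    {v | v + c ∈ P.support} ⊆ (Submodule.span ℝ (Set.range d) : Set (EuclideanSpace ℝ (Fin n)))

/-- A scheme `f` is feasible for `c` and `d` if `V - c = ∑ i, fᵢ(V) dᵢ` almost surely. -/
def IsFeasibleScheme {n K : ℕ} (P : Measure (EuclideanSpace ℝ (Fin n)))
    (c : EuclideanSpace ℝ (Fin n)) (d : Fin K → EuclideanSpace ℝ (Fin n))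
    (f : EuclideanSpace ℝ (Fin n) → EuclideanSpace ℝ (Fin K)) : Prop :=
  AEMeasurable f P ∧ ∀ᵐ v ∂P, v - c = ∑ i, f v i • d i

/-- Feasible triples (constant, dictionary, scheme). -/
def IsFeasible {n K : ℕ} (P : Measure (EuclideanSpace ℝ (Fin n))) (len : Fin K → ℝ)
    (c : EuclideanSpace ℝ (Fin n)) (d : Fin K → EuclideanSpace ℝ (Fin n))
    (f : EuclideanSpace ℝ (Fin n) → EuclideanSpace ℝ (Fin K)) : Prop :=
  IsFeasibleDictionary P len c d ∧ IsFeasibleScheme P c d f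

/-- The average cost `E⟨f(V), f(V)⟩`, possibly infinite. -/
def cost {n K : ℕ} (P : Measure (EuclideanSpace ℝ (Fin n)))
    (f : EuclideanSpace ℝ (Fin n) → EuclideanSpace ℝ (Fin K)) : ENNReal :=
  ∫⁻ v, ENNReal.ofReal (inner ℝ (f v) (f v)) ∂P

/-- Optimal solutions of the `ℓ²`-optimal dictionary problem. -/
def IsOptimal {n K : ℕ} (P : Measure (EuclideanSpace ℝ (Fin n))) (len : Fin K → ℝ)
    (c : EuclideanSpace ℝ (Fin n)) (d : Fin K → EuclideanSpace ℝ (Fin n))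
    (f : EuclideanSpace ℝ (Fin n) → EuclideanSpace ℝ (Fin K)) : Prop :=
  IsFeasible P len c d f ∧ ∀ c' d' f', IsFeasible P len c' d' f' → cost P f ≤ cost P f'

/-- A dictionary is `ℓ²`-optimal if it belongs to an optimal solution. -/
def IsOptimalDictionary {n K : ℕ} (P : Measure (EuclideanSpace ℝ (Fin n))) (len : Fin K → ℝ)
    (d : Fin K → EuclideanSpace ℝ (Fin n)) : Prop :=
  ∃ c f, IsOptimal P len c d f

/-- The `n × K` matrix with the columns `dᵢ`. -/
def dictionaryMatrix {n K : ℕ} (d : Fin K → EuclideanSpace ℝ (Fin n)) :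
    Matrix (Fin n) (Fin K) ℝ :=
  Matrix.of fun i j => d j i

/-- `B` is the Moore–Penrose pseudo-inverse of `A` (the four Penrose equations). -/
def IsMoorePenroseInverse {n K : ℕ} (A : Matrix (Fin n) (Fin K) ℝ)
    (B : Matrix (Fin K) (Fin n) ℝ) : Prop :=
  A * B * A = A ∧ B * A * B = B ∧ (A * B).transpose = A * B ∧ (B * A).transpose = B * A

/-- The affine scheme `v ↦ G (v - c)`. -/
def affineScheme {n K : ℕ} (G : Matrix (Fin K) (Fin n) ℝ) (c : EuclideanSpace ℝ (Fin n))
    (v : EuclideanSpace ℝ (Fin n)) : EuclideanSpace ℝ (Fin K) :=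
  WithLp.toLp 2 (G.mulVec (v - c).ofLp)

/-- `∑ i, dᵢ dᵢᵀ`. -/
def gram {n K : ℕ} (d : Fin K → EuclideanSpace ℝ (Fin n)) : Matrix (Fin n) (Fin n) ℝ :=
  ∑ i, Matrix.vecMulVec (d i).ofLp (d i).ofLp

/-- `u` is an orthonormal sequence of eigenvectors of `A` for the eigenvalues `σ`. -/
def IsOrthonormalEigenseq {n m : ℕ} (A : Matrix (Fin n) (Fin n) ℝ) (σ : Fin m → ℝ)
    (u : Fin m → EuclideanSpace ℝ (Fin n)) : Prop :=
  Orthonormal ℝ u ∧ ∀ i, A.mulVec (u i).ofLp = σ i • (u i).ofLp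

open scoped Classical in
/-- The positive eigenvalues of `A`, with multiplicity, in non-increasing order. -/
def positiveEigenvalues {n : ℕ} (A : Matrix (Fin n) (Fin n) ℝ) : List ℝ :=
  (A.charpoly.roots.filter fun t => 0 < t).sort (fun a b => a ≥ b)

/-! ## The quadratic program and the two maps

Indices start at `0`, so the index `i` stands for the `(i + 1)`-st term. -/

/-- `ℓ'₁, …, ℓ'ₘ`: the first `m - 1` lengths, followed by the sum of all remaining ones. -/
def foldedLengths {K : ℕ} (len : Fin K → ℝ) (m : ℕ) (i : Fin m) : ℝ :=
  if (i : ℕ) + 1 < m then (if h : (i : ℕ) < K then len ⟨i, h⟩ else 0)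
  else ∑ j : Fin K, if (i : ℕ) ≤ (j : ℕ) then len j else 0

/-- The objective `∑ t, a_t x_t² - 2 c_t x_t`. -/
def qpObjective {m : ℕ} (c a x : Fin m → ℝ) : ℝ :=
  ∑ t, (a t * x t ^ 2 - 2 * c t * x t)

/-- The constraint `0 ≤ x₁ ≤ ⋯ ≤ xₘ`. -/
def QPFeasible {m : ℕ} (x : Fin m → ℝ) : Prop :=
  (∀ t, 0 ≤ x t) ∧ Monotone x

/-- Optimal solutions of the quadratic program. -/
def IsQPSolution {m : ℕ} (c a x : Fin m → ℝ) : Prop :=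
  QPFeasible x ∧ ∀ y, QPFeasible y → qpObjective c a x ≤ qpObjective c a y

/-- The least `t > s` with `x_{t-1} < x_t`, and `m` if there is none. -/
def nextBreak {m : ℕ} (x : Fin m → ℝ) (s : ℕ) : ℕ :=
  sInf ({t : ℕ | ∃ i j : Fin m, (j : ℕ) = t ∧ (i : ℕ) + 1 = t ∧ s < t ∧ x i < x j} ∪ {m})

/-- The starting points of the blocks on which `x` is constant; all terms after the last starting
point are equal to `m`. -/
def breakpoint {m : ℕ} (x : Fin m → ℝ) : ℕ → ℕ
  | 0 => 0
  | l + 1 => nextBreak x (breakpoint x l)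

/-- The number of blocks. -/
def numBlocks {m : ℕ} (x : Fin m → ℝ) : ℕ :=
  sInf {l | breakpoint x l = m}

/-- `∑_{s ≤ j < t} a_j`. -/
def blockSum {m : ℕ} (a : Fin m → ℝ) (s t : ℕ) : ℝ :=
  ∑ j : Fin m, if s ≤ (j : ℕ) ∧ (j : ℕ) < t then a j else 0

/-- The map `λ`: on the block `ν l ≤ i < ν (l + 1)` it is `c_i (∑ a_j) / (∑ c_j)`, both sums over
the block. -/
def lambdaMap {m : ℕ} (c a : Fin m → ℝ) (T : ℕ) (ν : ℕ → ℕ) (i : Fin m) : ℝ :=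
  ∑ l ∈ Finset.range T, if ν l ≤ (i : ℕ) ∧ (i : ℕ) < ν (l + 1) then
    c i * (blockSum a (ν l) (ν (l + 1)) / blockSum c (ν l) (ν (l + 1))) else 0

/-- The map `J`. -/
def valueMap {m : ℕ} (c a : Fin m → ℝ) (T : ℕ) (ν : ℕ → ℕ) : ℝ :=
  ∑ l ∈ Finset.range T,
    blockSum c (ν l) (ν (l + 1)) ^ 2 / blockSum a (ν l) (ν (l + 1))

end

/-! ## Programs over the real numbers with a step count

`Prog R α` is the type of programs with result in `α` which calculate with abstract numbers of
type `R`. The algorithms below are polymorphic in `R`: numbers are accessible only through the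
instructions of the machine, each of which is charged. Moreover every recursive call of a
procedure is charged one step (`tick`). -/

/-- The four arithmetic operations. -/
inductive ArithOp : Type
  | add
  | sub
  | mul
  | div

/-- Programs. The instruction `eig` calls a subroutine for the spectral decomposition of a
symmetric matrix (given by its rows); the subroutine returns the list of pairs
(eigenvalue, eigenvector). -/
inductive Prog (R α : Type) : Type
  | ret (a : α) : Prog R α
  | tick (k : Prog R α) : Prog R α
  | zero (k : R → Prog R α) : Prog R α
  | one (k : R → Prog R α) : Prog R α
  | arith (o : ArithOp) (a b : R) (k : R → Prog R α) : Prog R α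
  | sqrt (a : R) (k : R → Prog R α) : Prog R α
  | le (a b : R) (k : Bool → Prog R α) : Prog R α
  | eig (A : List (List R)) (k : List (R × List R) → Prog R α) : Prog R α

namespace Prog

/-- Sequential composition. -/
def bind {R α β : Type} : Prog R α → (α → Prog R β) → Prog R β
  | ret a, g => g a
  | tick k, g => tick (k.bind g)
  | zero k, g => zero fun r => (k r).bind g
  | one k, g => one fun r => (k r).bind g
  | arith o a b k, g => arith o a b fun r => (k r).bind g
  | sqrt a k, g => sqrt a fun r => (k r).bind g
  | le a b k, g => le a b fun r => (k r).bind g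
  | eig A k, g => eig A fun r => (k r).bind g

instance {R : Type} : Monad (Prog R) where
  pure := ret
  bind := bind

end Prog

/-- A subroutine for spectral decompositions: its output, and its running time as a function of
the number of rows. -/
structure EigSolver where
  out : List (List ℝ) → List (ℝ × List ℝ)
  time : ℕ → ℕ

/-- The rows of a matrix. -/
def toRows {n k : ℕ} (A : Matrix (Fin n) (Fin k) ℝ) : List (List ℝ) :=
  List.ofFn fun i => List.ofFn fun j => A i j

/-- On every symmetric matrix the subroutine returns all eigenvalues in non-increasing order,
together with an orthonormal basis of corresponding eigenvectors. -/
def EigSolver.IsCorrect (E : EigSolver) : Prop :=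
  ∀ (n : ℕ) (A : Matrix (Fin n) (Fin n) ℝ), A.IsSymm →
    ∃ (τ : Fin n → ℝ) (u : Fin n → EuclideanSpace ℝ (Fin n)),
      Antitone τ ∧ IsOrthonormalEigenseq A τ u ∧
        E.out (toRows A) = List.ofFn fun i => (τ i, List.ofFn fun j => u i j)

noncomputable section

/-- The meaning of an arithmetic operation. -/
def ArithOp.eval : ArithOp → ℝ → ℝ → ℝ
  | .add, a, b => a + b
  | .sub, a, b => a - b
  | .mul, a, b => a * b
  | .div, a, b => a / b

open scoped Classical in
/-- The result of a program over the real numbers. -/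
def Prog.value {α : Type} (E : EigSolver) : Prog ℝ α → α
  | .ret a => a
  | .tick k => k.value E
  | .zero k => (k 0).value E
  | .one k => (k 1).value E
  | .arith o a b k => (k (o.eval a b)).value E
  | .sqrt a k => (k (Real.sqrt a)).value E
  | .le a b k => (k (decide (a ≤ b))).value E
  | .eig A k => (k (E.out A)).value E

open scoped Classical in
/-- The number of steps of a program over the real numbers: one for each instruction, and the
running time of the subroutine for each call of it. -/
def Prog.steps {α : Type} (E : EigSolver) : Prog ℝ α → ℕ
  | .ret _ => 0
  | .tick k => 1 + k.steps E
  | .zero k => 1 + (k 0).steps E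
  | .one k => 1 + (k 1).steps E
  | .arith o a b k => 1 + (k (o.eval a b)).steps E
  | .sqrt a k => 1 + (k (Real.sqrt a)).steps E
  | .le a b k => 1 + (k (decide (a ≤ b))).steps E
  | .eig A k => E.time A.length + (k (E.out A)).steps E

end

/-! ## The algorithm -/

namespace Algo

variable {R : Type}

def tick : Prog R Unit := .tick (.ret ())
def zero : Prog R R := .zero .ret
def one : Prog R R := .one .ret
def add (a b : R) : Prog R R := .arith .add a b .ret
def sub (a b : R) : Prog R R := .arith .sub a b .ret
def mul (a b : R) : Prog R R := .arith .mul a b .ret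
def div (a b : R) : Prog R R := .arith .div a b .ret
def sqrt (a : R) : Prog R R := .sqrt a .ret
def le (a b : R) : Prog R Bool := .le a b .ret
def eig (A : List (List R)) : Prog R (List (R × List R)) := .eig A .ret

/-- Apply a procedure to all entries of a list. -/
def mapP {α β : Type} (g : α → Prog R β) : List α → Prog R (List β)
  | [] => pure []
  | x :: xs => do
    tick
    let y ← g x
    let ys ← mapP g xs
    pure (y :: ys)

/-- Apply a procedure to all pairs of corresponding entries of two lists. -/
def zipP {α β γ : Type} (g : α → β → Prog R γ) : List α → List β → Prog R (List γ)
  | x :: xs, y :: ys => do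
    tick
    let z ← g x y
    let zs ← zipP g xs ys
    pure (z :: zs)
  | _, _ => pure []

def sum : List R → Prog R R
  | [] => zero
  | x :: xs => do
    tick
    let s ← sum xs
    add x s

/-- The zero vector of length `k`. -/
def zeros : ℕ → Prog R (List R)
  | 0 => pure []
  | k + 1 => do
    tick
    let z ← zero
    let zs ← zeros k
    pure (z :: zs)

/-- Extend a list by zeros to the length `k`. -/
def pad : ℕ → List R → Prog R (List R)
  | k, [] => zeros k
  | 0, _ :: _ => pure []
  | k + 1, x :: xs => do
    tick
    let ys ← pad k xs
    pure (x :: ys)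

def dot (x y : List R) : Prog R R := do
  let ps ← zipP mul x y
  sum ps

def scale (t : R) (x : List R) : Prog R (List R) := mapP (fun s => mul t s) x

def addVec (x y : List R) : Prog R (List R) := zipP add x y

/-- The linear combination in dimension `n` of vectors `w` with coefficients `t`. -/
def linComb (n : ℕ) : List R → List (List R) → Prog R (List R)
  | t :: ts, w :: ws => do
    tick
    let s ← scale t w
    let r ← linComb n ts ws
    addVec s r
  | _, _ => zeros n

/-- The standard basis in dimension `k`. -/
def stdBasis : ℕ → Prog R (List (List R))
  | 0 => pure []
  | k + 1 => do
    tick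
    let z ← zero
    let e ← one
    let zs ← zeros k
    let bs ← stdBasis k
    let bs' ← mapP (fun b => pure (z :: b)) bs
    pure ((e :: zs) :: bs')

/-- The initial segment of pairs with positive eigenvalue. -/
def takePositive : List (R × List R) → Prog R (List (R × List R))
  | [] => pure []
  | p :: ps => do
    tick
    let z ← zero
    let b ← le p.1 z
    if b then pure []
    else do
      let r ← takePositive ps
      pure (p :: r)

/-- The lengths `ℓ'`, as many as the first list has entries. -/
def foldLengths : List R → List R → Prog R (List R)
  | [], _ => pure []
  | [_], ls => do
    let s ← sum ls
    pure [s]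
  | _ :: _ :: _, [] => pure []
  | _ :: c :: cs, l :: ls => do
    tick
    let r ← foldLengths (c :: cs) ls
    pure (l :: r)

/-- Put a block (sum of the `c`s, sum of the `a`s, size) in front of a list of blocks, pooling it
with the following blocks as long as the quotients fail to increase. -/
def pushBlock : List (R × R × ℕ) → R → R → ℕ → Prog R (List (R × R × ℕ))
  | [], c, a, k => pure [(c, a, k)]
  | (c', a', k') :: bs, c, a, k => do
    tick
    let q ← div c a
    let q' ← div c' a'
    let b ← le q' q
    if b then do
      let c'' ← add c c'
      let a'' ← add a a'
      pushBlock bs c'' a'' (k + k')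
    else pure ((c, a, k) :: (c', a', k') :: bs)

def poolBlocks : List R → List R → Prog R (List (R × R × ℕ))
  | c :: cs, a :: as => do
    tick
    let bs ← poolBlocks cs as
    pushBlock bs c a 1
  | _, _ => pure []

/-- Put `k` copies of `q` in front of a list. -/
def prependCopies (q : R) : ℕ → List R → Prog R (List R)
  | 0, xs => pure xs
  | k + 1, xs => do
    tick
    let ys ← prependCopies q k xs
    pure (q :: ys)

def expandBlocks : List (R × R × ℕ) → Prog R (List R)
  | [] => pure []
  | (c, a, k) :: bs => do
    tick
    let q ← div c a
    let xs ← expandBlocks bs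
    prependCopies q k xs

/-- Solve the quadratic program `∑ a_t x_t² - 2 c_t x_t → min`, `0 ≤ x₁ ≤ ⋯ ≤ xₘ`, by pooling
adjacent violators. -/
def solveQP (cs as : List R) : Prog R (List R) := do
  let bs ← poolBlocks cs as
  expandBlocks bs

/-- Divide a list of triples `(x, c, a)` into blocks; a new block begins where `x` increases. -/
def splitBlocks : List (R × R × R) → Prog R (List (List (R × R × R)))
  | [] => pure []
  | t :: ts => do
    tick
    let gs ← splitBlocks ts
    match gs with
    | (h :: g) :: gs' => do
      let b ← le h.1 t.1
      if b then pure ((t :: h :: g) :: gs')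
      else pure ([t] :: (h :: g) :: gs')
    | _ => pure [[t]]

/-- Put the numbers `c_i q` for one block in front of a list. -/
def prependScaled (q : R) : List (R × R × R) → List R → Prog R (List R)
  | [], r => pure r
  | t :: ts, r => do
    tick
    let l ← mul t.2.1 q
    let ls ← prependScaled q ts r
    pure (l :: ls)

def lambdaBlocks : List (List (R × R × R)) → Prog R (List R)
  | [] => pure []
  | g :: gs => do
    tick
    let cs ← mapP (fun t => pure t.2.1) g
    let as ← mapP (fun t => pure t.2.2) g
    let sc ← sum cs
    let sa ← sum as
    let q ← div sa sc
    let r ← lambdaBlocks gs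
    prependScaled q g r

/-- The numbers `λ*` from the solution `x` of the quadratic program. -/
def lambdaStar (xs cs as : List R) : Prog R (List R) := do
  let cas ← zipP (fun c a => pure (c, a)) cs as
  let ts ← zipP (fun x ca => pure (x, ca)) xs cas
  let gs ← splitBlocks ts
  lambdaBlocks gs

/-- `⟨u, Λ u⟩` for a diagonal matrix `Λ`. -/
def quad (Lam u : List R) : Prog R R := do
  let w ← zipP mul Lam u
  dot u w

def insertDesc (p : R × List R) : List (R × List R) → Prog R (List (R × List R))
  | [] => pure [p]
  | q :: qs => do
    tick
    let b ← le q.1 p.1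
    if b then pure (p :: q :: qs)
    else do
      let r ← insertDesc p qs
      pure (q :: r)

/-- Sort pairs `(⟨u, Λ u⟩, u)` by their first entries, in non-increasing order. -/
def sortDesc : List (R × List R) → Prog R (List (R × List R))
  | [] => pure []
  | p :: ps => do
    tick
    let r ← sortDesc ps
    insertDesc p r

/-- The first pair with first entry at most `a`, and the list of the other pairs. -/
def extract (a : R) : List (R × List R) →
    Prog R (Option ((R × List R) × List (R × List R)))
  | [] => pure none
  | p :: ps => do
    tick
    let b ← le p.1 a
    if b then pure (some (p, ps))
    else do
      let r ← extract a ps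
      match r with
      | none => pure none
      | some (q, qs) => pure (some (q, p :: qs))

/-- The vectors `(s u + t w) / √(s² + t²)`. -/
def rotate (s t : R) (u w : List R) : Prog R (List R) := do
  let s2 ← mul s s
  let t2 ← mul t t
  let r2 ← add s2 t2
  let r ← sqrt r2
  let s' ← div s r
  let t' ← div t r
  let x ← scale s' u
  let y ← scale t' w
  addVec x y

/-- The main loop of the computation of an orthonormal basis `x` with `⟨x_t, Λ x_t⟩ = a_t`. The
second argument holds the current orthonormal vectors, as sorted pairs `(⟨u, Λ u⟩, u)`. -/
def basisLoop (Lam : List R) : List R → List (R × List R) → Prog R (List (List R))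
  | [], _ => pure []
  | _ :: _, [] => pure []
  | a :: as, p :: rest => do
    tick
    let b ← le p.1 a
    if b then do
      let xs ← basisLoop Lam as rest
      pure (p.2 :: xs)
    else do
      let o ← extract a rest
      match o with
      | none => pure []
      | some (q, others) => do
        let α ← sub a q.1
        let β ← sub p.1 a
        let α' ← sqrt α
        let β' ← sqrt β
        let γ ← add α' β'
        let θ ← div α' γ
        let e ← one
        let z ← zero
        let θ' ← sub e θ
        let nθ ← sub z θ
        let x ← rotate θ θ' p.2 q.2
        let v ← rotate θ' nθ p.2 q.2
        let bv ← quad Lam v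
        let next ← sortDesc ((bv, v) :: others)
        let xs ← basisLoop Lam as next
        pure (x :: xs)

/-- An orthonormal basis `x` of the `K`-dimensional space with `⟨x_i, Λ x_i⟩ = ℓ_i`, where `Λ` is
a diagonal matrix. -/
def orthonormalBasis (K : ℕ) (Lam ls : List R) : Prog R (List (List R)) := do
  let es ← stdBasis K
  let ps ← mapP (fun u => do
    let b ← quad Lam u
    pure (b, u)) es
  let qs ← sortDesc ps
  basisLoop Lam ls qs

/-- A rank-one decomposition `∑ d_i d_iᵀ` of `∑ λ_i u_i u_iᵀ` with `⟨d_i, d_i⟩ = ℓ_i`. -/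
def rankOneDecomposition (n K : ℕ) (lam : List R) (us : List (List R)) (ls : List R) :
    Prog R (List (List R)) := do
  let rs ← mapP sqrt lam
  let C ← zipP scale rs us
  let Lam ← pad K lam
  let xs ← orthonormalBasis K Lam ls
  mapP (fun x => linComb n x C) xs

/-- The row `∑ i, (⟨d, u_i⟩ / λ_i) u_iᵀ` of the pseudo-inverse. -/
def pinvRow (n : ℕ) (lam : List R) (us : List (List R)) (d : List R) : Prog R (List R) := do
  let ss ← mapP (fun u => dot d u) us
  let ts ← zipP div ss lam
  linComb n ts us

/-- The algorithm. The input is the variance matrix (by rows) and the list of lengths; the output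
is the list of dictionary vectors and the list of rows of the pseudo-inverse. -/
def optimalDictionary (n K : ℕ) (A : List (List R)) (ls : List R) :
    Prog R (List (List R) × List (List R)) := do
  let es ← eig A
  let ps ← takePositive es
  let cs ← mapP (fun p => sqrt p.1) ps
  let us ← mapP (fun p => pure p.2) ps
  let as ← foldLengths cs ls
  let xs ← solveQP cs as
  let lam ← lambdaStar xs cs as
  let ds ← rankOneDecomposition n K lam us ls
  let G ← mapP (fun d => pinvRow n lam us d) ds
  pure (ds, G)

end Algo

end L2Dictionary

open L2Dictionary

namespace L2Dictionary

open Finset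

/-! ## Summation by parts -/

/-! Write `c_i = √σ_i`, `a_i = ℓ'_i`, let `x` solve the quadratic program, and let `g = a x - c` be
half its gradient. All facts about `x` come from `KKT`: `x` is positive and non-decreasing, and the
suffix sums of `g` are nonnegative and vanish at every jump of `x` and in total. By Abel summation
`g` pairs nonnegatively with every feasible vector (`KKT.qpObjective_le`, hence minimality and
uniqueness) and to zero with every function of `x` (`KKT.sum_mul_comp`). In particular `∑ a x² = ∑ c
x = -q*`, and `λ* = c / x`. A `KKT` point exists because pooling adjacent violators produces one.

Lower bound. The coordinates `ξ_i = ⟨u_i, V - μ⟩ / c_i` have mean zero and are orthonormal in `L²`.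
The coefficients `F_i = E[ξ_i f(V)]` of a feasible scheme satisfy `D F_i = c_i u_i` whatever the
constant is, and by Bessel the cost is at least `∑ |F_i|²`, with equality only if `f` is linear in
the `ξ_i`. Take an eigenbasis `w_j` of `D Dᵀ` with non-increasing eigenvalues `λ_j`, and put `B = ∑
x_j w_j w_jᵀ`, where `x` is continued by its last value. Expanding `∑ |F_i - Dᵀ B u_i|² ≥ 0` gives
`∑ |F_i|² ≥ 2 ∑ c_i ⟨u_i, B u_i⟩ - ∑ λ_j x_j²` (`lower_bound_with_defects`). The first sum is at
least `∑ c_i x_i`, since `k` orthonormal vectors see at least the `k` smallest eigenvalues of `B`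
(`sum_mul_le_sum_weights`); the second is at most `∑ c_i x_i`, since the eigenvalues of `D Dᵀ`
majorize the lengths (`sum_lengths_le_sum_eigenvalues`, `sum_eigenvalues_mul_sq_le`).

Equality. If the bound is attained, then `F_i = Dᵀ B u_i`, so each `w_j` is an eigenvector of `∑ c_i
u_i u_iᵀ` with eigenvalue `λ_j x_j`. Moreover `∑ x_j (λ_j x_j) = ∑ c_i x_i` is the equality case of
the rearrangement inequality; as `λ` is sorted, this gives `λ_j x_j = c_j`
(`eigenbasis_of_lower_bound_eq`). Linearity of `f` in the `ξ_i` then forces the constant to be the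
mean and the scheme to be the pseudo-inverse.

Attainment. By the `KKT` conditions `c / x`, padded by zeros, majorizes the lengths. The algorithm
is a constructive Schur–Horn theorem: each rotation splits off a unit vector with the required value
of the quadratic form and keeps the majorization (`Majorized.step`, `basisLoop_spec`). The resulting
dictionary has Gram matrix `∑ λ*_i u_i u_iᵀ`, and its pseudo-inverse costs `∑ σ_i / λ*_i = ∑ c_i
x_i`. -/

/-- A sequence with nonnegative partial sums, weighted by nonnegative non-increasing weights, has a
nonnegative sum. -/
theorem sum_mul_nonneg_of_antitone {w h : ℕ → ℝ} {N : ℕ} (hw0 : ∀ t < N, 0 ≤ w t)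
    (hw : ∀ t, t + 1 < N → w (t + 1) ≤ w t) (hh : ∀ k ≤ N, 0 ≤ ∑ t ∈ range k, h t) :
    0 ≤ ∑ t ∈ range N, w t * h t := by
  -- The induction needs the stronger claim with the last weight times the plain partial sum on the
  -- left: lowering that weight only lowers the bound, because the partial sum is nonnegative.
  have key : ∀ k, k < N → w k * ∑ t ∈ range (k + 1), h t ≤ ∑ t ∈ range (k + 1), w t * h t := by
    intro k
    induction k with
    | zero => intro _; simp
    | succ k ih =>
      intro hk
      rw [sum_range_succ, sum_range_succ (fun t => w t * h t)]
      have h1 := ih (by omega)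
      have h2 := mul_le_mul_of_nonneg_right (hw k hk) (hh (k + 1) (by omega))
      linarith
  rcases N with _ | N
  · simp
  · exact (mul_nonneg (hw0 N (by omega)) (hh (N + 1) le_rfl)).trans (key N (by omega))

/-- Summation by parts from the right, as an inequality. -/
theorem le_sum_Ico_mul_of_monotone {g y : ℕ → ℝ} {m : ℕ}
    {s : ℕ} (hs : s < m) (hg : ∀ t, s ≤ t → t ≤ m → 0 ≤ ∑ j ∈ Ico t m, g j)
    (hy : ∀ t, s ≤ t → t + 1 < m → y t ≤ y (t + 1)) :
    y s * ∑ j ∈ Ico s m, g j ≤ ∑ j ∈ Ico s m, g j * y j := by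
  obtain ⟨d, hd⟩ : ∃ d, s + d + 1 = m := ⟨m - s - 1, by omega⟩
  induction d generalizing s with
  | zero =>
    obtain rfl : m = s + 1 := by omega
    simp [mul_comm]
  | succ d ih =>
    have h1 := ih (s := s + 1) (by omega) (fun t ht => hg t (by omega))
      (fun t ht => hy t (by omega)) (by omega)
    have h2 := mul_le_mul_of_nonneg_right (hy s le_rfl (by omega)) (hg (s + 1) (by omega) (by omega))
    rw [sum_eq_sum_Ico_succ_bot hs, sum_eq_sum_Ico_succ_bot hs]
    linarith

/-- Summation by parts from the right for weights which only change where the suffix sums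
vanish. -/
theorem sum_Ico_mul_eq_of_slack {g y : ℕ → ℝ} {m : ℕ} {s : ℕ} (hs : s < m)
    (hy : ∀ t, s ≤ t → t + 1 < m → y t = y (t + 1) ∨ ∑ j ∈ Ico (t + 1) m, g j = 0) :
    ∑ j ∈ Ico s m, g j * y j = y s * ∑ j ∈ Ico s m, g j := by
  obtain ⟨d, hd⟩ : ∃ d, s + d + 1 = m := ⟨m - s - 1, by omega⟩
  induction d generalizing s with
  | zero =>
    obtain rfl : m = s + 1 := by omega
    simp [mul_comm]
  | succ d ih =>
    have h1 := ih (s := s + 1) (by omega) (fun t ht => hy t (by omega)) (by omega)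
    rw [sum_eq_sum_Ico_succ_bot hs, sum_eq_sum_Ico_succ_bot hs, h1]
    rcases hy s le_rfl (by omega) with h | h
    · rw [h]; ring
    · rw [h]; ring

/-- The largest weighted sum with weights in `[0, 1]` of total at most `k` of a non-increasing
nonnegative sequence puts full weight on the first `k` terms. -/
theorem sum_mul_le_sum_range {b β : ℕ → ℝ} {N k : ℕ} (hk : k ≤ N)
    (hb0 : ∀ t < N, 0 ≤ b t) (hb : ∀ i j, i ≤ j → j < N → b j ≤ b i)
    (hβ0 : ∀ t < N, 0 ≤ β t) (hβ1 : ∀ t < N, β t ≤ 1) (hβ : ∑ t ∈ range N, β t ≤ k) :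
    ∑ t ∈ range N, b t * β t ≤ ∑ t ∈ range k, b t := by
  rcases Nat.eq_zero_or_pos k with rfl | hk0
  · have h0 : ∀ t ∈ range N, β t = 0 := by
      have := (sum_eq_zero_iff_of_nonneg (fun t ht => hβ0 t (mem_range.1 ht))).1
        (le_antisymm (by simpa using hβ) (sum_nonneg fun t ht => hβ0 t (mem_range.1 ht)))
      exact this
    rw [sum_eq_zero (fun t ht => by rw [h0 t ht, mul_zero])]
    simp
  -- The `k`-th term is the Lagrange multiplier of the constraint on the total weight: pointwise `b
  -- β ≤ r β`, plus `b - r` on the first `k` indices.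
  · set r := b (k - 1) with hr
    have h1 : ∑ t ∈ range N, b t * β t ≤
        ∑ t ∈ range N, (r * β t + if t < k then (b t - r) else 0) := by
      refine sum_le_sum fun t ht => ?_
      have htN := mem_range.1 ht
      split_ifs with h
      · have := hb t (k - 1) (by omega) (by omega)
        nlinarith [hβ1 t htN, hβ0 t htN]
      · have := hb (k - 1) t (by omega) (by omega)
        nlinarith [hβ0 t htN]
    rw [sum_add_distrib, ← mul_sum, ← sum_filter] at h1
    have h2 : (range N).filter (· < k) = range k := by ext; simp; omega
    rw [h2, sum_sub_distrib] at h1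
    simp only [sum_const, card_range, nsmul_eq_mul] at h1
    nlinarith [hb0 (k - 1) (by omega)]

/-! ## The optimality conditions of the quadratic program -/

/-- The Karush–Kuhn–Tucker conditions for the quadratic program on the indices `s ≤ t < m`, in
terms of suffix sums of the gradient. -/
structure KKT (c a x : ℕ → ℝ) (s m : ℕ) : Prop where
  pos : ∀ t, s ≤ t → t < m → 0 < x t
  mono : ∀ t, s ≤ t → t + 1 < m → x t ≤ x (t + 1)
  suffix_nonneg : ∀ t, s ≤ t → t ≤ m → 0 ≤ ∑ j ∈ Ico t m, (a j * x j - c j)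
  suffix_break : ∀ t, s ≤ t → t + 1 < m → x t < x (t + 1) →
    ∑ j ∈ Ico (t + 1) m, (a j * x j - c j) = 0
  total : ∑ j ∈ Ico s m, (a j * x j - c j) = 0

/-- Extension of a finite sequence by zeros. -/
noncomputable def extendZero {m : ℕ} (f : Fin m → ℝ) (t : ℕ) : ℝ :=
  if h : t < m then f ⟨t, h⟩ else 0

theorem extendZero_apply {m : ℕ} (f : Fin m → ℝ) (i : Fin m) : extendZero f i = f i := by
  simp [extendZero]

theorem extendZero_of_lt {m : ℕ} (f : Fin m → ℝ) {t : ℕ} (h : t < m) :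
    extendZero f t = f ⟨t, h⟩ := by simp [extendZero, h]

theorem extendZero_of_le {m : ℕ} (f : Fin m → ℝ) {t : ℕ} (h : m ≤ t) :
    extendZero f t = 0 := by simp [extendZero, h]

theorem extendZero_fin {m : ℕ} (x : ℕ → ℝ) {t : ℕ} (h : t < m) :
    extendZero (fun i : Fin m => x i) t = x t := by simp [extendZero, h]

theorem KKT.congr {c a x c' a' x' : ℕ → ℝ} {s m : ℕ} (h : KKT c a x s m)
    (hc : ∀ t, s ≤ t → t < m → c' t = c t) (ha : ∀ t, s ≤ t → t < m → a' t = a t)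
    (hx : ∀ t, s ≤ t → t < m → x' t = x t) : KKT c' a' x' s m := by
  have e : ∀ t, s ≤ t → ∑ j ∈ Ico t m, (a' j * x' j - c' j) =
      ∑ j ∈ Ico t m, (a j * x j - c j) := fun t ht => sum_congr rfl fun j hj => by
    rw [mem_Ico] at hj
    rw [hc j (by omega) hj.2, ha j (by omega) hj.2, hx j (by omega) hj.2]
  constructor
  · intro t h1 h2; rw [hx t h1 h2]; exact h.pos t h1 h2
  · intro t h1 h2
    rw [hx t h1 (by omega), hx (t + 1) (by omega) h2]; exact h.mono t h1 h2
  · intro t h1 h2; rw [e t h1]; exact h.suffix_nonneg t h1 h2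
  · intro t h1 h2 h3
    rw [hx t h1 (by omega), hx (t + 1) (by omega) h2] at h3
    rw [e _ (by omega)]; exact h.suffix_break t h1 h2 h3
  · rw [e s le_rfl]; exact h.total

theorem KKT.mono_le {c a x : ℕ → ℝ} {s m : ℕ} (h : KKT c a x s m) {i j : ℕ} (hi : s ≤ i)
    (hij : i ≤ j) (hj : j < m) : x i ≤ x j := by
  induction j, hij using Nat.le_induction with
  | base => exact le_rfl
  | succ j hij ih => exact (ih (by omega)).trans (h.mono j (by omega) hj)

theorem KKT.slack {c a x : ℕ → ℝ} {s m : ℕ} (h : KKT c a x s m) {t : ℕ} (h1 : s ≤ t)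
    (h2 : t + 1 < m) : x t = x (t + 1) ∨ ∑ j ∈ Ico (t + 1) m, (a j * x j - c j) = 0 := by
  rcases (h.mono t h1 h2).eq_or_lt with h3 | h3
  · exact Or.inl h3
  · exact Or.inr (h.suffix_break t h1 h2 h3)

/-- The gradient is orthogonal to every function of the solution. -/
theorem KKT.sum_mul_comp {c a x : ℕ → ℝ} {m : ℕ} (h : KKT c a x 0 m) (φ : ℝ → ℝ) :
    ∑ j ∈ range m, (a j * x j - c j) * φ (x j) = 0 := by
  rcases Nat.eq_zero_or_pos m with rfl | hm
  · simp
  -- `φ ∘ x` changes only where `x` jumps, and there the suffix sum vanishes; Abel summation leaves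
  -- only a multiple of the total.
  rw [range_eq_Ico, sum_Ico_mul_eq_of_slack (y := fun j => φ (x j)) hm, h.total, mul_zero]
  intro t h1 h2
  exact (h.slack h1 h2).imp (fun e => by rw [e]) id

theorem KKT.sum_prefix_nonpos {c a x : ℕ → ℝ} {m : ℕ} (h : KKT c a x 0 m) {k : ℕ} (hk : k ≤ m) :
    ∑ j ∈ range k, (a j * x j - c j) ≤ 0 := by
  have h1 := sum_Ico_consecutive (fun j => a j * x j - c j) (Nat.zero_le k) hk
  rw [h.total, ← range_eq_Ico] at h1
  have := h.suffix_nonneg k (Nat.zero_le _) hk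
  linarith

/-- Orthogonality of the gradient to `x` itself; it turns the quadratic part of the objective into
the linear one. -/
theorem KKT.sum_c_mul {c a x : ℕ → ℝ} {m : ℕ} (h : KKT c a x 0 m) :
    ∑ j ∈ range m, a j * x j ^ 2 = ∑ j ∈ range m, c j * x j := by
  have := h.sum_mul_comp id
  simp only [id, sub_mul, sum_sub_distrib] at this
  rw [← sub_eq_zero, ← this]
  congr 1
  exact sum_congr rfl fun j _ => by ring

/-- The weights `1 / x` are positive and non-increasing, and the prefix sums of `c - a x` are
nonnegative. This is what later makes `λ* = c / x` majorize the lengths. -/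
theorem KKT.sum_le_sum_div {c a x : ℕ → ℝ} {m : ℕ} (h : KKT c a x 0 m) {k : ℕ} (hk : k ≤ m) :
    ∑ j ∈ range k, a j ≤ ∑ j ∈ range k, c j / x j := by
  have h1 : 0 ≤ ∑ t ∈ range k, (x t)⁻¹ * (-(a t * x t - c t)) := by
    refine sum_mul_nonneg_of_antitone (fun t ht => (inv_pos.2 (h.pos t (by omega) (by omega))).le)
      (fun t ht => inv_anti₀ (h.pos t (by omega) (by omega)) (h.mono t (by omega) (by omega)))
      fun l hl => ?_
    rw [sum_neg_distrib]
    linarith [h.sum_prefix_nonpos (hl.trans hk)]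
  rw [← sub_nonneg, ← sum_sub_distrib]
  refine h1.trans (le_of_eq (sum_congr rfl fun j hj => ?_))
  have := (h.pos j (by omega) (by have := mem_range.1 hj; omega)).ne'
  field_simp
  ring

theorem KKT.sum_eq_sum_div {c a x : ℕ → ℝ} {m : ℕ} (h : KKT c a x 0 m) :
    ∑ j ∈ range m, a j = ∑ j ∈ range m, c j / x j := by
  rw [← sub_eq_zero, ← sum_sub_distrib, ← h.sum_mul_comp (fun t => t⁻¹)]
  refine sum_congr rfl fun j hj => ?_
  have := (h.pos j (by omega) (by have := mem_range.1 hj; omega)).ne'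
  field_simp

theorem qpObjective_eq {m : ℕ} (c a x : Fin m → ℝ) : qpObjective c a x =
    ∑ t ∈ range m, (extendZero a t * extendZero x t ^ 2 - 2 * extendZero c t * extendZero x t) := by
  rw [qpObjective, ← Fin.sum_univ_eq_sum_range
    (fun t => extendZero a t * extendZero x t ^ 2 - 2 * extendZero c t * extendZero x t)]
  simp only [extendZero_apply]

/-- The objective is quadratic, so its increment is the exact remainder `∑ a (y - x)²` plus twice
the pairing of `a x - c` with `y - x`. That pairing is zero on `x` and, by Abel summation,
nonnegative on the monotone `y`. The remainder yields uniqueness. -/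
theorem KKT.qpObjective_le {m : ℕ} {c a x : Fin m → ℝ}
    (h : KKT (extendZero c) (extendZero a) (extendZero x) 0 m) {y : Fin m → ℝ}
    (hy : QPFeasible y) :
    qpObjective c a x + ∑ t, a t * (y t - x t) ^ 2 ≤ qpObjective c a y := by
  have h1 := h.sum_mul_comp id
  have h2 : 0 ≤ ∑ t ∈ range m, (extendZero a t * extendZero x t - extendZero c t) *
      extendZero y t := by
    rcases Nat.eq_zero_or_pos m with rfl | hm
    · simp
    rw [range_eq_Ico]
    refine le_trans ?_ (le_sum_Ico_mul_of_monotone hm h.suffix_nonneg ?_)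
    · rw [h.total, mul_zero]
    · intro t _ ht
      rw [extendZero_of_lt _ ht, extendZero_of_lt y (show t < m by omega)]
      exact hy.2 (by simp [Fin.le_def])
  have h3 : ∑ t, a t * (y t - x t) ^ 2 =
      ∑ t ∈ range m, extendZero a t * (extendZero y t - extendZero x t) ^ 2 := by
    rw [← Fin.sum_univ_eq_sum_range
      (fun t => extendZero a t * (extendZero y t - extendZero x t) ^ 2)]
    simp only [extendZero_apply]
  rw [qpObjective_eq, qpObjective_eq, h3, ← sum_add_distrib, ← sub_nonneg, ← sum_sub_distrib]
  have h4 : ∑ t ∈ range m, 2 * ((extendZero a t * extendZero x t - extendZero c t) *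
      extendZero y t) - ∑ t ∈ range m, 2 * ((extendZero a t * extendZero x t - extendZero c t) *
      id (extendZero x t)) = ∑ t ∈ range m, 2 * ((extendZero a t * extendZero x t - extendZero c t) *
      extendZero y t) := by
    rw [← mul_sum _ _ (2 : ℝ), ← mul_sum _ _ (2 : ℝ), h1]; ring
  rw [← sum_sub_distrib] at h4
  refine le_trans (b := ∑ t ∈ range m, 2 * ((extendZero a t * extendZero x t - extendZero c t) *
      extendZero y t)) ?_ ?_
  · rw [← mul_sum]; positivity
  · rw [← h4]
    refine le_of_eq (sum_congr rfl fun t _ => ?_)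
    simp only [id]
    ring

theorem KKT.isQPSolution {m : ℕ} {c a x : Fin m → ℝ} (ha : ∀ t, 0 < a t)
    (h : KKT (extendZero c) (extendZero a) (extendZero x) 0 m) : IsQPSolution c a x := by
  refine ⟨⟨fun t => ?_, ?_⟩, fun y hy => ?_⟩
  · rw [← extendZero_apply x]; exact (h.pos t (by omega) t.2).le
  · intro i j hij
    rw [← extendZero_apply x, ← extendZero_apply x j]; exact h.mono_le (by omega) hij j.2
  · have h1 := h.qpObjective_le hy
    have h2 : 0 ≤ ∑ t, a t * (y t - x t) ^ 2 :=
      sum_nonneg fun t _ => mul_nonneg (ha t).le (sq_nonneg _)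
    linarith

theorem KKT.eq_of_isQPSolution {m : ℕ} {c a x : Fin m → ℝ} (ha : ∀ t, 0 < a t)
    (h : KKT (extendZero c) (extendZero a) (extendZero x) 0 m) {y : Fin m → ℝ}
    (hy : IsQPSolution c a y) : y = x := by
  have h1 := h.qpObjective_le hy.1
  have h2 := hy.2 x (h.isQPSolution ha).1
  have h3 := (sum_eq_zero_iff_of_nonneg
    (fun t _ => mul_nonneg (ha t).le (sq_nonneg (y t - x t)))).1
    (le_antisymm (by linarith) (sum_nonneg fun t _ => mul_nonneg (ha t).le (sq_nonneg _)))
  funext t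
  have h4 := (mul_eq_zero.1 (h3 t (mem_univ t))).resolve_left (ha t).ne'
  linarith [pow_eq_zero_iff (two_ne_zero) |>.1 h4]

/-! ## Blocks of the solution -/

theorem blockSum_eq {m : ℕ} (a : Fin m → ℝ) {s t : ℕ} (ht : t ≤ m) :
    blockSum a s t = ∑ j ∈ Ico s t, extendZero a j := by
  have : blockSum a s t = ∑ j : Fin m, (fun j : ℕ => if s ≤ j ∧ j < t then extendZero a j else 0) j :=
    sum_congr rfl fun j _ => by simp only [extendZero_apply]
  rw [this, Fin.sum_univ_eq_sum_range (fun j => if s ≤ j ∧ j < t then extendZero a j else 0),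
    ← sum_filter]
  congr 1
  ext j
  simp
  omega

theorem nextBreak_mem {m : ℕ} (x : Fin m → ℝ) (s : ℕ) : nextBreak x s ∈
    ({t : ℕ | ∃ i j : Fin m, (j : ℕ) = t ∧ (i : ℕ) + 1 = t ∧ s < t ∧ x i < x j} ∪ {m} : Set ℕ) :=
  Nat.sInf_mem ⟨m, Or.inr rfl⟩

theorem nextBreak_le {m : ℕ} (x : Fin m → ℝ) (s : ℕ) : nextBreak x s ≤ m :=
  Nat.sInf_le (Or.inr rfl)

theorem lt_nextBreak {m : ℕ} (x : Fin m → ℝ) {s : ℕ} (hs : s < m) : s < nextBreak x s := by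
  rcases nextBreak_mem x s with ⟨_, _, _, _, h, _⟩ | h
  · exact h
  · rw [h]; exact hs

theorem breakpoint_le {m : ℕ} (x : Fin m → ℝ) (l : ℕ) : breakpoint x l ≤ m := by
  cases l with
  | zero => exact Nat.zero_le m
  | succ l => exact nextBreak_le x _

/-- Breakpoints below `m` increase strictly, so otherwise the `l`-th one would be at least `l` for
every `l`. -/
theorem exists_breakpoint_eq {m : ℕ} (x : Fin m → ℝ) : ∃ l, breakpoint x l = m := by
  by_contra! h
  have : ∀ l, l ≤ breakpoint x l := by
    intro l
    induction l with
    | zero => exact Nat.zero_le _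
    | succ l ih =>
      have := lt_nextBreak x (lt_of_le_of_ne (breakpoint_le x l) (h l))
      simp only [breakpoint]
      omega
  have h1 := this (m + 1)
  have h2 := breakpoint_le x (m + 1)
  omega

theorem breakpoint_numBlocks {m : ℕ} (x : Fin m → ℝ) : breakpoint x (numBlocks x) = m :=
  Nat.sInf_mem (exists_breakpoint_eq x)

theorem breakpoint_lt {m : ℕ} (x : Fin m → ℝ) {l : ℕ} (hl : l < numBlocks x) :
    breakpoint x l < m :=
  lt_of_le_of_ne (breakpoint_le x l) fun h => Nat.notMem_of_lt_sInf hl h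

theorem breakpoint_lt_succ {m : ℕ} (x : Fin m → ℝ) {l : ℕ} (hl : l < numBlocks x) :
    breakpoint x l < breakpoint x (l + 1) :=
  lt_nextBreak x (breakpoint_lt x hl)

section Blocks

variable {m : ℕ} {c a x : Fin m → ℝ}

theorem KKT.suffix_nextBreak (h : KKT (extendZero c) (extendZero a) (extendZero x) 0 m) (s : ℕ) :
    ∑ j ∈ Ico (nextBreak x s) m, (extendZero a j * extendZero x j - extendZero c j) = 0 := by
  rcases nextBreak_mem x s with ⟨i, j, hj, hi, _, h1⟩ | h1
  · rw [← hi]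
    refine h.suffix_break i (by omega) (by omega) ?_
    rw [hi, ← hj, extendZero_apply, extendZero_apply]
    exact h1
  · rw [h1]; simp

theorem KKT.suffix_breakpoint (h : KKT (extendZero c) (extendZero a) (extendZero x) 0 m) (l : ℕ) :
    ∑ j ∈ Ico (breakpoint x l) m, (extendZero a j * extendZero x j - extendZero c j) = 0 := by
  cases l with
  | zero => exact h.total
  | succ l => exact h.suffix_nextBreak _

theorem KKT.eq_of_lt_nextBreak (h : KKT (extendZero c) (extendZero a) (extendZero x) 0 m) {s t : ℕ}
    (hst : s ≤ t) (ht : t < nextBreak x s) : extendZero x t = extendZero x s := by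
  induction t, hst using Nat.le_induction with
  | base => rfl
  | succ t hst ih =>
    have hm := nextBreak_le x s
    rw [← ih (by omega)]
    refine le_antisymm (not_lt.1 fun h1 => Nat.notMem_of_lt_sInf ht (Or.inl ?_))
      (h.mono t (by omega) (by omega))
    rw [extendZero_of_lt x (show t + 1 < m by omega), extendZero_of_lt x (show t < m by omega)] at h1
    exact ⟨⟨t, by omega⟩, ⟨t + 1, by omega⟩, rfl, rfl, by omega, h1⟩

/-- The suffix sums of the gradient vanish at both ends of a block and `x` is constant in between;
hence `x` equals the quotient of the two block sums there. -/
theorem KKT.sum_block (h : KKT (extendZero c) (extendZero a) (extendZero x) 0 m) {l : ℕ}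
    (hl : l < numBlocks x) :
    ∑ j ∈ Ico (breakpoint x l) (breakpoint x (l + 1)), extendZero c j =
      extendZero x (breakpoint x l) *
        ∑ j ∈ Ico (breakpoint x l) (breakpoint x (l + 1)), extendZero a j := by
  have h1 := sum_Ico_consecutive (fun j => extendZero a j * extendZero x j - extendZero c j)
    (breakpoint_lt_succ x hl).le (breakpoint_le x (l + 1))
  rw [h.suffix_breakpoint, h.suffix_breakpoint, add_zero, sum_sub_distrib, sub_eq_zero] at h1
  rw [← h1, mul_sum]
  refine sum_congr rfl fun j hj => ?_
  rw [mem_Ico] at hj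
  rw [h.eq_of_lt_nextBreak hj.1 hj.2, mul_comm]

theorem sum_block_pos {a : Fin m → ℝ} (ha : ∀ t, 0 < a t) (x : Fin m → ℝ) {l : ℕ}
    (hl : l < numBlocks x) :
    0 < ∑ j ∈ Ico (breakpoint x l) (breakpoint x (l + 1)), extendZero a j := by
  refine sum_pos (fun j hj => ?_) (nonempty_Ico.2 (breakpoint_lt_succ x hl))
  have := breakpoint_le x (l + 1)
  rw [extendZero_of_lt a (show j < m by rw [mem_Ico] at hj; omega)]
  exact ha _

theorem KKT.lambdaMap_eq (h : KKT (extendZero c) (extendZero a) (extendZero x) 0 m)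
    (ha : ∀ t, 0 < a t) :
    lambdaMap c a (numBlocks x) (breakpoint x) = fun i => c i / x i := by
  funext i
  -- Consecutive blocks tile the indices, so exactly one of the conditions holds; induction on the
  -- number of blocks seen so far makes this precise.
  have h1 : ∀ T ≤ numBlocks x, (∑ l ∈ range T,
      if breakpoint x l ≤ (i : ℕ) ∧ (i : ℕ) < breakpoint x (l + 1) then c i / x i else 0) =
      if (i : ℕ) < breakpoint x T then c i / x i else 0 := by
    intro T
    induction T with
    | zero => intro _; simp [breakpoint]
    | succ T ih =>
      intro hT
      rw [sum_range_succ, ih (by omega)]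
      have := breakpoint_lt_succ x (show T < numBlocks x by omega)
      by_cases h2 : (i : ℕ) < breakpoint x T
      · rw [if_pos h2, if_neg (by omega), if_pos (by omega), add_zero]
      · rw [if_neg h2, zero_add]
        refine if_congr ?_ rfl rfl
        omega
  have h2 := h1 _ le_rfl
  rw [breakpoint_numBlocks, if_pos i.2] at h2
  rw [← h2, lambdaMap]
  refine sum_congr rfl fun l hl => ?_
  have hl := mem_range.1 hl
  split_ifs with h3
  · rw [blockSum_eq _ (breakpoint_le x _), blockSum_eq _ (breakpoint_le x _), h.sum_block hl,
      ← extendZero_apply x i, h.eq_of_lt_nextBreak h3.1 h3.2]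
    have p1 := (sum_block_pos ha x hl).ne'
    have p2 := (h.pos _ (Nat.zero_le _) (breakpoint_lt x hl)).ne'
    field_simp
  · rfl

/-- On a block `∑ c = x ∑ a`, so `(∑ c)² / ∑ a = x ∑ c`, and the blocks add up. -/
theorem KKT.valueMap_eq (h : KKT (extendZero c) (extendZero a) (extendZero x) 0 m)
    (ha : ∀ t, 0 < a t) :
    valueMap c a (numBlocks x) (breakpoint x) = ∑ i, c i * x i := by
  have h1 : ∀ T ≤ numBlocks x, (∑ l ∈ range T, blockSum c (breakpoint x l) (breakpoint x (l + 1)) ^ 2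
      / blockSum a (breakpoint x l) (breakpoint x (l + 1))) =
      ∑ t ∈ Ico 0 (breakpoint x T), extendZero c t * extendZero x t := by
    intro T
    induction T with
    | zero => intro _; simp [breakpoint]
    | succ T ih =>
      intro hT
      have hl : T < numBlocks x := by omega
      rw [sum_range_succ, ih (by omega),
        ← sum_Ico_consecutive _ (Nat.zero_le _) (breakpoint_lt_succ x hl).le]
      congr 1
      rw [blockSum_eq _ (breakpoint_le x _), blockSum_eq _ (breakpoint_le x _)]
      have p1 := (sum_block_pos ha x hl).ne'
      have h3 : ∑ t ∈ Ico (breakpoint x T) (breakpoint x (T + 1)), extendZero c t * extendZero x t =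
          ∑ t ∈ Ico (breakpoint x T) (breakpoint x (T + 1)), extendZero c t *
            extendZero x (breakpoint x T) := sum_congr rfl fun j hj => by
        rw [mem_Ico] at hj
        rw [h.eq_of_lt_nextBreak hj.1 hj.2]
      rw [h3, ← sum_mul, h.sum_block hl]
      field_simp
  rw [valueMap, h1 _ le_rfl, breakpoint_numBlocks, ← range_eq_Ico,
    ← Fin.sum_univ_eq_sum_range (fun t => extendZero c t * extendZero x t)]
  simp only [extendZero_apply]

theorem KKT.sum_eq_neg_qpObjective (h : KKT (extendZero c) (extendZero a) (extendZero x) 0 m) :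
    ∑ i, c i * x i = -qpObjective c a x := by
  have h1 := h.sum_c_mul
  have h2 : ∑ i, c i * x i = ∑ t ∈ range m, extendZero c t * extendZero x t := by
    rw [← Fin.sum_univ_eq_sum_range (fun t => extendZero c t * extendZero x t)]
    simp only [extendZero_apply]
  rw [h2, qpObjective_eq, sum_sub_distrib, h1]
  simp only [mul_assoc, ← mul_sum]
  ring

end Blocks

/-! ## Folded lengths -/

theorem foldedLengths_pos {K m : ℕ} {len : Fin K → ℝ} (hlen : ∀ i, 0 < len i) (hmK : m ≤ K)
    (i : Fin m) : 0 < foldedLengths len m i := by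
  unfold foldedLengths
  have hi := i.2
  split_ifs with h1 h2
  · exact hlen _
  · omega
  · refine sum_pos' (fun j _ => ?_) ⟨⟨i, by omega⟩, mem_univ _, ?_⟩
    · split_ifs
      · exact (hlen j).le
      · exact le_rfl
    · simp [hlen]

theorem extendZero_foldedLengths {K m : ℕ} (len : Fin K → ℝ) {t : ℕ} (ht : t + 1 < m) :
    extendZero (foldedLengths len m) t = extendZero len t := by
  rw [extendZero_of_lt _ (show t < m by omega)]
  simp [foldedLengths, extendZero, ht]

theorem sum_foldedLengths_of_lt {K m : ℕ} (len : Fin K → ℝ) {k : ℕ} (hk : k < m) :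
    ∑ t ∈ range k, extendZero (foldedLengths len m) t = ∑ t ∈ range k, extendZero len t :=
  sum_congr rfl fun t ht => extendZero_foldedLengths len (by have := mem_range.1 ht; omega)

theorem extendZero_foldedLengths_last {K m : ℕ} (len : Fin K → ℝ) :
    extendZero (foldedLengths len (m + 1)) m = ∑ t ∈ Ico m K, extendZero len t := by
  rw [extendZero_of_lt _ (Nat.lt_succ_self m)]
  simp only [foldedLengths, lt_irrefl, if_false]
  have : ∑ j : Fin K, (if m ≤ (j : ℕ) then len j else 0) =
      ∑ j : Fin K, (fun j : ℕ => if m ≤ j then extendZero len j else 0) j :=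
    sum_congr rfl fun j _ => by simp only [extendZero_apply]
  rw [this, Fin.sum_univ_eq_sum_range (fun j => if m ≤ j then extendZero len j else 0),
    ← sum_filter]
  congr 1
  ext j
  simp
  omega

theorem sum_foldedLengths {K m : ℕ} (len : Fin K → ℝ) (hm : 0 < m) (hmK : m ≤ K) :
    ∑ t ∈ range m, extendZero (foldedLengths len m) t = ∑ t ∈ range K, extendZero len t := by
  obtain ⟨m, rfl⟩ : ∃ k, m = k + 1 := ⟨m - 1, by omega⟩
  rw [sum_range_succ, sum_foldedLengths_of_lt _ (Nat.lt_succ_self m),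
    extendZero_foldedLengths_last len, sum_range_add_sum_Ico _ (by omega)]

end L2Dictionary

namespace L2Dictionary

/-! ## Values and step counts of the procedures -/

namespace Prog

variable {α β : Type} (E : EigSolver)

@[simp] theorem value_pure (a : α) : (pure a : Prog ℝ α).value E = a := rfl

@[simp] theorem steps_pure (a : α) : (pure a : Prog ℝ α).steps E = 0 := rfl

@[simp] theorem value_bind (p : Prog ℝ α) (g : α → Prog ℝ β) :
    (p >>= g).value E = (g (p.value E)).value E := by
  change (p.bind g).value E = _
  induction p with
  | le a b k ih => exact ih _
  | _ => simp_all [Prog.bind, Prog.value]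

-- The second program is counted at the value of the first, so every step bound below relies on the
-- value lemmas of the preceding instructions.
@[simp] theorem steps_bind (p : Prog ℝ α) (g : α → Prog ℝ β) :
    (p >>= g).steps E = p.steps E + (g (p.value E)).steps E := by
  change (p.bind g).steps E = _
  induction p with
  | le a b k ih => simp only [Prog.bind, Prog.value, Prog.steps, ih, add_assoc]
  | _ => simp_all [Prog.bind, Prog.value, Prog.steps, add_assoc]

@[simp] theorem value_ite {c : Prop} [Decidable c] (p q : Prog ℝ α) :
    (if c then p else q).value E = if c then p.value E else q.value E := by
  split_ifs <;> rfl

@[simp] theorem steps_ite {c : Prop} [Decidable c] (p q : Prog ℝ α) :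
    (if c then p else q).steps E = if c then p.steps E else q.steps E := by
  split_ifs <;> rfl

end Prog

namespace Algo

variable (E : EigSolver)

@[simp] theorem value_tick : (tick : Prog ℝ Unit).value E = () := rfl
@[simp] theorem steps_tick : (tick : Prog ℝ Unit).steps E = 1 := rfl
@[simp] theorem value_zero : (zero : Prog ℝ ℝ).value E = 0 := rfl
@[simp] theorem steps_zero : (zero : Prog ℝ ℝ).steps E = 1 := rfl
@[simp] theorem value_one : (one : Prog ℝ ℝ).value E = 1 := rfl
@[simp] theorem steps_one : (one : Prog ℝ ℝ).steps E = 1 := rfl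
@[simp] theorem value_add (a b : ℝ) : (add a b).value E = a + b := rfl
@[simp] theorem steps_add (a b : ℝ) : (add a b).steps E = 1 := rfl
@[simp] theorem value_sub (a b : ℝ) : (sub a b).value E = a - b := rfl
@[simp] theorem steps_sub (a b : ℝ) : (sub a b).steps E = 1 := rfl
@[simp] theorem value_mul (a b : ℝ) : (mul a b).value E = a * b := rfl
@[simp] theorem steps_mul (a b : ℝ) : (mul a b).steps E = 1 := rfl
@[simp] theorem value_div (a b : ℝ) : (div a b).value E = a / b := rfl
@[simp] theorem steps_div (a b : ℝ) : (div a b).steps E = 1 := rfl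
@[simp] theorem value_sqrt (a : ℝ) : (sqrt a).value E = Real.sqrt a := rfl
@[simp] theorem steps_sqrt (a : ℝ) : (sqrt a).steps E = 1 := rfl
@[simp] theorem value_eig (A : List (List ℝ)) : (eig A).value E = E.out A := rfl
@[simp] theorem steps_eig (A : List (List ℝ)) : (eig A).steps E = E.time A.length := rfl
@[simp] theorem steps_le (a b : ℝ) : (le a b).steps E = 1 := rfl

open scoped Classical in
@[simp] theorem value_le (a b : ℝ) : (le a b).value E = decide (a ≤ b) := rfl

@[simp] theorem value_mapP {α β : Type} (g : α → Prog ℝ β) (xs : List α) :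
    (mapP g xs).value E = xs.map fun x => (g x).value E := by
  induction xs <;> simp_all [mapP]

theorem steps_mapP_le {α β : Type} {g : α → Prog ℝ β} {xs : List α} {s : ℕ}
    (h : ∀ x ∈ xs, (g x).steps E ≤ s) : (mapP g xs).steps E ≤ xs.length * (s + 1) := by
  induction xs with
  | nil => simp [mapP]
  | cons x xs ih =>
    have h1 := h x (by simp)
    have h2 := ih fun y hy => h y (by simp [hy])
    simp [mapP]
    linarith

@[simp] theorem value_zipP {α β γ : Type} (g : α → β → Prog ℝ γ) (xs : List α) (ys : List β) :
    (zipP g xs ys).value E = List.zipWith (fun x y => (g x y).value E) xs ys := by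
  induction xs generalizing ys with
  | nil => simp [zipP]
  | cons x xs ih => cases ys <;> simp_all [zipP]

theorem steps_zipP_le {α β γ : Type} {g : α → β → Prog ℝ γ} {xs : List α} {ys : List β} {s : ℕ}
    (h : ∀ x ∈ xs, ∀ y ∈ ys, (g x y).steps E ≤ s) :
    (zipP g xs ys).steps E ≤ xs.length * (s + 1) := by
  induction xs generalizing ys with
  | nil => simp [zipP]
  | cons x xs ih =>
    cases ys with
    | nil => simp [zipP]
    | cons y ys =>
      have h1 := h x (by simp) y (by simp)
      have h2 := ih (ys := ys) fun a ha b hb => h a (by simp [ha]) b (by simp [hb])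
      simp [zipP]
      linarith

@[simp] theorem value_sum (xs : List ℝ) : (sum xs).value E = xs.sum := by
  induction xs <;> simp_all [sum]

@[simp] theorem steps_sum (xs : List ℝ) : (sum xs).steps E = 2 * xs.length + 1 := by
  induction xs with
  | nil => simp [sum]
  | cons x xs ih => simp [sum, ih]; ring

@[simp] theorem value_zeros (k : ℕ) : (zeros k : Prog ℝ _).value E = List.replicate k 0 := by
  induction k <;> simp_all [zeros, List.replicate_succ]

@[simp] theorem steps_zeros (k : ℕ) : (zeros k : Prog ℝ _).steps E = 2 * k := by
  induction k with
  | zero => simp [zeros]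
  | succ k ih => simp [zeros, ih]; ring

theorem value_pad (k : ℕ) (xs : List ℝ) (h : xs.length ≤ k) :
    (pad k xs).value E = xs ++ List.replicate (k - xs.length) 0 := by
  induction xs generalizing k with
  | nil => simp [pad]
  | cons x xs ih =>
    obtain ⟨k, rfl⟩ : ∃ j, k = j + 1 := ⟨k - 1, by simp at h; omega⟩
    simp [pad, ih k (by simpa using h)]

theorem steps_pad_le (k : ℕ) (xs : List ℝ) : (pad k xs).steps E ≤ 2 * k := by
  induction xs generalizing k with
  | nil => simp [pad]
  | cons x xs ih =>
    rcases k with _ | k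
    · simp [pad]
    · have := ih k
      simp [pad]
      omega

@[simp] theorem value_dot (x y : List ℝ) :
    (dot x y).value E = (List.zipWith (· * ·) x y).sum := by
  simp [dot]

theorem steps_dot_le (x y : List ℝ) : (dot x y).steps E ≤ 4 * x.length + 1 := by
  have := steps_zipP_le E (g := mul) (xs := x) (ys := y) (s := 1) (by simp)
  simp [dot]
  omega

@[simp] theorem value_scale (t : ℝ) (x : List ℝ) : (scale t x).value E = x.map (t * ·) := by
  simp [scale]

theorem steps_scale_le (t : ℝ) (x : List ℝ) : (scale t x).steps E ≤ 2 * x.length := by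
  have := steps_mapP_le E (g := fun s => mul t s) (xs := x) (s := 1) (by simp)
  unfold scale
  omega

@[simp] theorem value_addVec (x y : List ℝ) :
    (addVec x y).value E = List.zipWith (· + ·) x y := by
  simp [addVec]

theorem steps_addVec_le (x y : List ℝ) : (addVec x y).steps E ≤ 2 * x.length := by
  have := steps_zipP_le E (g := add) (xs := x) (ys := y) (s := 1) (by simp)
  unfold addVec
  omega

theorem steps_linComb_le (n N : ℕ) (ts : List ℝ) (ws : List (List ℝ))
    (h : ∀ w ∈ ws, w.length ≤ N) :
    (linComb n ts ws).steps E ≤ ts.length * (4 * N + 1) + 2 * n := by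
  induction ts generalizing ws with
  | nil => simp [linComb]
  | cons t ts ih =>
    cases ws with
    | nil => simp [linComb]
    | cons w ws =>
      have h1 := ih ws fun v hv => h v (by simp [hv])
      have h2 := h w (by simp)
      have h3 := steps_scale_le E t w
      have h4 := steps_addVec_le E (w.map (t * ·)) ((linComb n ts ws).value E)
      simp [linComb] at h4 ⊢
      linarith

theorem zipWith_ofFn {α β γ : Type*} {n : ℕ} (g : α → β → γ) (x : Fin n → α) (y : Fin n → β) :
    List.zipWith g (List.ofFn x) (List.ofFn y) = List.ofFn fun i => g (x i) (y i) := by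
  apply List.ext_getElem <;> simp

theorem value_linComb {n : ℕ} (ts : List ℝ) (ws : List (Fin n → ℝ)) :
    (linComb n ts (ws.map List.ofFn)).value E =
      List.ofFn (List.zipWith (fun t w => t • w) ts ws).sum := by
  induction ts generalizing ws with
  | nil => apply List.ext_getElem <;> simp [linComb]
  | cons t ts ih =>
    cases ws with
    | nil => apply List.ext_getElem <;> simp [linComb]
    | cons w ws =>
      simp only [linComb, List.map_cons, Prog.value_bind, value_scale, value_addVec, ih,
        List.map_ofFn, zipWith_ofFn, List.zipWith_cons_cons, List.sum_cons]
      rfl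

theorem value_stdBasis (k : ℕ) : (stdBasis k : Prog ℝ _).value E =
    List.ofFn fun i : Fin k => List.ofFn (Pi.single i (1 : ℝ) : Fin k → ℝ) := by
  induction k with
  | zero => simp [stdBasis]
  | succ k ih =>
    simp only [stdBasis, Prog.value_bind, value_zero, value_one, value_zeros, ih,
      value_mapP, Prog.value_pure, List.map_ofFn, List.ofFn_succ]
    congr 1
    · simp only [Pi.single_eq_same]
      congr 1
      apply List.ext_getElem <;> simp [Fin.succ_ne_zero]
    · congr 1
      funext i
      simp only [Function.comp]
      congr 1
      congr 1
      funext j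
      simp [Pi.single_apply]

theorem steps_stdBasis_le (k : ℕ) : (stdBasis k : Prog ℝ _).steps E ≤ k * (3 * k + 3) := by
  induction k with
  | zero => simp [stdBasis]
  | succ k ih =>
    have h := steps_mapP_le E (g := fun b : List ℝ => pure ((0 : ℝ) :: b))
      (xs := (stdBasis k : Prog ℝ _).value E) (s := 0) (by simp)
    rw [value_stdBasis] at h
    simp [stdBasis, value_stdBasis] at h ⊢
    nlinarith

open scoped Classical in
theorem value_takePositive (ps : List (ℝ × List ℝ)) :
    (takePositive ps).value E = ps.takeWhile fun p => 0 < p.1 := by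
  induction ps with
  | nil => simp [takePositive]
  | cons p ps ih =>
    simp only [takePositive, Prog.value_bind, value_zero, value_le, List.takeWhile_cons]
    by_cases h : p.1 ≤ 0
    · simp [h, not_lt.2 h]
    · simp [h, not_le.1 h, ih]

theorem steps_takePositive_le (ps : List (ℝ × List ℝ)) :
    (takePositive ps).steps E ≤ 3 * ps.length := by
  induction ps with
  | nil => simp [takePositive]
  | cons p ps ih =>
    simp only [takePositive, Prog.steps_bind, steps_tick, steps_zero, steps_le, List.length_cons,
      Prog.steps_ite, Prog.steps_pure]
    split_ifs <;> omega

theorem value_foldLengths (cs ls : List ℝ) (h0 : cs ≠ []) (h : cs.length ≤ ls.length) :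
    (foldLengths cs ls).value E =
      ls.take (cs.length - 1) ++ [(ls.drop (cs.length - 1)).sum] := by
  induction cs generalizing ls with
  | nil => simp at h0
  | cons c cs ih =>
    cases cs with
    | nil => simp [foldLengths]
    | cons c' cs =>
      cases ls with
      | nil => simp at h
      | cons l ls =>
        simp only [foldLengths, Prog.value_bind, ih ls (by simp) (by simpa using h)]
        simp

theorem steps_foldLengths_le (cs ls : List ℝ) :
    (foldLengths cs ls).steps E ≤ cs.length + 2 * ls.length + 1 := by
  induction cs generalizing ls with
  | nil => simp [foldLengths]
  | cons c cs ih =>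
    cases cs with
    | nil => simp [foldLengths]
    | cons c' cs =>
      cases ls with
      | nil => simp [foldLengths]
      | cons l ls =>
        have := ih ls
        simp [foldLengths] at this ⊢
        omega

theorem value_foldLengths_ofFn {K m : ℕ} (len : Fin K → ℝ) (cs : List ℝ) (hc : cs.length = m)
    (hm : 0 < m) (hmK : m ≤ K) :
    (foldLengths cs (List.ofFn len)).value E = List.ofFn (foldedLengths len m) := by
  rw [value_foldLengths E cs _ (by rintro rfl; simp at hc; omega) (by simp; omega), hc]
  apply List.ext_getElem
  · simp; omega
  · intro i h1 h2
    simp only [List.getElem_ofFn, foldedLengths]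
    by_cases hi : i + 1 < m
    · rw [List.getElem_append_left (by simp; omega), if_pos hi, dif_pos (by omega)]
      simp
    · have hi : i = m - 1 := by simp at h2; omega
      subst hi
      rw [List.getElem_append_right (by simp), if_neg (by omega)]
      simp only [List.getElem_singleton]
      have h3 : (List.ofFn len).drop (m - 1) =
          (List.range' (m - 1) (K - (m - 1))).map (extendZero len) := by
        apply List.ext_getElem
        · simp
        · intro j h4 h5
          simp at h4
          simp [extendZero_of_lt len (show m - 1 + j < K by omega)]
      rw [h3]
      have h4 : ∑ j : Fin K, (if m - 1 ≤ (j : ℕ) then len j else 0) =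
          ∑ j : Fin K, (fun j : ℕ => if m - 1 ≤ j then extendZero len j else 0) j :=
        Finset.sum_congr rfl fun j _ => by simp only [extendZero_apply]
      rw [h4, Fin.sum_univ_eq_sum_range (fun j => if m - 1 ≤ j then extendZero len j else 0),
        ← Finset.sum_filter]
      have h5 : (Finset.range K).filter (m - 1 ≤ ·) = Finset.Ico (m - 1) K := by ext; simp; omega
      rw [h5]
      simp [Finset.sum, Finset.Ico, LocallyFiniteOrder.finsetIco]

end Algo

end L2Dictionary

namespace L2Dictionary

namespace Algo

open Finset

/-! ## Pooling adjacent violators -/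

/-- The block of the indices `s ≤ t < s + k`, with sums `C` and `A`, all of whose initial segments
have at least the quotient `C / A`. -/
structure GoodBlock (c a : ℕ → ℝ) (m s k : ℕ) (C A : ℝ) : Prop where
  pos : 0 < k
  le : s + k ≤ m
  sum_c : ∑ j ∈ Ico s (s + k), c j = C
  sum_a : ∑ j ∈ Ico s (s + k), a j = A
  initial : ∀ j ≤ k, C * ∑ i ∈ Ico s (s + j), a i ≤ A * ∑ i ∈ Ico s (s + j), c i

/-- A list of good blocks with increasing quotients which partition the indices `s ≤ t < m`. -/
def Pooled (c a : ℕ → ℝ) (m : ℕ) : ℕ → List (ℝ × ℝ × ℕ) → Prop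
  | s, [] => s = m
  | s, (C, A, k) :: bs => GoodBlock c a m s k C A ∧ (∀ b ∈ bs.head?, C / A < b.1 / b.2.1) ∧
      Pooled c a m (s + k) bs

section

variable {c a : ℕ → ℝ} {m : ℕ}

theorem GoodBlock.sum_pos {s k : ℕ} {C A : ℝ} (h : GoodBlock c a m s k C A) {f : ℕ → ℝ}
    (hf : ∀ t < m, 0 < f t) : 0 < ∑ j ∈ Ico s (s + k), f j := by
  have := h.pos
  have := h.le
  exact Finset.sum_pos (fun j hj => hf j (by rw [mem_Ico] at hj; omega))
    (nonempty_Ico.2 (by omega))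

/-- Up to the end of the first block the initial quotient is at least `C / A`, hence at least `C' /
A'` as well. Beyond that point, the rest of the second block has quotient at most `C' / A' ≤ C / A`,
so cutting it off cannot push the quotient below the pooled one. All inequalities are
cross-multiplied. -/
theorem GoodBlock.merge (hc : ∀ t < m, 0 < c t) (ha : ∀ t < m, 0 < a t) {s k k' : ℕ}
    {C A C' A' : ℝ} (h : GoodBlock c a m s k C A) (h' : GoodBlock c a m (s + k) k' C' A')
    (hq : C' / A' ≤ C / A) : GoodBlock c a m s (k + k') (C + C') (A + A') := by
  have pC : 0 < C := h.sum_c ▸ h.sum_pos hc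
  have pA : 0 < A := h.sum_a ▸ h.sum_pos ha
  have pC' : 0 < C' := h'.sum_c ▸ h'.sum_pos hc
  have pA' : 0 < A' := h'.sum_a ▸ h'.sum_pos ha
  have hle := h'.le
  rw [div_le_div_iff₀ pA' pA] at hq
  refine ⟨by have := h.pos; omega, by omega, ?_, ?_, fun j hj => ?_⟩
  · rw [← h.sum_c, ← h'.sum_c, ← add_assoc, sum_Ico_consecutive _ (by omega) (by omega)]
  · rw [← h.sum_a, ← h'.sum_a, ← add_assoc, sum_Ico_consecutive _ (by omega) (by omega)]
  · rcases le_total j k with hjk | hjk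
    · have h1 := h.initial j hjk
      have h2 : 0 ≤ ∑ i ∈ Ico s (s + j), a i :=
        sum_nonneg fun i hi => (ha i (by rw [mem_Ico] at hi; omega)).le
      set x := ∑ i ∈ Ico s (s + j), a i
      set y := ∑ i ∈ Ico s (s + j), c i
      have h3 : C' * x ≤ A' * y := by
        refine le_of_mul_le_mul_left ?_ pA
        nlinarith
      linarith
    · obtain ⟨i, rfl⟩ := Nat.exists_eq_add_of_le hjk
      have e : ∀ f : ℕ → ℝ, ∑ t ∈ Ico s (s + (k + i)), f t =
          ∑ t ∈ Ico s (s + k), f t + ∑ t ∈ Ico (s + k) (s + k + i), f t := fun f => by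
        rw [sum_Ico_consecutive _ (by omega) (by omega), add_assoc]
      have h1 := h'.initial i (by omega)
      rw [e, e, h.sum_c, h.sum_a]
      have h2 : ∑ t ∈ Ico (s + k) (s + k + i), a t ≤ A' := by
        rw [← h'.sum_a]
        refine sum_le_sum_of_subset_of_nonneg (Ico_subset_Ico le_rfl (by omega)) fun t ht _ => ?_
        exact (ha t (by rw [mem_Ico] at ht; omega)).le
      set x := ∑ t ∈ Ico (s + k) (s + k + i), a t
      set y := ∑ t ∈ Ico (s + k) (s + k + i), c t
      have h3 : A * (C' - y) ≤ C * (A' - x) := by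
        refine le_of_mul_le_mul_left ?_ pA'
        have h4 := mul_le_mul_of_nonneg_right hq (sub_nonneg.2 h2)
        nlinarith
      linarith

theorem pushBlock_pooled (E : EigSolver) (hc : ∀ t < m, 0 < c t) (ha : ∀ t < m, 0 < a t)
    {bs : List (ℝ × ℝ × ℕ)} {s k : ℕ} {C A : ℝ} (h : GoodBlock c a m s k C A)
    (hbs : Pooled c a m (s + k) bs) : Pooled c a m s ((pushBlock bs C A k).value E) := by
  induction bs generalizing C A k with
  | nil => exact ⟨h, by simp, hbs⟩
  | cons b bs ih =>
    obtain ⟨C', A', k'⟩ := b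
    simp only [pushBlock, Prog.value_bind, value_div, value_le, value_add, Prog.value_ite,
      decide_eq_true_eq]
    split_ifs with hq
    · exact ih (h.merge hc ha hbs.1 hq) (by rw [← add_assoc]; exact hbs.2.2)
    · exact ⟨h, by simpa using hq, hbs⟩

theorem length_pushBlock_le (E : EigSolver) (bs : List (ℝ × ℝ × ℕ)) (C A : ℝ) (k : ℕ) :
    ((pushBlock bs C A k).value E).length ≤ bs.length + 1 := by
  induction bs generalizing C A k with
  | nil => simp [pushBlock]
  | cons b bs ih =>
    simp only [pushBlock, Prog.value_bind, value_div, value_le, value_add, Prog.value_ite,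
      decide_eq_true_eq]
    split_ifs
    · exact (ih _ _ _).trans (by simp)
    · simp

theorem steps_pushBlock_le (E : EigSolver) (bs : List (ℝ × ℝ × ℕ)) (C A : ℝ) (k : ℕ) :
    (pushBlock bs C A k).steps E ≤ 6 * bs.length := by
  induction bs generalizing C A k with
  | nil => simp [pushBlock]
  | cons b bs ih =>
    obtain ⟨C', A', k'⟩ := b
    have := ih (C + C') (A + A') (k + k')
    simp only [pushBlock, value_div, value_le, value_add, Prog.steps_ite,
      decide_eq_true_eq, Prog.steps_bind, steps_tick, steps_div, steps_le, steps_add,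
      Prog.steps_pure, List.length_cons]
    split_ifs <;> omega

theorem length_poolBlocks_le (E : EigSolver) (cs as : List ℝ) :
    ((poolBlocks cs as).value E).length ≤ cs.length := by
  induction cs generalizing as with
  | nil => simp [poolBlocks]
  | cons c cs ih =>
    cases as with
    | nil => simp [poolBlocks]
    | cons a as =>
      simp only [poolBlocks, Prog.value_bind]
      exact (length_pushBlock_le E _ _ _ _).trans (by simpa using ih as)

/-- Each push is charged with the whole list of blocks; this crude quadratic bound suffices, without
amortization. -/
theorem steps_poolBlocks_le (E : EigSolver) (cs as : List ℝ) :
    (poolBlocks cs as).steps E ≤ cs.length * (6 * cs.length + 1) := by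
  induction cs generalizing as with
  | nil => simp [poolBlocks]
  | cons c cs ih =>
    cases as with
    | nil => simp [poolBlocks]
    | cons a as =>
      have h1 := ih as
      have h2 := steps_pushBlock_le E ((poolBlocks cs as).value E) c a 1
      have h3 := length_poolBlocks_le E cs as
      simp only [poolBlocks, Prog.steps_bind, steps_tick, List.length_cons]
      nlinarith

theorem poolBlocks_pooled (E : EigSolver) (hc : ∀ t < m, 0 < c t) (ha : ∀ t < m, 0 < a t)
    {s d : ℕ} (h : s + d = m) :
    Pooled c a m s ((poolBlocks ((List.range' s d).map c) ((List.range' s d).map a)).value E) := by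
  induction d generalizing s with
  | zero => simpa [poolBlocks, Pooled] using h
  | succ d ih =>
    simp only [List.range'_succ, List.map_cons, poolBlocks, Prog.value_bind]
    refine pushBlock_pooled E hc ha ⟨one_pos, by omega, by simp, by simp, fun j hj => ?_⟩
      (ih (by omega))
    rcases (show j = 0 ∨ j = 1 by omega) with rfl | rfl
    · simp
    · simp [mul_comm]

theorem value_prependCopies (E : EigSolver) (q : ℝ) (k : ℕ) (xs : List ℝ) :
    (prependCopies q k xs).value E = List.replicate k q ++ xs := by
  induction k <;> simp_all [prependCopies, List.replicate_succ]

theorem steps_prependCopies (E : EigSolver) (q : ℝ) (k : ℕ) (xs : List ℝ) :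
    (prependCopies q k xs).steps E = k := by
  induction k <;> simp_all [prependCopies]
  omega

/-- A pooled list is a `KKT` point. The value `C / A` makes the gradient sum to zero over its block;
the condition on initial segments makes the prefix sums inside a block nonpositive, hence the suffix
sums nonnegative; increasing quotients give monotonicity, and jumps occur only between blocks. The
clause on the head lets the induction compare a block with its successor. -/
theorem expandBlocks_spec (E : EigSolver) (hc : ∀ t < m, 0 < c t) (ha : ∀ t < m, 0 < a t)
    {bs : List (ℝ × ℝ × ℕ)} {s : ℕ} (h : Pooled c a m s bs) :
    s ≤ m ∧ (expandBlocks bs).steps E ≤ 3 * (m - s) ∧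
    ∃ x : ℕ → ℝ, (expandBlocks bs).value E = (List.range' s (m - s)).map x ∧
      KKT c a x s m ∧ ∀ b ∈ bs.head?, x s = b.1 / b.2.1 := by
  induction bs generalizing s with
  | nil =>
    obtain rfl : s = m := h
    refine ⟨le_rfl, by simp [expandBlocks], fun _ => 0, by simp [expandBlocks], ?_, by simp⟩
    constructor
    · intros; omega
    · intros; omega
    · intro t h1 h2
      obtain rfl : t = s := by omega
      simp
    · intros; omega
    · simp
  | cons b bs ih =>
    obtain ⟨C, A, k⟩ := b
    obtain ⟨hb, hq, hbs⟩ := h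
    obtain ⟨hsk, hst, x', hx', hK, hhead⟩ := ih hbs
    have pC : 0 < C := hb.sum_c ▸ hb.sum_pos hc
    have pA : 0 < A := hb.sum_a ▸ hb.sum_pos ha
    have hk := hb.pos
    set q := C / A with hqdef
    have hqA : A * q = C := by rw [hqdef]; field_simp
    have hq0 : 0 < q := by positivity
    set x : ℕ → ℝ := fun t => if t < s + k then q else x' t with hx
    have x1 : ∀ t, t < s + k → x t = q := fun t ht => if_pos ht
    have x2 : ∀ t, s + k ≤ t → x t = x' t := fun t ht => if_neg (not_lt.2 ht)
    have g2 : ∀ t, s + k ≤ t → ∑ j ∈ Ico t m, (a j * x j - c j) =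
        ∑ j ∈ Ico t m, (a j * x' j - c j) := fun t ht => sum_congr rfl fun j hj => by
      rw [x2 j (by rw [mem_Ico] at hj; omega)]
    have pre : ∀ j ≤ k, ∑ i ∈ Ico s (s + j), (a i * x i - c i) =
        q * ∑ i ∈ Ico s (s + j), a i - ∑ i ∈ Ico s (s + j), c i := fun j hj => by
      rw [mul_sum, ← sum_sub_distrib]
      refine sum_congr rfl fun i hi => ?_
      rw [x1 i (by rw [mem_Ico] at hi; omega), mul_comm]
    have tot : ∑ j ∈ Ico s m, (a j * x j - c j) = 0 := by
      rw [← sum_Ico_consecutive _ (show s ≤ s + k by omega) hsk, pre k le_rfl, hb.sum_a, hb.sum_c,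
        g2 _ le_rfl, hK.total, mul_comm, hqA]
      ring
    have hlt : s + k < m → q < x' (s + k) := fun hlt => by
      cases bs with
      | nil =>
        have : s + k = m := hbs
        omega
      | cons b bs =>
        rw [hhead b (by simp)]
        exact hq b (by simp)
    refine ⟨by omega, ?_, x, ?_, ⟨?_, ?_, ?_, ?_, tot⟩, ?_⟩
    · simp only [expandBlocks, Prog.steps_bind, steps_tick, steps_div, steps_prependCopies]
      omega
    · simp only [expandBlocks, Prog.value_bind, value_div, value_prependCopies, hx']
      have e : m - s = k + (m - (s + k)) := by omega
      rw [e, ← List.range'_append_1, List.map_append]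
      congr 1
      · symm
        rw [List.eq_replicate_iff]
        refine ⟨by simp, fun y hy => ?_⟩
        simp only [List.mem_map, List.mem_range'_1] at hy
        obtain ⟨t, ht, rfl⟩ := hy
        exact x1 t (by omega)
      · refine List.map_congr_left fun t ht => ?_
        rw [List.mem_range'_1] at ht
        exact (x2 t (by omega)).symm
    · intro t h1 h2
      by_cases h3 : t < s + k
      · rw [x1 t h3]; exact hq0
      · rw [x2 t (by omega)]; exact hK.pos t (by omega) h2
    · intro t h1 h2
      rcases lt_trichotomy (t + 1) (s + k) with h3 | h3 | h3
      · rw [x1 t (by omega), x1 _ h3]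
      · rw [x1 t (by omega), x2 _ (by omega), h3]
        exact (hlt (by omega)).le
      · rw [x2 t (by omega), x2 _ (by omega)]
        exact hK.mono t (by omega) h2
    · intro t h1 h2
      by_cases h3 : t < s + k
      -- Inside the first block the suffix sum is the negative of a prefix sum, as the total is
      -- zero.
      · have h4 := sum_Ico_consecutive (fun j => a j * x j - c j) h1 h2
        rw [tot] at h4
        obtain ⟨j, rfl⟩ := Nat.exists_eq_add_of_le h1
        rw [pre j (by omega)] at h4
        have h5 := hb.initial j (by omega)
        rw [← hqA, mul_assoc] at h5
        have := le_of_mul_le_mul_left h5 pA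
        linarith
      · rw [g2 t (by omega)]; exact hK.suffix_nonneg t (by omega) h2
    · intro t h1 h2 h3
      rcases lt_trichotomy (t + 1) (s + k) with h4 | h4 | h4
      · rw [x1 t (by omega), x1 _ h4] at h3
        exact absurd h3 (lt_irrefl _)
      · rw [h4, g2 _ le_rfl, hK.total]
      · rw [x2 t (by omega), x2 _ (by omega)] at h3
        rw [g2 _ (by omega)]
        exact hK.suffix_break t (by omega) h2 h3
    · intro b hb
      simp at hb
      subst hb
      exact x1 s (by omega)

theorem solveQP_spec (E : EigSolver) (hc : ∀ t < m, 0 < c t) (ha : ∀ t < m, 0 < a t) :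
    (solveQP ((List.range' 0 m).map c) ((List.range' 0 m).map a)).steps E ≤
      m * (6 * m + 1) + 3 * m ∧
    ∃ x : ℕ → ℝ, (solveQP ((List.range' 0 m).map c) ((List.range' 0 m).map a)).value E =
      (List.range' 0 m).map x ∧ KKT c a x 0 m := by
  obtain ⟨-, h1, x, h2, h3, -⟩ := expandBlocks_spec E hc ha
    (poolBlocks_pooled E hc ha (show 0 + m = m by omega))
  refine ⟨?_, x, by simpa [solveQP] using h2, h3⟩
  have h4 := steps_poolBlocks_le E ((List.range' 0 m).map c) ((List.range' 0 m).map a)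
  simp only [List.length_map, List.length_range'] at h4
  simp only [solveQP, Prog.steps_bind]
  omega

/-! ## The numbers `λ*` -/

theorem sum_map_flatten_eq_zero {α : Type*} {f : α → ℝ} {gs : List (List α)}
    (h : ∀ g ∈ gs, (g.map f).sum = 0) : (gs.flatten.map f).sum = 0 := by
  induction gs <;> simp_all

/-- The groups are cut exactly where `x` increases strictly, that is, where the suffix sums of the
gradient vanish. The first group is exempt from the last clause because its zero sum follows only
from the total over all indices. -/
theorem splitBlocks_spec (E : EigSolver) {x : ℕ → ℝ} (h : KKT c a x 0 m) {s d : ℕ}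
    (hs : s + d = m) {gs : List (List (ℝ × ℝ × ℝ))}
    (hgs : (splitBlocks ((List.range' s d).map fun t => (x t, c t, a t))).value E = gs) :
    gs.flatten = (List.range' s d).map (fun t => (x t, c t, a t)) ∧ (∀ g ∈ gs, g ≠ []) ∧
      (∀ g ∈ gs, ∀ p ∈ g, ∀ q ∈ g, p.1 = q.1) ∧
      ∀ g ∈ gs.tail, (g.map fun p => p.2.2 * p.1 - p.2.1).sum = 0 := by
  induction d generalizing s gs with
  | zero =>
    simp only [splitBlocks, List.range'_zero, List.map_nil, Prog.value_pure] at hgs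
    subst hgs
    simp
  | succ d ih =>
    simp only [List.range'_succ, List.map_cons, splitBlocks, Prog.value_bind] at hgs
    obtain ⟨i1, i2, i3, i4⟩ := ih (show s + 1 + d = m by omega) rfl
    have htot : ∀ t, t ≤ m → ∑ j ∈ Ico t m, (a j * x j - c j) =
        (((List.range' t (m - t)).map fun t => (x t, c t, a t)).map
          fun p => p.2.2 * p.1 - p.2.1).sum := fun t ht => by
      simp [Finset.sum, Finset.Ico, LocallyFiniteOrder.finsetIco, Function.comp_def]
    generalize (splitBlocks ((List.range' (s + 1) d).map fun t => (x t, c t, a t))).value E = gs0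
      at hgs i1 i2 i3 i4
    cases gs0 with
    | nil =>
      simp only [Prog.value_pure] at hgs
      subst hgs
      obtain rfl : 0 = d := by simpa using congrArg List.length i1
      simp
      rintro _ _ _ rfl _ _ _ _ _ rfl _ _
      rfl
    | cons g gs0 =>
      cases g with
      | nil => exact absurd rfl (i2 [] (by simp))
      | cons p g =>
        have hp : p = (x (s + 1), c (s + 1), a (s + 1)) ∧ 0 < d := by
          cases d with
          | zero => simp at i1
          | succ d =>
            simp [List.range'_succ] at i1
            exact ⟨i1.1, by omega⟩
        have hd := hp.2
        simp only [Prog.value_bind, value_le, Prog.value_ite, decide_eq_true_eq,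
          Prog.value_pure] at hgs
        split_ifs at hgs with hle
        · subst hgs
          rw [hp.1] at hle
          have hxx : x s = x (s + 1) := le_antisymm (h.mono s (by omega) (by omega)) hle
          refine ⟨?_, ?_, ?_, i4⟩
          · rw [List.range'_succ, List.map_cons, ← i1]; rfl
          · intro g' hg'
            rcases List.mem_cons.1 hg' with rfl | hg'
            · simp
            · exact i2 _ (by simp [hg'])
          · intro g' hg'
            rcases List.mem_cons.1 hg' with rfl | hg'
            · have hall : ∀ r ∈ (x s, c s, a s) :: p :: g, r.1 = x s := by
                intro r hr
                rcases List.mem_cons.1 hr with rfl | hr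
                · rfl
                · rw [i3 (p :: g) (by simp) r hr p (by simp), hp.1, hxx]
              intro r hr r' hr'
              rw [hall r hr, hall r' hr']
            · exact i3 g' (by simp [hg'])
        · subst hgs
          rw [hp.1] at hle
          refine ⟨?_, ?_, ?_, ?_⟩
          · simp [List.range'_succ, ← i1]
          · intro g' hg'
            rcases List.mem_cons.1 hg' with rfl | hg'
            · simp
            · exact i2 _ hg'
          · intro g' hg'
            rcases List.mem_cons.1 hg' with rfl | hg'
            · simp
            · exact i3 _ hg'
          · intro g' hg'
            simp only [List.tail_cons] at hg'
            rcases List.mem_cons.1 hg' with rfl | hg'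
            -- The suffix sum after the strict increase is zero and the later groups contribute
            -- nothing, so the former first group has zero sum.
            · have h5 := htot (s + 1) (by omega)
              rw [h.suffix_break s (by omega) (by omega) (not_le.1 hle),
                show m - (s + 1) = d by omega, ← i1, List.flatten_cons, List.map_append,
                List.sum_append, sum_map_flatten_eq_zero (gs := gs0) i4, add_zero] at h5
              exact h5.symm
            · exact i4 _ (by simpa using hg')

theorem steps_splitBlocks_le (E : EigSolver) (ts : List (ℝ × ℝ × ℝ)) :
    (splitBlocks ts).steps E ≤ 2 * ts.length := by
  induction ts with
  | nil => simp [splitBlocks]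
  | cons t ts ih =>
    simp only [splitBlocks, Prog.steps_bind, steps_tick, List.length_cons]
    split <;> simp <;> omega

theorem value_prependScaled (E : EigSolver) (q : ℝ) (ts : List (ℝ × ℝ × ℝ)) (r : List ℝ) :
    (prependScaled q ts r).value E = ts.map (fun t => t.2.1 * q) ++ r := by
  induction ts <;> simp_all [prependScaled]

theorem steps_prependScaled (E : EigSolver) (q : ℝ) (ts : List (ℝ × ℝ × ℝ)) (r : List ℝ) :
    (prependScaled q ts r).steps E = 2 * ts.length := by
  induction ts <;> simp_all [prependScaled]
  omega

/-- With `x` constant on a group and zero gradient sum, `∑ c = x ∑ a`; the factor `∑ a / ∑ c` is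
therefore `1 / x`. -/
theorem value_lambdaBlocks (E : EigSolver) (gs : List (List (ℝ × ℝ × ℝ)))
    (h0 : ∀ g ∈ gs, g ≠ []) (h1 : ∀ g ∈ gs, ∀ p ∈ g, ∀ q ∈ g, p.1 = q.1)
    (h2 : ∀ g ∈ gs, (g.map fun p => p.2.2 * p.1 - p.2.1).sum = 0)
    (h3 : ∀ g ∈ gs, ∀ p ∈ g, 0 < p.1 ∧ 0 < p.2.2) :
    (lambdaBlocks gs).value E = gs.flatten.map fun p => p.2.1 / p.1 := by
  induction gs with
  | nil => simp [lambdaBlocks]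
  | cons g gs ih =>
    simp only [lambdaBlocks, Prog.value_bind, value_mapP, Prog.value_pure, value_sum, value_div,
      value_prependScaled, List.flatten_cons, List.map_append]
    rw [ih (fun g hg => h0 g (by simp [hg])) (fun g hg => h1 g (by simp [hg]))
      (fun g hg => h2 g (by simp [hg])) (fun g hg => h3 g (by simp [hg]))]
    congr 1
    obtain ⟨p, g', hg⟩ := List.exists_cons_of_ne_nil (h0 g (by simp))
    have hp : ∀ q ∈ g, q.1 = p.1 := fun q hq => h1 g (by simp) q hq p (by simp [hg])
    have hpos : 0 < (g.map fun t => t.2.2).sum := by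
      refine List.sum_pos _ (fun y hy => ?_) (by simp [hg])
      obtain ⟨q, hq, rfl⟩ := List.mem_map.1 hy
      exact (h3 g (by simp) q hq).2
    have hp0 : 0 < p.1 := (h3 g (by simp) p (by simp [hg])).1
    have hsum : (g.map fun t => t.2.1).sum = (g.map fun t => t.2.2).sum * p.1 := by
      have h4 := h2 g (by simp)
      rw [List.map_congr_left (g := fun q => q.2.2 * p.1 - q.2.1) (fun q hq => by rw [hp q hq]),
        ← Multiset.sum_coe, ← Multiset.map_coe, Multiset.sum_map_sub, Multiset.sum_map_mul_right,
        sub_eq_zero] at h4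
      simpa using h4.symm
    refine List.map_congr_left fun q hq => ?_
    rw [hp q hq, hsum]
    field_simp

theorem steps_lambdaBlocks_le (E : EigSolver) (gs : List (List (ℝ × ℝ × ℝ)))
    (h0 : ∀ g ∈ gs, g ≠ []) : (lambdaBlocks gs).steps E ≤ 12 * gs.flatten.length := by
  induction gs with
  | nil => simp [lambdaBlocks]
  | cons g gs ih =>
    have h1 := ih fun g hg => h0 g (by simp [hg])
    have h2 := List.length_pos_of_ne_nil (h0 g (by simp))
    have h3 := steps_mapP_le E (g := fun t : ℝ × ℝ × ℝ => pure t.2.1) (xs := g) (s := 0) (by simp)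
    have h4 := steps_mapP_le E (g := fun t : ℝ × ℝ × ℝ => pure t.2.2) (xs := g) (s := 0) (by simp)
    simp only [lambdaBlocks, Prog.steps_bind, steps_tick, value_mapP, Prog.value_pure, steps_sum,
      List.length_map, steps_div, steps_prependScaled, List.flatten_cons, List.length_append]
    omega

theorem zipWith_map_map {α β γ ι : Type*} (g : α → β → γ) (f : ι → α) (f' : ι → β) (l : List ι) :
    List.zipWith g (l.map f) (l.map f') = l.map fun i => g (f i) (f' i) := by
  induction l <;> simp_all

theorem lambdaStar_spec (E : EigSolver) (ha : ∀ t < m, 0 < a t) {x : ℕ → ℝ} (h : KKT c a x 0 m) :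
    (lambdaStar ((List.range' 0 m).map x) ((List.range' 0 m).map c)
      ((List.range' 0 m).map a)).steps E ≤ 16 * m ∧
    (lambdaStar ((List.range' 0 m).map x) ((List.range' 0 m).map c)
      ((List.range' 0 m).map a)).value E = (List.range' 0 m).map fun t => c t / x t := by
  have s1 := steps_zipP_le E (g := fun c a : ℝ => pure (c, a)) (xs := (List.range' 0 m).map c)
    (ys := (List.range' 0 m).map a) (s := 0) (by simp)
  have s2 := steps_zipP_le E (g := fun (x : ℝ) (ca : ℝ × ℝ) => pure (x, ca))
    (xs := (List.range' 0 m).map x)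
    (ys := (List.range' 0 m).map fun t => (c t, a t)) (s := 0) (by simp)
  have s3 := steps_splitBlocks_le E ((List.range' 0 m).map fun t => (x t, c t, a t))
  obtain ⟨gs, hgs⟩ : ∃ gs, (splitBlocks ((List.range' 0 m).map fun t => (x t, c t, a t))).value E =
    gs := ⟨_, rfl⟩
  obtain ⟨i1, i2, i3, i4⟩ := splitBlocks_spec E h (show 0 + m = m by omega) hgs
  have s4 := steps_lambdaBlocks_le E gs i2
  have i5 : ∀ g ∈ gs, (g.map fun p => p.2.2 * p.1 - p.2.1).sum = 0 := by
    cases hgs' : gs with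
    | nil => simp
    | cons g gs' =>
      intro g' hg'
      rcases List.mem_cons.1 hg' with rfl | hg'
      -- Only here does the first group enter: the total gradient sum is zero and so is the sum over
      -- all other groups.
      · have h5 : ∑ j ∈ Ico 0 m, (a j * x j - c j) = (gs.flatten.map
            fun p => p.2.2 * p.1 - p.2.1).sum := by
          rw [i1]
          simp [Finset.sum, Finset.Ico, LocallyFiniteOrder.finsetIco, Function.comp_def]
        rw [hgs'] at i4
        rw [h.total, hgs', List.flatten_cons, List.map_append, List.sum_append,
          sum_map_flatten_eq_zero (gs := gs') i4, add_zero] at h5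
        exact h5.symm
      · rw [hgs'] at i4
        exact i4 _ (by simpa using hg')
  have i6 : ∀ g ∈ gs, ∀ p ∈ g, 0 < p.1 ∧ 0 < p.2.2 := by
    intro g hg p hp
    have h5 : p ∈ gs.flatten := List.mem_flatten.2 ⟨g, hg, hp⟩
    rw [i1] at h5
    obtain ⟨t, ht, rfl⟩ := List.mem_map.1 h5
    rw [List.mem_range'_1] at ht
    exact ⟨h.pos t (by omega) (by omega), ha t (by omega)⟩
  constructor
  · simp only [lambdaStar, Prog.steps_bind, value_zipP, Prog.value_pure, zipWith_map_map, hgs]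
    rw [i1] at s4
    simp only [List.length_map, List.length_range'] at s1 s2 s3 s4
    omega
  · simp only [lambdaStar, Prog.value_bind, value_zipP, Prog.value_pure, zipWith_map_map, hgs]
    rw [value_lambdaBlocks E gs i2 i3 i5 i6, i1]
    simp [Function.comp_def]

end

end Algo

end L2Dictionary

namespace L2Dictionary

namespace Algo

/-! ## Majorization -/

/-- `∑ (x - t)⁺` over a list. -/
noncomputable def excess (l : List ℝ) (t : ℝ) : ℝ := (l.map fun x => max (x - t) 0).sum

@[simp] theorem excess_nil (t : ℝ) : excess [] t = 0 := rfl

@[simp] theorem excess_cons (x : ℝ) (l : List ℝ) (t : ℝ) :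
    excess (x :: l) t = max (x - t) 0 + excess l t := by simp [excess]

theorem excess_nonneg (l : List ℝ) (t : ℝ) : 0 ≤ excess l t := by
  induction l with
  | nil => simp
  | cons x l ih => rw [excess_cons]; positivity

theorem excess_eq_zero {l : List ℝ} {t : ℝ} (h : ∀ x ∈ l, x ≤ t) : excess l t = 0 := by
  induction l with
  | nil => simp
  | cons x l ih =>
    rw [excess_cons, ih fun y hy => h y (by simp [hy]), add_zero, max_eq_right]
    linarith [h x (by simp)]

theorem excess_perm {l l' : List ℝ} (h : l.Perm l') (t : ℝ) : excess l t = excess l' t :=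
  (h.map _).sum_eq

/-- The list `bs` majorizes the list `as`. -/
structure Majorized (as bs : List ℝ) : Prop where
  length_eq : as.length = bs.length
  sum_eq : as.sum = bs.sum
  excess_le : ∀ t, excess as t ≤ excess bs t

/-- Expressing majorization by excesses rather than sorted partial sums makes it insensitive to
order, so re-sorting the frame is free. -/
theorem Majorized.perm {as bs bs' : List ℝ} (h : Majorized as bs) (hb : bs.Perm bs') :
    Majorized as bs' :=
  ⟨h.length_eq.trans hb.length_eq, h.sum_eq.trans hb.sum_eq, fun t => by
    rw [← excess_perm hb]; exact h.excess_le t⟩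

/-- At the threshold `p` the right-hand excess is zero, so nothing on the left may exceed `p`. -/
theorem Majorized.le_head {a p : ℝ} {as bs : List ℝ} (h : Majorized (a :: as) (p :: bs))
    (hp : ∀ b ∈ bs, b ≤ p) : a ≤ p := by
  have h1 := h.excess_le p
  rw [excess_cons, excess_cons, excess_eq_zero hp, sub_self, max_self, add_zero] at h1
  have h2 := excess_nonneg as p
  have h3 := le_max_left (a - p) 0
  linarith

theorem Majorized.tail {a : ℝ} {as bs : List ℝ} (h : Majorized (a :: as) (a :: bs)) :
    Majorized as bs := by
  refine ⟨by simpa using h.length_eq, by simpa using h.sum_eq, fun t => ?_⟩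
  simpa using h.excess_le t

/-- Otherwise every entry on the right exceeds `a`, while those on the left are at most `a`, against
the equality of sums. -/
theorem Majorized.exists_le {a p : ℝ} {as bs : List ℝ} (h : Majorized (a :: as) (p :: bs))
    (ha : ∀ x ∈ as, x ≤ a) (hp : a < p) : ∃ b ∈ bs, b ≤ a := by
  by_contra! hb
  have h1 := List.sum_le_card_nsmul as a ha
  have h2 := List.card_nsmul_le_sum bs a fun x hx => (hb x hx).le
  have h3 := h.sum_eq
  have h4 : as.length = bs.length := by simpa using h.length_eq
  rw [h4] at h1
  simp only [List.sum_cons] at h3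
  linarith

/-- Since no entry lies strictly between `q` and `a`, nor at `a` unless `a = q`, the excess is
affine on `[q, a]`. Here `k` counts the entries above `a`; each of them contributes at least `a -
t`. -/
theorem exists_excess_of_gap {a q t : ℝ} (hq : q ≤ t) (ht : t ≤ a) {l : List ℝ}
    (h : ∀ x ∈ l, a < x ∨ x ≤ q) :
    ∃ k : ℕ, excess l q = excess l t + k * (t - q) ∧ k * (a - t) ≤ excess l t := by
  induction l with
  | nil => exact ⟨0, by simp⟩
  | cons x l ih =>
    obtain ⟨k, h1, h2⟩ := ih fun y hy => h y (by simp [hy])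
    rcases h x (by simp) with hx | hx
    · refine ⟨k + 1, ?_, ?_⟩
      · rw [excess_cons, excess_cons, h1, max_eq_left (by linarith), max_eq_left (by linarith)]
        push_cast
        ring
      · rw [excess_cons, max_eq_left (by linarith)]
        push_cast
        linarith
    · refine ⟨k, ?_, ?_⟩
      · rw [excess_cons, excess_cons, h1, max_eq_right (by linarith), max_eq_right (by linarith)]
        ring
      · rw [excess_cons, max_eq_right (by linarith)]
        linarith

/-- Here `r` counts the entries above `t`: each contributes at most `a - t`, and gains `t - q` when
the threshold drops to `q`. -/
theorem exists_excess_of_le {a q t : ℝ} (hq : q ≤ t) {l : List ℝ}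
    (h : ∀ x ∈ l, x ≤ a) :
    ∃ r : ℕ, excess l t ≤ r * (a - t) ∧ excess l t + r * (t - q) ≤ excess l q := by
  induction l with
  | nil => exact ⟨0, by simp⟩
  | cons x l ih =>
    obtain ⟨r, h1, h2⟩ := ih fun y hy => h y (by simp [hy])
    have hx := h x (by simp)
    rcases lt_or_ge t x with hxt | hxt
    · refine ⟨r + 1, ?_, ?_⟩
      · rw [excess_cons, max_eq_left (by linarith)]
        push_cast
        linarith
      · rw [excess_cons, excess_cons, max_eq_left (by linarith), max_eq_left (by linarith)]
        push_cast
        linarith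
    · refine ⟨r, ?_, ?_⟩
      · rw [excess_cons, max_eq_right (by linarith)]
        linarith
      · rw [excess_cons, excess_cons, max_eq_right (by linarith)]
        linarith [le_max_right (x - q) 0]

/-- Replacing the largest entry `p` and the largest entry `q ≤ a` by `p + q - a` preserves
majorization of the tail. -/
theorem Majorized.step {a p q : ℝ} {as bs : List ℝ} (h : Majorized (a :: as) (p :: q :: bs))
    (ha : ∀ x ∈ as, x ≤ a) (hp : a < p) (hb : ∀ b ∈ bs, a < b ∨ b ≤ q) :
    Majorized as ((p + q - a) :: bs) := by
  refine ⟨by simpa using h.length_eq, ?_, fun t => ?_⟩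
  · have := h.sum_eq
    simp only [List.sum_cons] at this ⊢
    linarith
  rw [excess_cons]
  rcases le_or_gt a t with hat | hat
  · rw [excess_eq_zero fun x hx => (ha x hx).trans hat]
    have := excess_nonneg bs t
    positivity
  rcases le_or_gt t q with htq | htq
  · have h1 := h.excess_le t
    simp only [excess_cons] at h1
    rw [max_eq_left (by linarith), max_eq_left (by linarith), max_eq_left (by linarith)] at h1
    rw [max_eq_left (by linarith)]
    linarith
  · obtain ⟨k, k1, k2⟩ := exists_excess_of_gap htq.le hat.le hb
    obtain ⟨r, r1, r2⟩ := exists_excess_of_le htq.le ha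
    have h1 := h.excess_le q
    simp only [excess_cons, sub_self, max_self] at h1
    rw [max_eq_left (by linarith), max_eq_left (by linarith)] at h1
    -- For `q < t < a` the slopes decide. If `k < r`, the inequality at `q` is transported to `t`,
    -- and the surplus slope pays for the summand of `p + q - a`. If `r ≤ k`, already `r (a - t) ≤ k
    -- (a - t)` suffices.
    rcases Nat.lt_or_ge k r with hkr | hkr
    · have h2 : ((k : ℝ) + 1) * (t - q) ≤ r * (t - q) :=
        mul_le_mul_of_nonneg_right (by exact_mod_cast hkr) (by linarith)
      have h3 := le_max_left (p + q - a - t) 0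
      linarith
    · have h2 : (r : ℝ) * (a - t) ≤ k * (a - t) :=
        mul_le_mul_of_nonneg_right (by exact_mod_cast hkr) (by linarith)
      have h3 := le_max_right (p + q - a - t) 0
      linarith

/-- As `x` is non-increasing, the indicator of `x > t` is a non-increasing weight, and Abel
summation compares the sums over the indices where it is 1. There `x - t` is the excess of `x`,
while `y - t` is at most that of `y`; `y` need not be sorted. -/
theorem majorized_ofFn {K : ℕ} {x y : Fin K → ℝ} (hx : Antitone x)
    (h : ∀ k ≤ K, ∑ t ∈ Finset.range k, extendZero x t ≤ ∑ t ∈ Finset.range k, extendZero y t)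
    (hK : ∑ t ∈ Finset.range K, extendZero x t = ∑ t ∈ Finset.range K, extendZero y t) :
    Majorized (List.ofFn x) (List.ofFn y) := by
  have e : ∀ (z : Fin K → ℝ) (φ : ℝ → ℝ), (∑ i, φ (z i)) =
      ∑ t ∈ Finset.range K, φ (extendZero z t) := fun z φ => by
    rw [← Fin.sum_univ_eq_sum_range (fun t => φ (extendZero z t))]
    simp only [extendZero_apply]
  refine ⟨by simp, ?_, fun t => ?_⟩
  · rw [List.sum_ofFn, List.sum_ofFn]
    exact (e x id).trans (hK.trans (e y id).symm)
  · simp only [excess, List.map_ofFn, List.sum_ofFn, Function.comp]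
    rw [e x fun s => max (s - t) 0, e y fun s => max (s - t) 0]
    have h1 : 0 ≤ ∑ s ∈ Finset.range K, (if t < extendZero x s then (1 : ℝ) else 0) *
        (extendZero y s - extendZero x s) := by
      refine sum_mul_nonneg_of_antitone (fun s _ => ?_) (fun s hs => ?_) fun k hk => ?_
      · split_ifs <;> norm_num
      · have : extendZero x (s + 1) ≤ extendZero x s := by
          rw [extendZero_of_lt x hs, extendZero_of_lt x (show s < K by omega)]
          exact hx (by simp [Fin.le_def])
        split_ifs <;> first | (exfalso; linarith) | norm_num
      · rw [Finset.sum_sub_distrib]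
        linarith [h k hk]
    rw [← sub_nonneg, ← Finset.sum_sub_distrib]
    refine h1.trans (Finset.sum_le_sum fun s _ => ?_)
    split_ifs with hs
    · rw [max_eq_left (by linarith : 0 ≤ extendZero x s - t)]
      linarith [le_max_left (extendZero y s - t) 0]
    · rw [max_eq_right (by linarith : extendZero x s - t ≤ 0)]
      linarith [le_max_right (extendZero y s - t) 0]

/-! ## Sorting and searching -/

theorem insertDesc_perm (E : EigSolver) (p : ℝ × List ℝ) (qs : List (ℝ × List ℝ)) :
    ((insertDesc p qs).value E).Perm (p :: qs) := by
  induction qs with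
  | nil => simp [insertDesc]
  | cons q qs ih =>
    simp only [insertDesc, Prog.value_bind, value_le, Prog.value_ite, decide_eq_true_eq,
      Prog.value_pure]
    split_ifs
    · exact List.Perm.refl _
    · exact (ih.cons q).trans (List.Perm.swap p q qs)

theorem insertDesc_sorted (E : EigSolver) (p : ℝ × List ℝ) {qs : List (ℝ × List ℝ)}
    (h : qs.Pairwise fun a b => b.1 ≤ a.1) :
    ((insertDesc p qs).value E).Pairwise fun a b => b.1 ≤ a.1 := by
  induction qs with
  | nil => simp [insertDesc]
  | cons q qs ih =>
    rw [List.pairwise_cons] at h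
    simp only [insertDesc, Prog.value_bind, value_le, Prog.value_ite, decide_eq_true_eq,
      Prog.value_pure]
    split_ifs with hq
    · rw [List.pairwise_cons, List.pairwise_cons]
      refine ⟨fun r hr => ?_, h⟩
      rcases List.mem_cons.1 hr with rfl | hr
      · exact hq
      · exact (h.1 r hr).trans hq
    · rw [List.pairwise_cons]
      refine ⟨fun r hr => ?_, ih h.2⟩
      rcases List.mem_cons.1 ((insertDesc_perm E p qs).mem_iff.1 hr) with rfl | hr
      · exact (not_le.1 hq).le
      · exact h.1 r hr

theorem steps_insertDesc_le (E : EigSolver) (p : ℝ × List ℝ) (qs : List (ℝ × List ℝ)) :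
    (insertDesc p qs).steps E ≤ 2 * qs.length := by
  induction qs with
  | nil => simp [insertDesc]
  | cons q qs ih =>
    simp only [insertDesc, Prog.steps_bind, value_le, Prog.steps_ite, decide_eq_true_eq,
      Prog.steps_pure, steps_tick, steps_le, List.length_cons]
    split_ifs <;> omega

theorem sortDesc_perm (E : EigSolver) (ps : List (ℝ × List ℝ)) :
    ((sortDesc ps).value E).Perm ps := by
  induction ps with
  | nil => simp [sortDesc]
  | cons p ps ih =>
    simp only [sortDesc, Prog.value_bind]
    exact (insertDesc_perm E p _).trans (ih.cons p)

theorem sortDesc_sorted (E : EigSolver) (ps : List (ℝ × List ℝ)) :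
    ((sortDesc ps).value E).Pairwise fun a b => b.1 ≤ a.1 := by
  induction ps with
  | nil => simp [sortDesc]
  | cons p ps ih =>
    simp only [sortDesc, Prog.value_bind]
    exact insertDesc_sorted E p ih

theorem steps_sortDesc_le (E : EigSolver) (ps : List (ℝ × List ℝ)) :
    (sortDesc ps).steps E ≤ ps.length * (2 * ps.length + 1) := by
  induction ps with
  | nil => simp [sortDesc]
  | cons p ps ih =>
    have h1 := steps_insertDesc_le E p ((sortDesc ps).value E)
    rw [(sortDesc_perm E ps).length_eq] at h1
    simp only [sortDesc, Prog.steps_bind, steps_tick, List.length_cons]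
    nlinarith

/-- In a sorted list the first entry at most `a` is the largest such entry, so the remaining values
leave a gap between it and `a`; this is the hypothesis of `Majorized.step`. -/
theorem extract_spec (E : EigSolver) {a : ℝ} {ps : List (ℝ × List ℝ)}
    (hs : ps.Pairwise fun a b => b.1 ≤ a.1) (h : ∃ p ∈ ps, p.1 ≤ a) :
    ∃ q others, (extract a ps).value E = some (q, others) ∧ ps.Perm (q :: others) ∧ q.1 ≤ a ∧
      ∀ o ∈ others, a < o.1 ∨ o.1 ≤ q.1 := by
  induction ps with
  | nil => simp at h
  | cons p ps ih =>
    rw [List.pairwise_cons] at hs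
    simp only [extract, Prog.value_bind, value_le, Prog.value_ite, decide_eq_true_eq,
      Prog.value_pure]
    split_ifs with hp
    · exact ⟨p, ps, rfl, List.Perm.refl _, hp, fun o ho => Or.inr (hs.1 o ho)⟩
    · obtain ⟨q, others, h1, h2, h3, h4⟩ := ih hs.2 (by
        obtain ⟨r, hr, hra⟩ := h
        rcases List.mem_cons.1 hr with rfl | hr
        · exact absurd hra hp
        · exact ⟨r, hr, hra⟩)
      refine ⟨q, p :: others, by rw [h1]; rfl, (h2.cons p).trans (List.Perm.swap _ _ _), h3,
        fun o ho => ?_⟩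
      rcases List.mem_cons.1 ho with rfl | ho
      · exact Or.inl (not_le.1 hp)
      · exact h4 o ho

theorem steps_extract_le (E : EigSolver) (a : ℝ) (ps : List (ℝ × List ℝ)) :
    (extract a ps).steps E ≤ 2 * ps.length := by
  induction ps with
  | nil => simp [extract]
  | cons p ps ih =>
    simp only [extract, Prog.steps_bind, value_le, Prog.steps_ite, decide_eq_true_eq,
      Prog.steps_pure, steps_tick, steps_le, List.length_cons]
    split_ifs
    · omega
    · split <;> simp only [Prog.steps_pure] <;> omega

/-! ## Computation of the orthonormal basis -/

theorem value_quad (E : EigSolver) {K : ℕ} (Lam w : Fin K → ℝ) :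
    (quad (List.ofFn Lam) (List.ofFn w)).value E = w ⬝ᵥ (Lam * w) := by
  simp [quad, zipWith_ofFn, List.sum_ofFn, dotProduct]

theorem steps_quad_le (E : EigSolver) {K : ℕ} (Lam w : Fin K → ℝ) :
    (quad (List.ofFn Lam) (List.ofFn w)).steps E ≤ 6 * K + 1 := by
  have h1 := steps_zipP_le E (g := mul) (xs := List.ofFn Lam) (ys := List.ofFn w) (s := 1)
    (by simp)
  have h2 := steps_dot_le E (List.ofFn w) (List.zipWith (· * ·) (List.ofFn Lam) (List.ofFn w))
  simp only [quad, Prog.steps_bind, value_zipP, value_mul, List.length_ofFn] at h1 h2 ⊢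
  omega

theorem value_rotate (E : EigSolver) {K : ℕ} (s t : ℝ) (u w : Fin K → ℝ) :
    (rotate s t (List.ofFn u) (List.ofFn w)).value E =
      List.ofFn ((s / √(s * s + t * t)) • u + (t / √(s * s + t * t)) • w) := by
  simp only [rotate, Prog.value_bind, value_mul, value_add, value_sqrt, value_div, value_scale,
    value_addVec, List.map_ofFn, zipWith_ofFn]
  rfl

theorem steps_rotate_le (E : EigSolver) {K : ℕ} (s t : ℝ) (u w : Fin K → ℝ) :
    (rotate s t (List.ofFn u) (List.ofFn w)).steps E ≤ 6 * K + 6 := by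
  have h1 := steps_scale_le E (s / √(s * s + t * t)) (List.ofFn u)
  have h2 := steps_scale_le E (t / √(s * s + t * t)) (List.ofFn w)
  have h3 := steps_addVec_le E ((List.ofFn u).map ((s / √(s * s + t * t)) * ·))
    ((List.ofFn w).map ((t / √(s * s + t * t)) * ·))
  simp only [rotate, Prog.steps_bind, value_mul, value_add, value_sqrt, value_div,
    value_scale, steps_mul, steps_add, steps_sqrt, steps_div, List.length_ofFn,
    List.length_map] at h1 h2 h3 ⊢
  omega

/-- The weights are in the ratio `√(a - q) : √(p - a)`, so after normalization their squares are `(a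
- q) / (p - q)` and `(p - a) / (p - q)`, which express `a` as a convex combination of `p` and `q`.
-/
theorem rotation_coefficients {p q a θ : ℝ} (hq : q ≤ a) (hp : a < p)
    (hθ : θ = √(a - q) / (√(a - q) + √(p - a))) :
    (θ / √(θ * θ + (1 - θ) * (1 - θ))) ^ 2 + ((1 - θ) / √(θ * θ + (1 - θ) * (1 - θ))) ^ 2 = 1 ∧
    (θ / √(θ * θ + (1 - θ) * (1 - θ))) ^ 2 * p +
      ((1 - θ) / √(θ * θ + (1 - θ) * (1 - θ))) ^ 2 * q = a := by
  have hα := Real.sq_sqrt (sub_nonneg.2 hq)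
  have hβ := Real.sq_sqrt (sub_nonneg.2 hp.le)
  have hβ0 : 0 < √(p - a) := Real.sqrt_pos.2 (sub_pos.2 hp)
  have hα0 := Real.sqrt_nonneg (a - q)
  set α := √(a - q)
  set β := √(p - a)
  have hγ : α + β ≠ 0 := by positivity
  have hθ' : 1 - θ = β / (α + β) := by rw [hθ]; field_simp; ring
  have hr0 : 0 < θ * θ + (1 - θ) * (1 - θ) := by nlinarith [sq_nonneg (2 * θ - 1)]
  have hr := Real.sq_sqrt hr0.le
  have hr1 : (√(θ * θ + (1 - θ) * (1 - θ))) ≠ 0 := (Real.sqrt_pos.2 hr0).ne'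
  rw [div_pow, div_pow, hr]
  constructor
  · rw [← add_div, sq, sq]
    exact div_self hr0.ne'
  · have hpq : p - q ≠ 0 := by linarith
    have e1 : θ * θ + (1 - θ) * (1 - θ) = (p - q) / (α + β) ^ 2 := by
      rw [hθ', hθ, div_mul_div_comm, div_mul_div_comm, ← add_div, ← sq, ← sq, ← sq, hα, hβ]
      congr 1
      ring
    rw [e1, hθ', hθ, div_pow, div_pow, hα, hβ]
    field_simp
    ring

/-- The vector encoded by the second component of a pair. -/
def decode (K : ℕ) (p : ℝ × List ℝ) : Fin K → ℝ := fun i => p.2.getD i 0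

theorem decode_mk_ofFn {K : ℕ} (b : ℝ) (w : Fin K → ℝ) : decode K (b, List.ofFn w) = w := by
  funext i
  simp [decode, List.getD_eq_getElem?_getD]

/-- A list of pairs `(⟨w, Λ w⟩, w)` with orthonormal and `Λ`-orthogonal vectors `w`. -/
structure IsFrame {K : ℕ} (Lam : Fin K → ℝ) (ps : List (ℝ × List ℝ)) : Prop where
  enc : ∀ p ∈ ps, p.2 = List.ofFn (decode K p)
  val : ∀ p ∈ ps, p.1 = decode K p ⬝ᵥ (Lam * decode K p)
  unit : ∀ p ∈ ps, decode K p ⬝ᵥ decode K p = 1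
  orth : ps.Pairwise fun p q => decode K p ⬝ᵥ decode K q = 0 ∧ decode K p ⬝ᵥ (Lam * decode K q) = 0

theorem dotProduct_mul_comm {K : ℕ} (Lam u w : Fin K → ℝ) :
    u ⬝ᵥ (Lam * w) = w ⬝ᵥ (Lam * u) := by
  simp only [dotProduct, Pi.mul_apply]
  exact Finset.sum_congr rfl fun i _ => by ring

theorem IsFrame.perm {K : ℕ} {Lam : Fin K → ℝ} {ps ps' : List (ℝ × List ℝ)} (h : IsFrame Lam ps)
    (hp : ps.Perm ps') : IsFrame Lam ps' :=
  ⟨fun p hp' => h.enc p (hp.mem_iff.2 hp'), fun p hp' => h.val p (hp.mem_iff.2 hp'),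
    fun p hp' => h.unit p (hp.mem_iff.2 hp'), (hp.pairwise_iff (fun {p q} hpq => by
      rwa [dotProduct_comm, dotProduct_mul_comm])).1 h.orth⟩

theorem IsFrame.tail {K : ℕ} {Lam : Fin K → ℝ} {p : ℝ × List ℝ} {ps : List (ℝ × List ℝ)}
    (h : IsFrame Lam (p :: ps)) : IsFrame Lam ps :=
  ⟨fun q hq => h.enc q (by simp [hq]), fun q hq => h.val q (by simp [hq]),
    fun q hq => h.unit q (by simp [hq]), h.orth.of_cons⟩

section

variable {K : ℕ} {Lam : Fin K → ℝ}

theorem dot_combination (B : Fin K → ℝ) (u w z : Fin K → ℝ) (s t : ℝ) :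
    z ⬝ᵥ (B * (s • u + t • w)) = s * (z ⬝ᵥ (B * u)) + t * (z ⬝ᵥ (B * w)) := by
  rw [mul_add, dotProduct_add, mul_smul_comm, mul_smul_comm, dotProduct_smul, dotProduct_smul,
    smul_eq_mul, smul_eq_mul]

theorem combination_dot (B : Fin K → ℝ) (u w z : Fin K → ℝ) (s t : ℝ) :
    (s • u + t • w) ⬝ᵥ (B * z) = s * (u ⬝ᵥ (B * z)) + t * (w ⬝ᵥ (B * z)) := by
  rw [add_dotProduct, smul_dotProduct, smul_dotProduct, smul_eq_mul, smul_eq_mul]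

/-- Orthogonality and `Λ`-orthogonality of the two vectors remove the cross terms. Only one
combination is put back into the frame: the two rotated vectors are in general not `Λ`-orthogonal to
each other, but the emitted one is no longer needed there. -/
theorem IsFrame.rotate {p q : ℝ × List ℝ} {others : List (ℝ × List ℝ)}
    (h : IsFrame Lam (p :: q :: others)) {s t : ℝ} (hst : s ^ 2 + t ^ 2 = 1) :
    IsFrame Lam (((s ^ 2 * p.1 + t ^ 2 * q.1), List.ofFn (s • decode K p + t • decode K q)) ::
      others) := by
  have ho := h.orth
  rw [List.pairwise_cons, List.pairwise_cons] at ho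
  have hpq := ho.1 q (by simp)
  have up := h.unit p (by simp)
  have uq := h.unit q (by simp)
  have vp := h.val p (by simp)
  have vq := h.val q (by simp)
  refine ⟨?_, ?_, ?_, ?_⟩
  · intro r hr
    rcases List.mem_cons.1 hr with rfl | hr
    · rw [decode_mk_ofFn]
    · exact h.enc r (by simp [hr])
  · intro r hr
    rcases List.mem_cons.1 hr with rfl | hr
    · rw [decode_mk_ofFn, dot_combination, combination_dot, combination_dot, ← vp, ← vq,
        dotProduct_mul_comm Lam (decode K q), hpq.2]
      ring
    · exact h.val r (by simp [hr])
  · intro r hr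
    rcases List.mem_cons.1 hr with rfl | hr
    · simp only [decode_mk_ofFn, add_dotProduct, dotProduct_add, smul_dotProduct, dotProduct_smul,
        hpq.1, up, uq, dotProduct_comm (decode K q) (decode K p), smul_eq_mul]
      linear_combination hst
    · exact h.unit r (by simp [hr])
  · rw [List.pairwise_cons]
    refine ⟨fun r hr => ?_, ho.2.2⟩
    have h1 := ho.1 r (by simp [hr])
    have h2 := ho.2.1 r hr
    have := combination_dot 1 (decode K p) (decode K q) (decode K r) s t
    simp only [one_mul] at this
    rw [decode_mk_ofFn, combination_dot, this, h1.1, h1.2, h2.1, h2.2]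
    simp

-- The invariant is a sorted frame whose values majorize the remaining lengths. The last clause says
-- that all outputs lie in the span of the current frame; applied to a newly emitted vector it gives
-- its orthogonality to all later ones.
set_option maxHeartbeats 1000000 in
theorem basisLoop_spec (E : EigSolver) {as : List ℝ} {ps : List (ℝ × List ℝ)}
    (hf : IsFrame Lam ps) (hs : ps.Pairwise fun a b => b.1 ≤ a.1)
    (hm : Majorized as (ps.map Prod.fst)) (ha : as.Pairwise fun a b => b ≤ a)
    (hK : as.length ≤ K) :
    (basisLoop (List.ofFn Lam) as ps).steps E ≤ as.length * (2 * K ^ 2 + 21 * K + 25) ∧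
    ∃ ys : List (Fin K → ℝ), (basisLoop (List.ofFn Lam) as ps).value E = ys.map List.ofFn ∧
      List.Forall₂ (fun y a => y ⬝ᵥ (Lam * y) = a) ys as ∧ (∀ y ∈ ys, y ⬝ᵥ y = 1) ∧
      ys.Pairwise (fun y z => y ⬝ᵥ z = 0) ∧
      ∀ z, (∀ p ∈ ps, z ⬝ᵥ decode K p = 0) → ∀ y ∈ ys, z ⬝ᵥ y = 0 := by
  induction as generalizing ps with
  | nil => exact ⟨by simp [basisLoop], [], by simp [basisLoop], by simp⟩
  | cons a as ih =>
    cases ps with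
    | nil => simpa using hm.length_eq
    | cons p rest =>
      rw [List.pairwise_cons] at hs ha
      have hlen : as.length = rest.length := by simpa using hm.length_eq
      have hle := hm.le_head (by simpa using fun a b hab => hs.1 (a, b) hab)
      simp only [basisLoop, Prog.value_bind, value_le, Prog.value_ite, decide_eq_true_eq,
        Prog.value_pure, Prog.steps_bind, steps_tick, steps_le, Prog.steps_ite, Prog.steps_pure]
      split_ifs with hpa
      · obtain rfl : p.1 = a := le_antisymm hpa hle
        obtain ⟨h0, ys, h1, h2, h3, h4, h5⟩ := ih hf.tail hs.2 hm.tail ha.2 (by simp at hK; omega)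
        have ho := hf.orth
        rw [List.pairwise_cons] at ho
        refine ⟨?_, decode K p :: ys, ?_, ?_, ?_, ?_, ?_⟩
        · have : 2 ≤ 2 * K ^ 2 + 21 * K + 25 := by omega
          rw [List.length_cons, add_mul, one_mul]
          linarith
        · rw [h1, List.map_cons, ← hf.enc p (by simp)]
        · exact List.Forall₂.cons (hf.val p (by simp)).symm h2
        · intro y hy
          rcases List.mem_cons.1 hy with rfl | hy
          · exact hf.unit p (by simp)
          · exact h3 y hy
        · exact List.pairwise_cons.2 ⟨h5 _ fun q hq => (ho.1 q hq).1, h4⟩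
        · intro z hz y hy
          rcases List.mem_cons.1 hy with rfl | hy
          · exact hz p (by simp)
          · exact h5 z (fun q hq => hz q (by simp [hq])) y hy
      · have hpa := not_le.1 hpa
        obtain ⟨q, others, hx, hperm, hqa, hoth⟩ := extract_spec E hs.2 (a := a) (by
          obtain ⟨b, hb, hba⟩ := hm.exists_le ha.1 hpa
          obtain ⟨q, hq, rfl⟩ := List.mem_map.1 hb
          exact ⟨q, hq, hba⟩)
        have hf' := hf.perm (hperm.cons p)
        have hm' := hm.perm ((hperm.cons p).map Prod.fst)
        have hm'' := hm'.step ha.1 hpa (by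
          intro b hb
          obtain ⟨o, ho, rfl⟩ := List.mem_map.1 hb
          exact hoth o ho)
        obtain ⟨θ, hθ⟩ : ∃ θ, θ = √(a - q.1) / (√(a - q.1) + √(p.1 - a)) := ⟨_, rfl⟩
        obtain ⟨c1, c2⟩ := rotation_coefficients hqa hpa hθ
        -- Both rotated vectors have the same normalizing factor, so their coefficients are `(s, t)`
        -- and `(t, -s)`.
        have hr2 : √((1 - θ) * (1 - θ) + (0 - θ) * (0 - θ)) = √(θ * θ + (1 - θ) * (1 - θ)) := by
          congr 1; ring
        set r := √(θ * θ + (1 - θ) * (1 - θ)) with hr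
        set s := θ / r with hsdef
        set t := (1 - θ) / r with htdef
        have hneg : (0 - θ) / r = -s := by rw [hsdef]; ring
        have ep := hf'.enc p (by simp)
        have eq := hf'.enc q (by simp)
        set u := decode K p with hu
        set w := decode K q with hw
        have hv : IsFrame Lam ((t ^ 2 * p.1 + (-s) ^ 2 * q.1, List.ofFn (t • u + (-s) • w)) :: others) :=
          hf'.rotate (by rw [← c1]; ring)
        have hy : IsFrame Lam ((s ^ 2 * p.1 + t ^ 2 * q.1, List.ofFn (s • u + t • w)) :: others) :=
          hf'.rotate c1
        -- A rotation preserves the trace of the form on the plane, so the partner of a vector with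
        -- value `a` has value `p + q - a`, the entry required by `Majorized.step`.
        have hbv : t ^ 2 * p.1 + (-s) ^ 2 * q.1 = p.1 + q.1 - a := by
          have : p.1 + q.1 = (s ^ 2 + t ^ 2) * (p.1 + q.1) := by rw [c1, one_mul]
          linarith
        have hval := hv.val _ (List.mem_cons_self ..)
        rw [decode_mk_ofFn] at hval
        dsimp only at hval
        simp only [hx, value_sub, value_sqrt, value_add, value_div, value_one, value_zero, ← hθ,
          Prog.value_bind, Prog.value_pure, Prog.steps_bind, steps_sub, steps_sqrt, steps_add,
          steps_div, steps_one, steps_zero, Prog.steps_pure]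
        rw [ep, eq]
        simp only [value_rotate, hr2, ← hr, ← hsdef, ← htdef, hneg, value_quad]
        rw [← hval]
        set next := ((t ^ 2 * p.1 + (-s) ^ 2 * q.1, List.ofFn (t • u + (-s) • w)) :: others)
          with hnext
        have hsp := sortDesc_perm E next
        obtain ⟨h0, ys, h1, h2, h3, h4, h5⟩ := ih (ps := (sortDesc next).value E)
          (hv.perm hsp.symm) (sortDesc_sorted E next) (by
            refine Majorized.perm ?_ (hsp.map Prod.fst).symm
            rw [hnext, List.map_cons, hbv]
            exact hm'') ha.2 (by simp at hK; omega)
        refine ⟨?_, (s • u + t • w) :: ys, ?_, ?_, ?_, ?_, ?_⟩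
        -- One round costs at most `2` for call and comparison, `2K` for the search, `10` scalar
        -- instructions, `2(6K + 6)` for the rotations, `6K + 1` for the form and `2K² + K` for
        -- sorting.
        · have k1 := steps_extract_le E a rest
          have k2 := steps_rotate_le E θ (1 - θ) u w
          have k3 := steps_rotate_le E (1 - θ) (0 - θ) u w
          have k4 := steps_quad_le E Lam (t • u + (-s) • w)
          have k5 := steps_sortDesc_le E next
          have k6 : next.length ≤ K := by
            have := hperm.length_eq
            simp only [List.length_cons, hnext] at this hK ⊢
            omega
          have k7 : rest.length ≤ K := by simp at hK; omega
          have k8 : next.length * (2 * next.length + 1) ≤ K * (2 * K + 1) := by gcongr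
          have k9 : K * (2 * K + 1) = 2 * K ^ 2 + K := by ring
          rw [List.length_cons, add_mul, one_mul]
          linarith
        · rw [h1, List.map_cons]
        · refine List.Forall₂.cons ?_ h2
          have := hy.val _ (List.mem_cons_self ..)
          rw [decode_mk_ofFn] at this
          rw [← this]
          exact c2
        · intro y hy'
          rcases List.mem_cons.1 hy' with rfl | hy'
          · have := hy.unit _ (List.mem_cons_self ..)
            rwa [decode_mk_ofFn] at this
          · exact h3 y hy'
        -- The emitted vector is orthogonal to its partner, since `(s, t) ⊥ (t, -s)`, and to the
        -- untouched vectors of the frame, hence to everything computed from them.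
        · refine List.pairwise_cons.2 ⟨h5 _ fun o ho => ?_, h4⟩
          rcases List.mem_cons.1 (hsp.mem_iff.1 ho) with rfl | ho
          · rw [decode_mk_ofFn]
            have ho' := hf'.orth
            rw [List.pairwise_cons] at ho'
            have h6 := (ho'.1 q (by simp)).1
            have h7 := hf'.unit p (by simp)
            have h8 := hf'.unit q (by simp)
            rw [← hu, ← hw] at h6
            rw [← hu] at h7
            rw [← hw] at h8
            simp only [add_dotProduct, dotProduct_add, smul_dotProduct, dotProduct_smul, h6, h7, h8,
              dotProduct_comm w u, smul_eq_mul]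
            ring
          · have := hy.orth
            rw [List.pairwise_cons] at this
            have := (this.1 o ho).1
            rwa [decode_mk_ofFn] at this
        · intro z hz y hy'
          have zp := hz p (by simp)
          have zq := hz q (by simp [hperm.mem_iff])
          rw [← hu] at zp
          rw [← hw] at zq
          rcases List.mem_cons.1 hy' with rfl | hy'
          · rw [dotProduct_add, dotProduct_smul, dotProduct_smul, zp, zq]; simp
          · refine h5 z (fun o ho => ?_) y hy'
            rcases List.mem_cons.1 (hsp.mem_iff.1 ho) with rfl | ho
            · rw [decode_mk_ofFn, dotProduct_add, dotProduct_smul, dotProduct_smul, zp, zq]; simp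
            · exact hz o (by simp [hperm.mem_iff, ho])

theorem orthonormalBasis_spec (E : EigSolver) {len : Fin K → ℝ} (hlen : Antitone len)
    (hm : Majorized (List.ofFn len) (List.ofFn Lam)) :
    (orthonormalBasis K (List.ofFn Lam) (List.ofFn len)).steps E ≤
      K * (2 * K ^ 2 + 32 * K + 31) ∧
    ∃ y : Fin K → Fin K → ℝ, (orthonormalBasis K (List.ofFn Lam) (List.ofFn len)).value E =
      List.ofFn (fun t => List.ofFn (y t)) ∧ (∀ t, y t ⬝ᵥ (Lam * y t) = len t) ∧
      ∀ s t, y s ⬝ᵥ y t = if s = t then 1 else 0 := by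
  set ps : List (ℝ × List ℝ) := List.ofFn fun i : Fin K =>
    (Lam i, List.ofFn (Pi.single i (1 : ℝ) : Fin K → ℝ)) with hps
  have hps' : (((stdBasis K : Prog ℝ _).value E).map fun u =>
      ((quad (List.ofFn Lam) u).value E, u)) = ps := by
    rw [value_stdBasis, List.map_ofFn, hps]
    congr 1
    funext i
    simp [value_quad]
  have hsp := sortDesc_perm E ps
  have hf : IsFrame Lam ps := by
    refine ⟨?_, ?_, ?_, ?_⟩
    · intro p hp
      obtain ⟨i, rfl⟩ := (List.mem_ofFn' _ _).1 hp
      rw [decode_mk_ofFn]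
    · intro p hp
      obtain ⟨i, rfl⟩ := (List.mem_ofFn' _ _).1 hp
      rw [decode_mk_ofFn]
      simp
    · intro p hp
      obtain ⟨i, rfl⟩ := (List.mem_ofFn' _ _).1 hp
      rw [decode_mk_ofFn]
      simp
    · rw [hps, List.pairwise_ofFn]
      intro i j hij
      rw [decode_mk_ofFn, decode_mk_ofFn]
      simp [hij.ne]
  obtain ⟨h0, ys, h1, h2, h3, h4, -⟩ := basisLoop_spec E (as := List.ofFn len)
    (hf.perm hsp.symm) (sortDesc_sorted E ps) (by
      refine Majorized.perm ?_ (hsp.map Prod.fst).symm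
      rw [hps, List.map_ofFn]
      exact hm) (by
      rw [List.pairwise_ofFn]
      exact fun i j hij => hlen hij.le) (by simp)
  have hl : ys.length = K := by simpa using h2.length_eq
  refine ⟨?_, fun t => ys.get (t.cast hl.symm), ?_, ?_, ?_⟩
  · have k1 := steps_stdBasis_le E K
    have k2 := steps_mapP_le E (g := fun u => do
      let b ← quad (List.ofFn Lam) u
      pure (b, u)) (xs := (stdBasis K : Prog ℝ _).value E) (s := 6 * K + 1) (by
        intro u hu
        rw [value_stdBasis] at hu
        obtain ⟨i, rfl⟩ := (List.mem_ofFn' _ _).1 hu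
        simpa using steps_quad_le E Lam (Pi.single i 1))
    have k3 := steps_sortDesc_le E ps
    have k4 : ((stdBasis K : Prog ℝ _).value E).length = K := by rw [value_stdBasis]; simp
    rw [k4] at k2
    simp only [hps, List.length_ofFn] at k3 h0
    simp only [orthonormalBasis, Prog.steps_bind, Prog.value_bind, value_mapP, Prog.value_pure,
      hps']
    rw [← hps] at k3 h0
    nlinarith
  · simp only [orthonormalBasis, Prog.value_bind, value_mapP, Prog.value_pure, hps', h1]
    apply List.ext_getElem <;> simp [hl]
  · intro t
    have := (List.forall₂_iff_get.1 h2).2 t (by rw [hl]; exact t.2) (by simp)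
    simpa using this
  · intro s t
    rcases lt_trichotomy s t with hst | rfl | hst
    · rw [if_neg hst.ne]
      exact List.pairwise_iff_get.1 h4 _ _ (Fin.lt_def.2 hst)
    · rw [if_pos rfl]
      exact h3 _ (List.get_mem _ _)
    · rw [if_neg hst.ne', dotProduct_comm]
      exact List.pairwise_iff_get.1 h4 _ _ (Fin.lt_def.2 hst)

end

end Algo

end L2Dictionary

namespace L2Dictionary

open Finset

/-! ## Sorted eigenbases -/

section Eigenbasis

variable {n : ℕ} {A : Matrix (Fin n) (Fin n) ℝ} {τ : Fin n → ℝ}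
  {w : Fin n → EuclideanSpace ℝ (Fin n)}

theorem inner_eq_dotProduct {k : ℕ} (x y : EuclideanSpace ℝ (Fin k)) :
    inner ℝ x y = x.ofLp ⬝ᵥ y.ofLp := by
  rw [EuclideanSpace.inner_eq_star_dotProduct, dotProduct_comm]
  simp

theorem Orthonormal.inner_eq_ite {ι : Type*} [DecidableEq ι] {n : ℕ}
    {u : ι → EuclideanSpace ℝ (Fin n)} (h : Orthonormal ℝ u) (i j : ι) :
    inner ℝ (u i) (u j) = if i = j then (1 : ℝ) else 0 :=
  orthonormal_iff_ite.1 h i j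

/-- The orthogonal matrix with the given columns. -/
def columns (w : Fin n → EuclideanSpace ℝ (Fin n)) : Matrix (Fin n) (Fin n) ℝ :=
  Matrix.of fun i j => w j i

theorem columns_transpose_mul (hw : Orthonormal ℝ w) :
    (columns w).transpose * columns w = 1 := by
  ext i j
  have := Orthonormal.inner_eq_ite hw i j
  rw [inner_eq_dotProduct] at this
  simpa [columns, Matrix.mul_apply, Matrix.one_apply, dotProduct] using this

theorem columns_mul_transpose (hw : Orthonormal ℝ w) :
    columns w * (columns w).transpose = 1 :=
  mul_eq_one_comm.1 (columns_transpose_mul hw)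

theorem eq_conj_diagonal (h : IsOrthonormalEigenseq A τ w) :
    A = columns w * Matrix.diagonal τ * (columns w).transpose := by
  have h1 : A * columns w = columns w * Matrix.diagonal τ := by
    ext i j
    have := congrFun (h.2 j) i
    simp only [Pi.smul_apply, smul_eq_mul] at this
    rw [Matrix.mul_diagonal, mul_comm]
    exact this
  rw [← h1, Matrix.mul_assoc, columns_mul_transpose h.1, Matrix.mul_one]

theorem eq_sum_vecMulVec (h : IsOrthonormalEigenseq A τ w) :
    A = ∑ k, τ k • Matrix.vecMulVec (w k).ofLp (w k).ofLp := by
  conv_lhs => rw [eq_conj_diagonal h]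
  ext i j
  rw [Matrix.mul_apply, Matrix.sum_apply]
  refine sum_congr rfl fun k _ => ?_
  rw [Matrix.mul_diagonal]
  simp [columns, Matrix.vecMulVec_apply]
  ring

theorem trace_eq_sum (h : IsOrthonormalEigenseq A τ w) : A.trace = ∑ k, τ k := by
  conv_lhs => rw [eq_conj_diagonal h]
  rw [Matrix.trace_mul_comm, ← Matrix.mul_assoc, columns_transpose_mul h.1, Matrix.one_mul,
    Matrix.trace_diagonal]

theorem charpoly_roots_eq (h : IsOrthonormalEigenseq A τ w) :
    A.charpoly.roots = (List.ofFn τ : Multiset ℝ) := by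
  have h1 : A.charpoly = (Matrix.diagonal τ).charpoly := by
    conv_lhs => rw [eq_conj_diagonal h]
    rw [Matrix.charpoly_mul_comm, ← Matrix.mul_assoc, columns_transpose_mul h.1, Matrix.one_mul]
  rw [h1, Matrix.charpoly_diagonal]
  change (Multiset.map ((fun a => Polynomial.X - Polynomial.C a) ∘ τ) univ.val).prod.roots = _
  rw [← Multiset.map_map, Polynomial.roots_multiset_prod_X_sub_C]
  simp [List.ofFn_eq_map]

theorem exists_sorted_eigenbasis (hA : A.IsSymm) :
    ∃ (τ : Fin n → ℝ) (u : Fin n → EuclideanSpace ℝ (Fin n)),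
      Antitone τ ∧ IsOrthonormalEigenseq A τ u := by
  have hH : A.IsHermitian := by
    rw [Matrix.IsHermitian, Matrix.conjTranspose_eq_transpose_of_trivial]; exact hA
  have hT : (Matrix.toEuclideanLin A).IsSymmetric := Matrix.isSymmetric_toEuclideanLin_iff.2 hH
  have hn : Module.finrank ℝ (EuclideanSpace ℝ (Fin n)) = n := by simp
  refine ⟨hT.eigenvalues hn, hT.eigenvectorBasis hn, hT.eigenvalues_antitone hn,
    (hT.eigenvectorBasis hn).orthonormal, fun i => ?_⟩
  exact congrArg WithLp.ofLp (hT.apply_eigenvectorBasis hn i)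

theorem exists_pos_iff_lt (hτ : Antitone τ) : ∃ k ≤ n, ∀ i : Fin n, 0 < τ i ↔ (i : ℕ) < k := by
  classical
  have hex : ∃ k, ∀ i : Fin n, k ≤ (i : ℕ) → τ i ≤ 0 := ⟨n, fun i hi => by omega⟩
  refine ⟨Nat.find hex, Nat.find_min' hex fun i hi => by omega, fun i => ⟨fun hi => ?_, fun hi => ?_⟩⟩
  · by_contra hlt
    exact absurd hi (not_lt.2 (Nat.find_spec hex i (not_lt.1 hlt)))
  · have := Nat.find_min hex hi
    push Not at this
    obtain ⟨j, hj, hpos⟩ := this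
    exact hpos.trans_le (hτ hj)

theorem filter_ofFn {α : Type*} {n k : ℕ} (hk : k ≤ n) (f : Fin n → α) (p : α → Bool)
    (hp : ∀ i, p (f i) = true ↔ (i : ℕ) < k) :
    (List.ofFn f).filter p = List.ofFn fun i : Fin k => f ⟨i, by omega⟩ := by
  obtain ⟨d, rfl⟩ := Nat.exists_eq_add_of_le hk
  rw [List.ofFn_add, List.filter_append, List.filter_eq_self.2, List.filter_eq_nil_iff.2,
    List.append_nil]
  · rfl
  · intro x hx
    obtain ⟨i, rfl⟩ := (List.mem_ofFn' _ _).1 hx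
    rw [hp]
    simp
  · intro x hx
    obtain ⟨i, rfl⟩ := (List.mem_ofFn' _ _).1 hx
    rw [hp]
    simp

theorem takeWhile_ofFn {α : Type*} {n k : ℕ} (hk : k ≤ n) (f : Fin n → α) (p : α → Bool)
    (hp : ∀ i, p (f i) = true ↔ (i : ℕ) < k) :
    (List.ofFn f).takeWhile p = List.ofFn fun i : Fin k => f ⟨i, by omega⟩ := by
  obtain ⟨d, rfl⟩ := Nat.exists_eq_add_of_le hk
  rw [List.ofFn_add, List.takeWhile_append_of_pos, (_ : List.takeWhile p _ = []), List.append_nil]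
  · rfl
  · rw [List.takeWhile_eq_nil_iff]
    intro h
    simp [hp]
  · intro x hx
    obtain ⟨i, rfl⟩ := (List.mem_ofFn' _ _).1 hx
    rw [hp]
    simp

/-- The positive eigenvalues are the first entries of a sorted list of all eigenvalues. -/
theorem positiveEigenvalues_spec (h : IsOrthonormalEigenseq A τ w) (hτ : Antitone τ) {m : ℕ}
    {σ : Fin m → ℝ} (hσ : List.ofFn σ = positiveEigenvalues A) :
    m ≤ n ∧ (∀ i : Fin n, 0 < τ i ↔ (i : ℕ) < m) ∧
      ∀ i : Fin n, (i : ℕ) < m → τ i = extendZero σ i := by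
  classical
  obtain ⟨k, hk, hpos⟩ := exists_pos_iff_lt hτ
  -- Both lists are sorted and have the same multiset of entries, so they coincide.
  have h1 : positiveEigenvalues A = (List.ofFn τ).filter fun t => decide (0 < t) := by
    rw [positiveEigenvalues, charpoly_roots_eq h]
    refine List.Perm.eq_of_pairwise' (r := fun a b : ℝ => a ≥ b) (Multiset.pairwise_sort _ _) ?_ ?_
    · refine List.Pairwise.filter _ ?_
      rw [List.pairwise_ofFn]
      exact fun i j hij => hτ hij.le
    · rw [← Multiset.coe_eq_coe, Multiset.sort_eq, ← Multiset.filter_coe]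
  rw [h1, filter_ofFn hk τ _ (by simpa using hpos)] at hσ
  obtain rfl : m = k := by simpa using congrArg List.length hσ
  refine ⟨hk, hpos, fun i hi => ?_⟩
  rw [extendZero_of_lt σ hi, List.ofFn_injective hσ]

end Eigenbasis

/-! ### The Gram matrix of a dictionary and Schur's inequality -/

theorem gram_mulVec {n K : ℕ} (d : Fin K → EuclideanSpace ℝ (Fin n))
    (v : EuclideanSpace ℝ (Fin n)) :
    (gram d).mulVec v.ofLp = (∑ t, (inner ℝ (d t) v : ℝ) • d t).ofLp := by
  rw [gram, Matrix.sum_mulVec]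
  simp only [Matrix.vecMulVec_mulVec, WithLp.ofLp_sum, WithLp.ofLp_smul, inner_eq_dotProduct]
  refine sum_congr rfl fun t _ => ?_
  ext i
  simp [mul_comm]

theorem gram_isSymm {n K : ℕ} (d : Fin K → EuclideanSpace ℝ (Fin n)) : (gram d).IsSymm := by
  rw [Matrix.IsSymm, gram, Matrix.transpose_sum]
  refine sum_congr rfl fun t _ => ?_
  ext i j
  simp [Matrix.vecMulVec_apply, mul_comm]

theorem sum_inner_smul_eq_of_gram {n K m : ℕ} {d : Fin K → EuclideanSpace ℝ (Fin n)}
    {lam : Fin m → ℝ} {w : Fin m → EuclideanSpace ℝ (Fin n)}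
    (h : IsOrthonormalEigenseq (gram d) lam w) (j : Fin m) :
    ∑ t, (inner ℝ (d t) (w j) : ℝ) • d t = lam j • w j := by
  have := h.2 j
  rw [gram_mulVec] at this
  exact WithLp.ofLp_injective 2 this

/-- Bessel's inequality for orthogonal vectors of norm at most one. -/
theorem sum_inner_sq_le {ι V : Type*} [Fintype ι] [NormedAddCommGroup V] [InnerProductSpace ℝ V]
    {v : ι → V} (ho : ∀ i j, i ≠ j → inner ℝ (v i) (v j) = (0 : ℝ))
    (h1 : ∀ i, inner ℝ (v i) (v i) ≤ (1 : ℝ)) (z : V) :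
    ∑ i, (inner ℝ (v i) z : ℝ) ^ 2 ≤ inner ℝ z z := by
  classical
  set p : V := ∑ i, (inner ℝ (v i) z : ℝ) • v i with hp
  have e1 : (inner ℝ p z : ℝ) = ∑ i, (inner ℝ (v i) z : ℝ) ^ 2 := by
    rw [hp, sum_inner]
    exact sum_congr rfl fun i _ => by rw [real_inner_smul_left]; ring
  have e2 : (inner ℝ p p : ℝ) ≤ ∑ i, (inner ℝ (v i) z : ℝ) ^ 2 := by
    conv_lhs => rw [hp, sum_inner]
    refine sum_le_sum fun i _ => ?_
    rw [real_inner_smul_left, ← hp, hp, inner_sum, sum_eq_single i]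
    · rw [real_inner_smul_right]
      nlinarith [sq_nonneg (inner ℝ (v i) z : ℝ), h1 i]
    · intro j _ hj
      rw [real_inner_smul_right, ho i j hj.symm, mul_zero]
    · simp
  have e3 : (0 : ℝ) ≤ inner ℝ (z - p) (z - p) := real_inner_self_nonneg
  rw [inner_sub_left, inner_sub_right, inner_sub_right, real_inner_comm p z, e1] at e3
  linarith

section Gram

variable {n K : ℕ} {d : Fin K → EuclideanSpace ℝ (Fin n)} {lam : Fin n → ℝ}
  {w : Fin n → EuclideanSpace ℝ (Fin n)}

/-- In matrix terms `wᵢᵀ D Dᵀ wⱼ`: the vectors `Dᵀ wᵢ` are orthogonal with squared norms `λᵢ`, as in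
a singular value decomposition of `D`. -/
theorem sum_inner_mul_inner (h : IsOrthonormalEigenseq (gram d) lam w) (i j : Fin n) :
    ∑ t, (inner ℝ (d t) (w i) : ℝ) * inner ℝ (d t) (w j) = if i = j then lam i else 0 := by
  have h1 := congrArg (fun v => (inner ℝ v (w j) : ℝ)) (sum_inner_smul_eq_of_gram h i)
  simp only [sum_inner, real_inner_smul_left, Orthonormal.inner_eq_ite h.1] at h1
  rw [h1]
  split_ifs <;> simp

theorem eigenvalue_gram_nonneg (h : IsOrthonormalEigenseq (gram d) lam w) (j : Fin n) :
    0 ≤ lam j := by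
  have h1 := sum_inner_mul_inner h j j
  rw [if_pos rfl] at h1
  rw [← h1]
  exact sum_nonneg fun t _ => mul_self_nonneg _

theorem inner_expand (hw : Orthonormal ℝ w) (x y : EuclideanSpace ℝ (Fin n)) :
    ∑ j, (inner ℝ (w j) x : ℝ) * inner ℝ (w j) y = inner ℝ x y := by
  let b : OrthonormalBasis (Fin n) ℝ (EuclideanSpace ℝ (Fin n)) :=
    OrthonormalBasis.mk hw (by
      rw [hw.linearIndependent.span_eq_top_of_card_eq_finrank' (by simp)])
  have := b.sum_inner_mul_inner x y
  rw [← this]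
  refine sum_congr rfl fun j _ => ?_
  simp [b, real_inner_comm x]

theorem sum_eigenvalues_gram (h : IsOrthonormalEigenseq (gram d) lam w) :
    ∑ j, lam j = ∑ t, (inner ℝ (d t) (d t) : ℝ) := by
  simp only [← inner_expand h.1 (d _) (d _)]
  rw [sum_comm]
  refine sum_congr rfl fun j _ => ?_
  have := sum_inner_mul_inner h j j
  rw [if_pos rfl] at this
  rw [← this]
  simp only [real_inner_comm]

theorem sum_univ_eq_sum_range_extendZero {k : ℕ} (f : Fin k → ℝ) :
    ∑ i, f i = ∑ t ∈ range k, extendZero f t := by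
  rw [← Fin.sum_univ_eq_sum_range (extendZero f)]
  simp only [extendZero_apply]

/-- The squared lengths of the first `k` vectors add up to at most the sum of the `k` largest
eigenvalues of `∑ d_t d_tᵀ`. -/
theorem sum_lengths_le_sum_eigenvalues (h : IsOrthonormalEigenseq (gram d) lam w)
    (hlam : Antitone lam) {len : Fin K → ℝ} (hd : ∀ t, inner ℝ (d t) (d t) = len t) {k : ℕ}
    (hk : k ≤ n) (hnK : n ≤ K) :
    ∑ t ∈ range k, extendZero len t ≤ ∑ j ∈ range k, extendZero lam j := by
  -- The right singular vectors of `D`. For a zero eigenvalue the inverse is `0` by convention, so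
  -- `y j = 0`; hence only norms at most one are available.
  set y : Fin n → EuclideanSpace ℝ (Fin K) := fun j =>
    WithLp.toLp 2 fun t => (√(lam j))⁻¹ * inner ℝ (d t) (w j) with hy
  have hyy : ∀ i j, (inner ℝ (y i) (y j) : ℝ) =
      (√(lam i))⁻¹ * (√(lam j))⁻¹ * if i = j then lam i else 0 := fun i j => by
    rw [← sum_inner_mul_inner h i j, inner_eq_dotProduct, mul_sum]
    exact sum_congr rfl fun t _ => by simp [hy]; ring
  have hy1 : ∀ j, (inner ℝ (y j) (y j) : ℝ) ≤ 1 := fun j => by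
    rw [hyy, if_pos rfl, ← mul_inv, Real.mul_self_sqrt (eigenvalue_gram_nonneg h j)]
    rcases (eigenvalue_gram_nonneg h j).eq_or_lt with h0 | h0
    · rw [← h0]; simp
    · rw [inv_mul_cancel₀ h0.ne']
  have hy0 : ∀ i j, i ≠ j → (inner ℝ (y i) (y j) : ℝ) = 0 := fun i j hij => by
    rw [hyy, if_neg hij, mul_zero]
  have hval : ∀ t j, (inner ℝ (d t) (w j) : ℝ) ^ 2 = lam j * (y j t) ^ 2 := fun t j => by
    have h0 := eigenvalue_gram_nonneg h j
    have : y j t = (√(lam j))⁻¹ * inner ℝ (d t) (w j) := rfl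
    rw [this, mul_pow, inv_pow, Real.sq_sqrt h0]
    rcases h0.eq_or_lt with h0 | h0
    · have h1 := sum_inner_mul_inner h j j
      rw [if_pos rfl, ← h0, sum_eq_zero_iff_of_nonneg fun t _ => mul_self_nonneg _] at h1
      have := mul_self_eq_zero.1 (h1 t (mem_univ t))
      rw [this]; simp
    · field_simp
  -- The share of `y j` in the first `k` coordinates. The first `k` lengths add up to `∑ λ_j β_j`
  -- with weights in `[0, 1]` of total at most `k`, so `sum_mul_le_sum_range` applies.
  set β : Fin n → ℝ := fun j => ∑ t ∈ univ.filter (fun t : Fin K => (t : ℕ) < k), (y j t) ^ 2 with hβ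
  have hβ1 : ∀ j, β j ≤ 1 := fun j => by
    refine le_trans ?_ (hy1 j)
    rw [inner_eq_dotProduct, hβ]
    refine le_trans (sum_le_sum_of_subset_of_nonneg (filter_subset _ _)
      fun t _ _ => sq_nonneg _) (le_of_eq (sum_congr rfl fun t _ => sq _))
  have hcol : ∀ t, ∑ j, (y j t) ^ 2 ≤ 1 := fun t => by
    have := sum_inner_sq_le hy0 hy1 (EuclideanSpace.single t (1 : ℝ))
    simpa [EuclideanSpace.inner_single_right] using this
  have hcard : (univ.filter (fun t : Fin K => (t : ℕ) < k)).card = k := by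
    rw [Fin.card_filter_val_lt]; omega
  have hsum : ∑ j, β j ≤ k := by
    rw [hβ, sum_comm]
    refine (sum_le_sum fun t _ => hcol t).trans ?_
    simp [hcard]
  have e1 : ∑ t ∈ range k, extendZero len t =
      ∑ t ∈ univ.filter (fun t : Fin K => (t : ℕ) < k), len t := by
    rw [sum_filter, sum_univ_eq_sum_range_extendZero, ← sum_subset (range_subset_range.2
      (hk.trans hnK))]
    · refine sum_congr rfl fun t ht => ?_
      have ht := mem_range.1 ht
      rw [extendZero_of_lt _ (show t < K by omega), extendZero_of_lt _ (show t < K by omega)]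
      simp [ht]
    · intro t ht ht'
      rw [extendZero_of_lt _ (mem_range.1 ht)]
      have := mem_range.not.1 ht'
      simp [this]
  have e2 : ∑ t ∈ univ.filter (fun t : Fin K => (t : ℕ) < k), len t = ∑ j, lam j * β j := by
    simp only [hβ, mul_sum]
    rw [sum_comm]
    refine sum_congr rfl fun t _ => ?_
    rw [← hd t, ← inner_expand h.1]
    refine sum_congr rfl fun j _ => ?_
    rw [← hval, real_inner_comm, sq]
  have e3 : ∑ j, lam j * β j = ∑ j ∈ range n, extendZero lam j * extendZero β j := by
    rw [← Fin.sum_univ_eq_sum_range (fun j => extendZero lam j * extendZero β j)]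
    simp only [extendZero_apply]
  rw [e1, e2, e3]
  refine sum_mul_le_sum_range hk ?_ ?_ ?_ ?_ ?_
  · intro t ht; rw [extendZero_of_lt _ ht]; exact eigenvalue_gram_nonneg h _
  · intro i j hij hj
    rw [extendZero_of_lt _ hj, extendZero_of_lt lam (show i < n by omega)]
    exact hlam (by simpa [Fin.le_def] using hij)
  · intro t ht; rw [extendZero_of_lt _ ht]; exact sum_nonneg fun _ _ => sq_nonneg _
  · intro t ht; rw [extendZero_of_lt _ ht]; exact hβ1 _
  · rw [← sum_univ_eq_sum_range_extendZero]; exact hsum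

end Gram

end L2Dictionary

namespace L2Dictionary

open Finset

/-! ## The lower bound and its equality case -/

/-- The solution of the quadratic program, continued by its last value. -/
noncomputable def extendConst {m : ℕ} (x : Fin m → ℝ) (t : ℕ) : ℝ := extendZero x (min t (m - 1))

section LowerBound

variable {n K m : ℕ} {len : Fin K → ℝ} {d : Fin K → EuclideanSpace ℝ (Fin n)} {lam : Fin n → ℝ}
  {w : Fin n → EuclideanSpace ℝ (Fin n)} {c x : Fin m → ℝ} {u : Fin m → EuclideanSpace ℝ (Fin n)}
  {F : Fin m → Fin K → ℝ}

theorem extendConst_of_lt (x : Fin m → ℝ) {t : ℕ} (ht : t < m) :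
    extendConst x t = extendZero x t := by
  rw [extendConst, min_eq_left (by omega)]

theorem extendConst_of_ge (x : Fin m → ℝ) {t : ℕ} (ht : m - 1 ≤ t) :
    extendConst x t = extendZero x (m - 1) := by
  rw [extendConst, min_eq_right ht]

variable {a : ℕ → ℝ}

theorem KKT.extendConst_pos (h : KKT (extendZero c) a (extendZero x) 0 m)
    (hm : 0 < m) (t : ℕ) : 0 < extendConst x t :=
  h.pos _ (Nat.zero_le _) (by omega)

theorem KKT.extendConst_mono (h : KKT (extendZero c) a (extendZero x) 0 m)
    (hm : 0 < m) : Monotone (extendConst x) := fun i j hij =>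
  h.mono_le (Nat.zero_le _) (by omega) (by omega)

/-- With `W` the largest squared value, the weights `W - x²` are nonnegative, non-increasing and
zero from the index `m - 1` on, so Schur's inequality can be summed by parts against them. Since the
trace is the sum of all lengths, all lengths from that index on end up with the common factor `W`:
this is why the last folded length collects them. -/
theorem sum_eigenvalues_mul_sq_le
    (h : KKT (extendZero c) (extendZero (foldedLengths len m)) (extendZero x) 0 m)
    (hm : 0 < m) (hmn : m ≤ n) (hnK : n ≤ K) (hw : IsOrthonormalEigenseq (gram d) lam w)
    (hlam : Antitone lam) (hd : ∀ t, inner ℝ (d t) (d t) = len t) :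
    ∑ j, lam j * extendConst x j ^ 2 ≤ ∑ i, c i * x i := by
  have hmono := h.extendConst_mono hm
  have hpos := h.extendConst_pos hm
  set W := extendZero x (m - 1) ^ 2 with hW
  have hWx : ∀ t, extendConst x t ^ 2 ≤ W := fun t => by
    rw [hW, ← extendConst_of_ge x le_rfl]
    refine pow_le_pow_left₀ (hpos t).le ?_ 2
    rw [extendConst_of_ge x le_rfl]
    exact h.mono_le (Nat.zero_le _) (by omega) (by omega)
  have h1 : 0 ≤ ∑ t ∈ range n, (W - extendConst x t ^ 2) *
      (extendZero lam t - extendZero len t) := by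
    refine sum_mul_nonneg_of_antitone (fun t _ => sub_nonneg.2 (hWx t)) (fun t _ => ?_) fun k hk => ?_
    · have := pow_le_pow_left₀ (hpos t).le (hmono (Nat.le_succ t)) 2
      simp only [Nat.succ_eq_add_one] at this
      linarith
    · rw [sum_sub_distrib, sub_nonneg]
      exact sum_lengths_le_sum_eigenvalues hw hlam hd hk hnK
  have h2 : ∑ t ∈ range n, (W - extendConst x t ^ 2) * extendZero len t =
      ∑ t ∈ range (m - 1), (W - extendZero x t ^ 2) * extendZero len t := by
    rw [← sum_subset (range_subset_range.2 (show m - 1 ≤ n by omega))]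
    · refine sum_congr rfl fun t ht => ?_
      have ht := mem_range.1 ht
      rw [extendConst_of_lt x (by omega)]
    · intro t _ ht
      have := mem_range.not.1 ht
      rw [extendConst_of_ge x (by omega), sub_self, zero_mul]
  have h3 : ∑ t ∈ range n, (W - extendConst x t ^ 2) * extendZero lam t =
      W * ∑ j, lam j - ∑ j, lam j * extendConst x j ^ 2 := by
    rw [← Fin.sum_univ_eq_sum_range (fun t => (W - extendConst x t ^ 2) * extendZero lam t), mul_sum,
      ← sum_sub_distrib]
    exact sum_congr rfl fun j _ => by rw [extendZero_apply]; ring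
  have h4 : ∑ j, lam j = ∑ t ∈ range K, extendZero len t := by
    rw [sum_eigenvalues_gram hw, sum_univ_eq_sum_range_extendZero]
    simp only [hd]
  have h5 := h.sum_c_mul
  have h6 : ∑ i, c i * x i = ∑ t ∈ range m, extendZero c t * extendZero x t := by
    rw [← Fin.sum_univ_eq_sum_range (fun t => extendZero c t * extendZero x t)]
    simp only [extendZero_apply]
  obtain ⟨l, rfl⟩ : ∃ l, m = l + 1 := ⟨m - 1, by omega⟩
  have h7 : ∑ t ∈ range (l + 1), extendZero (foldedLengths len (l + 1)) t * extendZero x t ^ 2 =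
      W * ∑ t ∈ range K, extendZero len t -
        ∑ t ∈ range l, (W - extendZero x t ^ 2) * extendZero len t := by
    have h8 := sum_foldedLengths len hm (hmn.trans hnK)
    rw [sum_range_succ, sum_foldedLengths_of_lt len (Nat.lt_succ_self l)] at h8
    rw [sum_range_succ, ← h8, mul_add, hW, mul_sum]
    simp only [sub_mul, sum_sub_distrib, Nat.add_sub_cancel]
    rw [sum_congr rfl fun t ht => by
      rw [extendZero_foldedLengths len (by have := mem_range.1 ht; omega : t + 1 < l + 1)]]
    simp only [mul_comm (extendZero len _)]
    ring
  simp only [mul_sub, sum_sub_distrib] at h1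
  rw [h2, h3, h4] at h1
  simp only [Nat.add_sub_cancel] at h1
  rw [h6, ← h5, h7]
  linarith

/-- Here `z_i = ⟨u_i, B u_i⟩` for the symmetric matrix `B` with eigenvectors `w_j` and
non-decreasing eigenvalues. Any `k` diagonal entries in an orthonormal system sum to at least the
`k` smallest eigenvalues (Ky Fan); the non-increasing weights `c` are then handled by Abel
summation. -/
theorem sum_mul_le_sum_weights
    (h : KKT (extendZero c) a (extendZero x) 0 m)
    (hm : 0 < m) (hmn : m ≤ n) (hw : Orthonormal ℝ w) (hu : Orthonormal ℝ u)
    (hc0 : ∀ i, 0 < c i) (hc : Antitone c) :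
    ∑ i, c i * x i ≤ ∑ i, c i * ∑ j : Fin n, extendConst x j * (inner ℝ (w j) (u i) : ℝ) ^ 2 := by
  have hmono := h.extendConst_mono hm
  set z : Fin m → ℝ := fun i => ∑ j : Fin n, extendConst x j * (inner ℝ (w j) (u i) : ℝ) ^ 2 with hz
  set W := extendZero x (m - 1) with hW
  have hWx : ∀ t, extendConst x t ≤ W := fun t =>
    h.mono_le (Nat.zero_le _) (by omega) (by omega)
  have key : 0 ≤ ∑ t ∈ range m, extendZero c t * (extendZero z t - extendZero x t) := by
    refine sum_mul_nonneg_of_antitone (fun t ht => ?_) (fun t ht => ?_) fun k hk => ?_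
    · rw [extendZero_of_lt _ ht]; exact (hc0 _).le
    · rw [extendZero_of_lt _ ht, extendZero_of_lt c (show t < m by omega)]
      exact hc (by simp [Fin.le_def])
    · set S : Finset (Fin m) := univ.filter (fun i : Fin m => (i : ℕ) < k) with hS
      have hcard : S.card = k := by rw [hS, Fin.card_filter_val_lt]; omega
      -- The squared length of the projection of `w j` to the span of the first `k` vectors `u i`.
      -- Replacing `x` by `W - x` turns the smallest-sum statement into the largest-sum statement
      -- `sum_mul_le_sum_range`.
      set β : Fin n → ℝ := fun j => ∑ i ∈ S, (inner ℝ (w j) (u i) : ℝ) ^ 2 with hβ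
      have hrow : ∀ i, ∑ j, (inner ℝ (w j) (u i) : ℝ) ^ 2 = 1 := fun i => by
        have := inner_expand hw (u i) (u i)
        rw [Orthonormal.inner_eq_ite hu, if_pos rfl] at this
        simpa [sq] using this
      have hβsum : ∑ j, β j = k := by
        rw [hβ, sum_comm]
        simp [hrow, hcard]
      have hβ1 : ∀ j, β j ≤ 1 := fun j => by
        have h1 := sum_inner_sq_le (fun i i' hi => by
          rw [Orthonormal.inner_eq_ite hu, if_neg hi]) (fun i => by
          rw [Orthonormal.inner_eq_ite hu, if_pos rfl]) (w j)
        rw [Orthonormal.inner_eq_ite hw, if_pos rfl] at h1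
        refine le_trans (sum_le_sum_of_subset_of_nonneg (filter_subset _ _)
          fun t _ _ => sq_nonneg _) (le_of_eq_of_le (sum_congr rfl fun i _ => ?_) h1)
        rw [real_inner_comm]
      have h1 := sum_mul_le_sum_range (b := fun t => W - extendConst x t) (β := extendZero β)
        (N := n) (k := k) (hk.trans hmn) (fun t _ => sub_nonneg.2 (hWx t))
        (fun i j hij _ => sub_le_sub_left (hmono hij) W)
        (fun t ht => by rw [extendZero_of_lt _ ht]; exact sum_nonneg fun _ _ => sq_nonneg _)
        (fun t ht => by rw [extendZero_of_lt _ ht]; exact hβ1 _)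
        (by rw [← sum_univ_eq_sum_range_extendZero, hβsum])
      have h2 : ∑ t ∈ range n, (W - extendConst x t) * extendZero β t =
          W * k - ∑ j : Fin n, extendConst x j * β j := by
        rw [← Fin.sum_univ_eq_sum_range (fun t => (W - extendConst x t) * extendZero β t), ← hβsum,
          mul_sum, ← sum_sub_distrib]
        exact sum_congr rfl fun j _ => by rw [extendZero_apply]; ring
      have h3 : ∑ j : Fin n, extendConst x j * β j = ∑ t ∈ range k, extendZero z t := by
        have e1 : ∑ t ∈ range k, extendZero z t = ∑ i ∈ S, z i := by
          rw [hS, sum_filter, sum_univ_eq_sum_range_extendZero, ← sum_subset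
            (range_subset_range.2 hk)]
          · refine sum_congr rfl fun t ht => ?_
            have ht := mem_range.1 ht
            rw [extendZero_of_lt _ (show t < m by omega), extendZero_of_lt _ (show t < m by omega)]
            simp [ht]
          · intro t ht ht'
            rw [extendZero_of_lt _ (mem_range.1 ht)]
            have := mem_range.not.1 ht'
            simp [this]
        rw [e1, hz, sum_comm]
        exact sum_congr rfl fun j _ => by rw [hβ, mul_sum]
      have h4 : ∑ t ∈ range k, (W - extendConst x t) = W * k - ∑ t ∈ range k, extendZero x t := by
        rw [sum_sub_distrib]
        simp only [sum_const, card_range, nsmul_eq_mul]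
        rw [mul_comm]
        congr 1
        exact sum_congr rfl fun t ht => extendConst_of_lt x (by have := mem_range.1 ht; omega)
      rw [h2, h3, h4] at h1
      rw [sum_sub_distrib]
      linarith
  rw [← Fin.sum_univ_eq_sum_range (fun t => extendZero c t * (extendZero z t - extendZero x t))] at key
  simp only [extendZero_apply, mul_sub, sum_sub_distrib] at key
  linarith

/-- The coefficients of the certificate. -/
noncomputable def certificate (d : Fin K → EuclideanSpace ℝ (Fin n))
    (w : Fin n → EuclideanSpace ℝ (Fin n)) (x : Fin m → ℝ) (v : EuclideanSpace ℝ (Fin n))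
    (t : Fin K) : ℝ :=
  ∑ j : Fin n, extendConst x j * (inner ℝ (w j) v : ℝ) * inner ℝ (d t) (w j)

/-- The certificate for `v` is `Dᵀ B v` with `B = ∑ x_j w_j w_jᵀ`, so `D` maps it to `D Dᵀ B v`. -/
theorem sum_certificate_smul (hw : IsOrthonormalEigenseq (gram d) lam w) (x : Fin m → ℝ)
    (v : EuclideanSpace ℝ (Fin n)) :
    ∑ t, certificate d w x v t • d t =
      ∑ j, (lam j * extendConst x j * (inner ℝ (w j) v : ℝ)) • w j := by
  simp only [certificate, sum_smul]
  rw [sum_comm]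
  refine sum_congr rfl fun j _ => ?_
  have := sum_inner_smul_eq_of_gram hw j
  rw [mul_comm (lam j), mul_right_comm, mul_smul, ← this, smul_sum]
  exact sum_congr rfl fun t _ => by rw [mul_smul]

/-- The cross term `⟨f, Dᵀ B v⟩ = ⟨D f, B v⟩` depends on `f` only through `D f = r v`, and `B` and
`D Dᵀ` are diagonal in the same basis. -/
theorem sum_sq_sub_certificate (hw : IsOrthonormalEigenseq (gram d) lam w) (x : Fin m → ℝ)
    {f : Fin K → ℝ} {v : EuclideanSpace ℝ (Fin n)} {r : ℝ} (hf : ∑ t, f t • d t = r • v) :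
    ∑ t, (f t - certificate d w x v t) ^ 2 = ∑ t, f t ^ 2 -
      2 * (r * ∑ j : Fin n, extendConst x j * (inner ℝ (w j) v : ℝ) ^ 2) +
      ∑ j, lam j * extendConst x j ^ 2 * (inner ℝ (w j) v : ℝ) ^ 2 := by
  have h1 : ∑ t, f t * certificate d w x v t =
      r * ∑ j : Fin n, extendConst x j * (inner ℝ (w j) v : ℝ) ^ 2 := by
    simp only [certificate, mul_sum]
    rw [sum_comm]
    refine sum_congr rfl fun j _ => ?_
    have h2 := congrArg (fun y => (inner ℝ y (w j) : ℝ)) hf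
    simp only [sum_inner, real_inner_smul_left] at h2
    rw [real_inner_comm (w j) v] at h2
    rw [sq, show r * (extendConst x j * ((inner ℝ (w j) v : ℝ) * inner ℝ (w j) v)) =
      extendConst x j * inner ℝ (w j) v * (r * inner ℝ (w j) v) by ring, ← h2, mul_sum]
    exact sum_congr rfl fun t _ => by ring
  have h2 : ∑ t, certificate d w x v t * certificate d w x v t =
      ∑ j, lam j * extendConst x j ^ 2 * (inner ℝ (w j) v : ℝ) ^ 2 := by
    conv_lhs =>
      enter [2, t]
      rw [certificate, sum_mul_sum]
    rw [sum_comm]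
    refine sum_congr rfl fun i _ => ?_
    rw [sum_comm, sum_eq_single i]
    · have := sum_inner_mul_inner hw i i
      rw [if_pos rfl] at this
      rw [← this, sum_mul, sum_mul]
      exact sum_congr rfl fun t _ => by ring
    · intro j _ hj
      have := sum_inner_mul_inner hw i j
      rw [if_neg hj.symm] at this
      rw [← mul_zero (extendConst x i * (inner ℝ (w i) v : ℝ) *
        (extendConst x j * (inner ℝ (w j) v : ℝ))), ← this, mul_sum]
      exact sum_congr rfl fun t _ => by ring
    · simp
  rw [← h1, ← h2, mul_sum, ← sum_sub_distrib, ← sum_add_distrib]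
  exact sum_congr rfl fun t _ => by ring

/-- The lower bound for the squared norms of coefficient vectors of `c_i u_i`, with the defects
which vanish in the case of equality. -/
theorem lower_bound_with_defects
    (h : KKT (extendZero c) (extendZero (foldedLengths len m)) (extendZero x) 0 m)
    (hm : 0 < m) (hmn : m ≤ n) (hnK : n ≤ K) (hw : IsOrthonormalEigenseq (gram d) lam w)
    (hlam : Antitone lam) (hd : ∀ t, inner ℝ (d t) (d t) = len t)
    (hF : ∀ i, ∑ t, F i t • d t = c i • u i) :
    (∑ i, ∑ t, (F i t - certificate d w x (u i) t) ^ 2) +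
      2 * (∑ i, c i * ∑ j : Fin n, extendConst x j * (inner ℝ (w j) (u i) : ℝ) ^ 2 - ∑ i, c i * x i) +
      ∑ j, lam j * extendConst x j ^ 2 * (1 - ∑ i, (inner ℝ (w j) (u i) : ℝ) ^ 2) ≤
    ∑ i, ∑ t, F i t ^ 2 - ∑ i, c i * x i := by
  have h1 := sum_eigenvalues_mul_sq_le h hm hmn hnK hw hlam hd
  simp only [sum_sq_sub_certificate hw x (hF _), sum_add_distrib, sum_sub_distrib, ← mul_sum]
  have h2 : ∑ j, lam j * extendConst x j ^ 2 * (1 - ∑ i, (inner ℝ (w j) (u i) : ℝ) ^ 2) =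
      ∑ j, lam j * extendConst x j ^ 2 -
        ∑ i, ∑ j, lam j * extendConst x j ^ 2 * (inner ℝ (w j) (u i) : ℝ) ^ 2 := by
    rw [sum_comm (s := univ (α := Fin m)), ← sum_sub_distrib]
    exact sum_congr rfl fun j _ => by rw [mul_sub, mul_one, mul_sum]
  rw [h2]
  linarith

theorem sum_inner_sq_le_one (hw : Orthonormal ℝ w) (hu : Orthonormal ℝ u) (j : Fin n) :
    ∑ i, (inner ℝ (w j) (u i) : ℝ) ^ 2 ≤ 1 := by
  have h1 := sum_inner_sq_le (fun i i' hi => by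
    rw [Orthonormal.inner_eq_ite hu, if_neg hi]) (fun i => by
    rw [Orthonormal.inner_eq_ite hu, if_pos rfl]) (w j)
  rw [Orthonormal.inner_eq_ite hw, if_pos rfl] at h1
  simpa only [real_inner_comm] using h1

theorem lower_bound
    (h : KKT (extendZero c) (extendZero (foldedLengths len m)) (extendZero x) 0 m)
    (hm : 0 < m) (hmn : m ≤ n) (hnK : n ≤ K) (hd : ∀ t, inner ℝ (d t) (d t) = len t)
    (hu : Orthonormal ℝ u) (hc0 : ∀ i, 0 < c i) (hc : Antitone c)
    (hF : ∀ i, ∑ t, F i t • d t = c i • u i) :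
    ∑ i, c i * x i ≤ ∑ i, ∑ t, F i t ^ 2 := by
  obtain ⟨lam, w, hlam, hw⟩ := exists_sorted_eigenbasis (gram_isSymm d)
  have h1 := lower_bound_with_defects h hm hmn hnK hw hlam hd hF
  have h2 := sum_mul_le_sum_weights h hm hmn hw.1 hu hc0 hc
  have h3 : 0 ≤ ∑ i, ∑ t, (F i t - certificate d w x (u i) t) ^ 2 :=
    sum_nonneg fun _ _ => sum_nonneg fun _ _ => sq_nonneg _
  have h4 : 0 ≤ ∑ j, lam j * extendConst x j ^ 2 * (1 - ∑ i, (inner ℝ (w j) (u i) : ℝ) ^ 2) :=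
    sum_nonneg fun j _ => mul_nonneg (mul_nonneg (eigenvalue_gram_nonneg hw j) (sq_nonneg _))
      (sub_nonneg.2 (sum_inner_sq_le_one hw.1 hu j))
  linarith

/-- In the case of equality, the eigenbasis of `∑ d_t d_tᵀ` diagonalizes `∑ c_i u_i u_iᵀ`. -/
theorem eigen_of_lower_bound_eq
    (h : KKT (extendZero c) (extendZero (foldedLengths len m)) (extendZero x) 0 m)
    (hm : 0 < m) (hmn : m ≤ n) (hnK : n ≤ K) (hw : IsOrthonormalEigenseq (gram d) lam w)
    (hlam : Antitone lam) (hd : ∀ t, inner ℝ (d t) (d t) = len t) (hu : Orthonormal ℝ u)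
    (hc0 : ∀ i, 0 < c i) (hc : Antitone c) (hF : ∀ i, ∑ t, F i t • d t = c i • u i)
    (heq : ∑ i, ∑ t, F i t ^ 2 = ∑ i, c i * x i) :
    (∀ j, ∑ i, (c i * (inner ℝ (u i) (w j) : ℝ)) • u i = (lam j * extendConst x j) • w j) ∧
      ∑ j : Fin n, extendConst x j * (lam j * extendConst x j) = ∑ i, c i * x i := by
  have h1 := lower_bound_with_defects h hm hmn hnK hw hlam hd hF
  have h2 := sum_mul_le_sum_weights h hm hmn hw.1 hu hc0 hc
  have h3 : 0 ≤ ∑ i, ∑ t, (F i t - certificate d w x (u i) t) ^ 2 :=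
    sum_nonneg fun _ _ => sum_nonneg fun _ _ => sq_nonneg _
  have h4' : ∀ j, 0 ≤ lam j * extendConst x j ^ 2 * (1 - ∑ i, (inner ℝ (w j) (u i) : ℝ) ^ 2) :=
    fun j => mul_nonneg (mul_nonneg (eigenvalue_gram_nonneg hw j) (sq_nonneg _))
      (sub_nonneg.2 (sum_inner_sq_le_one hw.1 hu j))
  have h4 := sum_nonneg fun j (_ : j ∈ univ) => h4' j
  have h5 : ∑ i, ∑ t, (F i t - certificate d w x (u i) t) ^ 2 = 0 := by linarith
  have h6 : ∑ j, lam j * extendConst x j ^ 2 * (1 - ∑ i, (inner ℝ (w j) (u i) : ℝ) ^ 2) = 0 := by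
    linarith
  have h7 : ∑ i, c i * ∑ j : Fin n, extendConst x j * (inner ℝ (w j) (u i) : ℝ) ^ 2 = ∑ i, c i * x i := by
    linarith
  have hcert : ∀ i t, F i t = certificate d w x (u i) t := fun i t => by
    have := (sum_eq_zero_iff_of_nonneg fun i _ => sum_nonneg fun _ _ => sq_nonneg _).1 h5 i
      (mem_univ i)
    have := (sum_eq_zero_iff_of_nonneg fun t _ => sq_nonneg _).1 this t (mem_univ t)
    exact sub_eq_zero.1 (pow_eq_zero_iff two_ne_zero |>.1 this)
  -- As `F i` equals its certificate, `c i u i = D Dᵀ B u i`; the components along `w j` are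
  -- compared.
  have hproj : ∀ i j, c i * (inner ℝ (u i) (w j) : ℝ) =
      lam j * extendConst x j * inner ℝ (u i) (w j) := fun i j => by
    have e1 := hF i
    simp only [hcert, sum_certificate_smul hw] at e1
    have e2 := congrArg (fun y => (inner ℝ y (w j) : ℝ)) e1
    simp only [sum_inner, real_inner_smul_left, Orthonormal.inner_eq_ite hw.1] at e2
    rw [← e2]
    simp [real_inner_comm]
  have hpos := h.extendConst_pos hm
  -- If `lam j = 0`, both sides vanish by `hproj`. Otherwise the vanishing defect forces `w j` to
  -- have all its length in the span of the `u i`.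
  have heig : ∀ j, ∑ i, (c i * (inner ℝ (u i) (w j) : ℝ)) • u i =
      (lam j * extendConst x j) • w j := fun j => by
    rcases (eigenvalue_gram_nonneg hw j).eq_or_lt with h0 | h0
    · simp only [hproj, ← h0]; simp
    · have h8 := (sum_eq_zero_iff_of_nonneg fun j _ => h4' j).1 h6 j (mem_univ j)
      have h9 : ∑ i, (inner ℝ (w j) (u i) : ℝ) ^ 2 = 1 := by
        have := (mul_eq_zero.1 h8).resolve_left (mul_pos h0 (pow_pos (hpos j) 2)).ne'
        linarith
      have h10 : ∑ i, (inner ℝ (u i) (w j) : ℝ) • u i = w j := by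
        rw [← sub_eq_zero, ← inner_self_eq_zero (𝕜 := ℝ), inner_sub_left, inner_sub_right,
          inner_sub_right, Orthonormal.inner_eq_ite hw.1, if_pos rfl]
        simp only [sum_inner, inner_sum, real_inner_smul_left, real_inner_smul_right,
          Orthonormal.inner_eq_ite hu, mul_ite, mul_one, mul_zero, sum_ite_eq', mem_univ, if_true]
        simp only [real_inner_comm (u _) (w j)] at h9 ⊢
        simp only [← sq]
        rw [h9]
        ring
      conv_rhs => rw [← h10, smul_sum]
      exact sum_congr rfl fun i _ => by rw [hproj, mul_smul]
  refine ⟨heig, ?_⟩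
  rw [← h7]
  simp only [mul_sum]
  rw [sum_comm]
  refine sum_congr rfl fun j _ => ?_
  have e1 := congrArg (fun y => (inner ℝ y (w j) : ℝ)) (heig j)
  simp only [sum_inner, real_inner_smul_left, Orthonormal.inner_eq_ite hw.1, if_true, mul_one] at e1
  rw [← e1, mul_sum]
  refine sum_congr rfl fun i _ => ?_
  rw [real_inner_comm (u i) (w j)]
  ring

/-- In the case of equality, the sorted eigenbasis of `∑ d_t d_tᵀ` is a sorted eigenbasis of the
variance matrix, and the eigenvalues of `∑ d_t d_tᵀ` are the numbers `c_i / x_i`. -/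
theorem eigenbasis_of_lower_bound_eq
    (h : KKT (extendZero c) (extendZero (foldedLengths len m)) (extendZero x) 0 m)
    (hm : 0 < m) (hnK : n ≤ K) (hd : ∀ t, inner ℝ (d t) (d t) = len t) (hu : Orthonormal ℝ u)
    (hc0 : ∀ i, 0 < c i) (hc : Antitone c) (hF : ∀ i, ∑ t, F i t • d t = c i • u i)
    (heq : ∑ i, ∑ t, F i t ^ 2 = ∑ i, c i * x i) {A : Matrix (Fin n) (Fin n) ℝ}
    (hA : ∀ v, A.mulVec v.ofLp = (∑ i, (c i ^ 2 * (inner ℝ (u i) v : ℝ)) • u i).ofLp)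
    {σ : Fin m → ℝ} (hσc : ∀ i, c i = √(σ i)) (hσ : List.ofFn σ = positiveEigenvalues A)
    (hmn : m ≤ n) :
    ∃ w : Fin n → EuclideanSpace ℝ (Fin n),
      IsOrthonormalEigenseq A (fun j => extendZero σ j) w ∧
      gram d = ∑ i : Fin m, (c i / x i) •
        Matrix.vecMulVec (w (i.castLE hmn)).ofLp (w (i.castLE hmn)).ofLp := by
  obtain ⟨lam, w, hlam, hw⟩ := exists_sorted_eigenbasis (gram_isSymm d)
  obtain ⟨h1, h2⟩ := eigen_of_lower_bound_eq h hm hmn hnK hw hlam hd hu hc0 hc hF heq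
  have hpos := h.extendConst_pos hm
  have hmono := h.extendConst_mono hm
  set s : Fin n → ℝ := fun j => lam j * extendConst x j with hs
  have hs0 : ∀ j, 0 ≤ s j := fun j => mul_nonneg (eigenvalue_gram_nonneg hw j) (hpos j).le
  have hAw : ∀ j, A.mulVec (w j).ofLp = (s j ^ 2) • (w j).ofLp := fun j => by
    rw [hA, ← WithLp.ofLp_smul]
    congr 1
    have e1 : ∀ i, c i * (inner ℝ (u i) (w j) : ℝ) = s j * inner ℝ (u i) (w j) := fun i => by
      have := congrArg (fun y => (inner ℝ (u i) y : ℝ)) (h1 j)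
      simpa [inner_sum, real_inner_smul_right, Orthonormal.inner_eq_ite hu] using this
    rw [sq, mul_smul, ← h1 j, smul_sum]
    refine sum_congr rfl fun i _ => ?_
    rw [smul_smul]
    congr 1
    linear_combination c i * e1 i
  -- the values `s` are a permutation of the values `c`, extended by zeros
  obtain ⟨ρ, hρ⟩ : ∃ ρ : Equiv.Perm (Fin n), Antitone (s ∘ ρ) :=
    ⟨Tuple.sort (fun j => -s j), fun i j hij => by
      have := Tuple.monotone_sort (fun j => -s j) hij
      simpa using this⟩
  -- The `w j` form an eigenbasis of `A` with eigenvalues `s j ^ 2`, so any non-increasing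
  -- arrangement of `s` must be `c` followed by zeros.
  have hspec : ∀ ρ : Equiv.Perm (Fin n), Antitone (s ∘ ρ) →
      ∀ j, s (ρ j) = extendZero c j := by
    intro ρ hρ j
    obtain ⟨-, k1, k2⟩ := positiveEigenvalues_spec (A := A) (τ := fun j => s (ρ j) ^ 2)
      (w := w ∘ ρ) ⟨hw.1.comp ρ ρ.injective, fun j => hAw (ρ j)⟩
      (fun i j hij => pow_le_pow_left₀ (hs0 _) (hρ hij) 2) hσ
    by_cases hj : (j : ℕ) < m
    · have := k2 j hj
      rw [extendZero_of_lt _ hj] at this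
      rw [extendZero_of_lt _ hj, hσc, ← this, Real.sqrt_sq (hs0 _)]
    · have := (k1 j).not.2 hj
      rw [extendZero_of_le _ (not_lt.1 hj)]
      exact pow_eq_zero_iff two_ne_zero |>.1 (le_antisymm (not_lt.1 this) (sq_nonneg _))
  -- `∑ x s` equals the value of the oppositely sorted pairing of `x` with the entries of `s`.
  -- Equality in the rearrangement inequality makes `x` and `s` antivary.
  have hanti : Antitone s := by
    have e1 : s = (fun j : Fin n => extendZero c j) ∘ (ρ⁻¹ : Equiv.Perm (Fin n)) := by
      funext j
      have := hspec ρ hρ (ρ⁻¹ j)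
      rw [Function.comp, ← this]
      simp
    have e2 : Antivary (fun j : Fin n => extendConst x j) fun j : Fin n => extendZero c j := by
      intro i j hij
      refine hmono ?_
      by_contra hlt
      have hlt : (i : ℕ) ≤ j := by omega
      dsimp only at hij
      by_cases hj : (j : ℕ) < m
      · rw [extendZero_of_lt _ hj, extendZero_of_lt c (show (i : ℕ) < m by omega)] at hij
        exact absurd hij (not_lt.2 (hc (Fin.le_def.2 hlt)))
      · rw [extendZero_of_le _ (not_lt.1 hj)] at hij
        refine absurd hij (not_lt.2 ?_)
        unfold extendZero
        split_ifs
        · exact (hc0 _).le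
        · exact le_rfl
    have e3 : ∑ j : Fin n, extendConst x j * extendZero c j = ∑ i, c i * x i := by
      rw [Fin.sum_univ_eq_sum_range (fun j => extendConst x j * extendZero c j),
        ← sum_subset (range_subset_range.2 hmn),
        ← Fin.sum_univ_eq_sum_range (fun j => extendConst x j * extendZero c j)]
      · refine sum_congr rfl fun i _ => ?_
        rw [extendConst_of_lt x i.2, extendZero_apply, extendZero_apply, mul_comm]
      · intro t _ ht
        rw [extendZero_of_le c (not_lt.1 (mem_range.not.1 ht)), mul_zero]
    have e4 : Antivary (fun j : Fin n => extendConst x j) s := by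
      rw [e1, ← e2.sum_mul_eq_sum_mul_comp_perm_iff, e3, ← h2]
      refine sum_congr rfl fun j _ => ?_
      have := congrFun e1 j
      simp only [Function.comp] at this
      rw [← this]
    intro i j hij
    by_contra hlt
    have hlt := not_le.1 hlt
    -- Antivariation leaves the order of `s` open where `x` is constant; there `s` is a positive
    -- multiple of the sorted `lam`.
    have e5 : extendConst x i = extendConst x j := le_antisymm (hmono hij) (e4 hlt)
    have e6 : s j ≤ s i := by
      simp only [hs, e5]
      exact mul_le_mul_of_nonneg_right (hlam hij) (hpos j).le
    exact absurd hlt (not_lt.2 e6)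
  have hsc : ∀ j, s j = extendZero c j := fun j => hspec 1 hanti j
  refine ⟨w, ⟨hw.1, fun j => ?_⟩, ?_⟩
  · rw [hAw, hsc]
    congr 1
    change extendZero c j ^ 2 = extendZero σ j
    by_cases hj : (j : ℕ) < m
    · rw [extendZero_of_lt _ hj, extendZero_of_lt _ hj, hσc, Real.sq_sqrt]
      by_contra hneg
      have := hc0 ⟨j, hj⟩
      rw [hσc, Real.sqrt_eq_zero_of_nonpos (not_le.1 hneg).le] at this
      exact absurd this (lt_irrefl _)
    · rw [extendZero_of_le _ (not_lt.1 hj), extendZero_of_le _ (not_lt.1 hj)]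
      simp
  · rw [eq_sum_vecMulVec hw]
    have hlamj : ∀ j, lam j = extendZero c j / extendConst x j := fun j => by
      rw [← hsc j]
      simp only [hs]
      field_simp [(hpos j).ne']
    symm
    refine sum_of_injOn (fun i : Fin m => i.castLE hmn) (by intro i _ j _ hij; simpa using hij)
      (fun _ _ => mem_univ _) ?_ ?_
    -- Beyond `m` the eigenvalue `lam j` is zero, because `c` is continued by zeros and `x` by a
    -- positive constant.
    · intro j _ hj
      have : m ≤ (j : ℕ) := by
        by_contra hlt
        exact hj ⟨⟨j, not_le.1 hlt⟩, by simp, by simp⟩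
      rw [hlamj, extendZero_of_le _ this, zero_div, zero_smul]
    · intro i _
      rw [hlamj]
      have e1 : extendZero c ((i.castLE hmn : Fin n) : ℕ) = c i := extendZero_apply c i
      have e2 : extendConst x ((i.castLE hmn : Fin n) : ℕ) = x i :=
        (extendConst_of_lt x i.2).trans (extendZero_apply x i)
      rw [e1, e2]

end LowerBound

end L2Dictionary

namespace L2Dictionary

open Finset

section Cost

variable {n K m : ℕ} {P : Measure (EuclideanSpace ℝ (Fin n))}

/-! ## The cost of a scheme -/

theorem cost_eq_of_memLp {f : EuclideanSpace ℝ (Fin n) → EuclideanSpace ℝ (Fin K)}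
    (hf : ∀ t, MemLp (fun v => f v t) 2 P) :
    cost P f = ENNReal.ofReal (∑ t, ∫ v, f v t ^ 2 ∂P) := by
  have h1 : ∀ v, (inner ℝ (f v) (f v) : ℝ) = ∑ t, f v t ^ 2 := fun v => by
    rw [inner_eq_dotProduct, dotProduct]
    exact sum_congr rfl fun t _ => (sq _).symm
  rw [cost, ← integral_finsetSum _ fun t _ => (hf t).integrable_sq,
    ofReal_integral_eq_lintegral_ofReal (integrable_finsetSum _ fun t _ => (hf t).integrable_sq)
      (Filter.Eventually.of_forall fun v => sum_nonneg fun t _ => sq_nonneg _)]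
  simp only [h1]

theorem memLp_of_cost_ne_top {f : EuclideanSpace ℝ (Fin n) → EuclideanSpace ℝ (Fin K)}
    (hf : AEMeasurable f P) (hcost : cost P f ≠ ⊤) (t : Fin K) : MemLp (fun v => f v t) 2 P := by
  have hm : AEMeasurable (fun v => f v t) P :=
    (EuclideanSpace.proj (𝕜 := ℝ) t).measurable.comp_aemeasurable hf
  have h1 : Integrable (fun v => (inner ℝ (f v) (f v) : ℝ)) P :=
    (lintegral_ofReal_ne_top_iff_integrable (hf.aestronglyMeasurable.inner hf.aestronglyMeasurable)
      (Filter.Eventually.of_forall fun v => real_inner_self_nonneg)).1 hcost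
  refine (memLp_two_iff_integrable_sq hm.aestronglyMeasurable).2 ?_
  refine h1.mono' (hm.aestronglyMeasurable.pow 2) (Filter.Eventually.of_forall fun v => ?_)
  rw [Real.norm_of_nonneg (sq_nonneg _), inner_eq_dotProduct, dotProduct, sq]
  exact single_le_sum (f := fun t => f v t * f v t) (fun t _ => mul_self_nonneg _) (mem_univ t)

/-- Bessel's inequality in `L²`, with the defect. -/
theorem integral_sq_sub_sum {ξ : Fin m → EuclideanSpace ℝ (Fin n) → ℝ}
    (hξ : ∀ i, MemLp (ξ i) 2 P) (ho : ∀ i j, ∫ v, ξ i v * ξ j v ∂P = if i = j then 1 else 0)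
    {g : EuclideanSpace ℝ (Fin n) → ℝ} (hg : MemLp g 2 P) :
    ∫ v, (g v - ∑ i, (∫ v, ξ i v * g v ∂P) * ξ i v) ^ 2 ∂P =
      ∫ v, g v ^ 2 ∂P - ∑ i, (∫ v, ξ i v * g v ∂P) ^ 2 := by
  set F : Fin m → ℝ := fun i => ∫ v, ξ i v * g v ∂P with hF
  have e : ∀ v, (g v - ∑ i, F i * ξ i v) ^ 2 = g v ^ 2 - ∑ i, 2 * F i * (ξ i v * g v) +
      ∑ i, ∑ j, F i * F j * (ξ i v * ξ j v) := fun v => by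
    rw [sub_sq, sq (∑ i, F i * ξ i v), sum_mul_sum, mul_sum]
    congr 1
    · congr 1
      exact sum_congr rfl fun i _ => by ring
    · exact sum_congr rfl fun i _ => sum_congr rfl fun j _ => by ring
  have i1 : ∀ i ∈ univ, Integrable (fun v => 2 * F i * (ξ i v * g v)) P := fun i _ =>
    ((hξ i).integrable_mul hg).const_mul _
  have i2 : ∀ i, ∀ j ∈ univ, Integrable (fun v => F i * F j * (ξ i v * ξ j v)) P := fun i j _ =>
    ((hξ i).integrable_mul (hξ j)).const_mul _
  have i3 := fun i (_ : i ∈ univ) => integrable_finsetSum _ (i2 i)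
  change ∫ v, (g v - ∑ i, F i * ξ i v) ^ 2 ∂P = ∫ v, g v ^ 2 ∂P - ∑ i, F i ^ 2
  simp only [e]
  have i4 : Integrable (fun v => g v ^ 2 - ∑ i, 2 * F i * (ξ i v * g v)) P :=
    hg.integrable_sq.sub (integrable_finsetSum _ i1)
  rw [integral_add i4 (integrable_finsetSum _ i3),
    integral_sub hg.integrable_sq (integrable_finsetSum _ i1), integral_finsetSum _ i1,
    integral_finsetSum _ i3]
  have e2 : ∀ i, ∫ v, ∑ j, F i * F j * (ξ i v * ξ j v) ∂P = F i ^ 2 := fun i => by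
    rw [integral_finsetSum _ (i2 i)]
    simp only [integral_const_mul, ho]
    simp [sq]
  simp only [e2, integral_const_mul]
  have e3 : ∀ i, 2 * F i * ∫ v, ξ i v * g v ∂P = 2 * F i ^ 2 := fun i => by
    change 2 * F i * F i = _
    ring
  simp only [e3, ← mul_sum]
  ring

theorem varianceMatrix_isSymm : (varianceMatrix P).IsSymm := by
  ext i j
  exact ProbabilityTheory.covariance_comm _ _

end Cost

/-! ## Second moments -/

section Probability

variable {n K m : ℕ} {P : Measure (EuclideanSpace ℝ (Fin n))} [IsProbabilityMeasure P]

theorem memLp_inner_sub (hP : MemLp (fun v : EuclideanSpace ℝ (Fin n) => v) 2 P)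
    (a b : EuclideanSpace ℝ (Fin n)) : MemLp (fun v => (inner ℝ a (v - b) : ℝ)) 2 P :=
  (hP.sub (memLp_const b)).const_inner a

theorem integral_inner_sub_mean (hP : MemLp (fun v : EuclideanSpace ℝ (Fin n) => v) 2 P)
    (a c : EuclideanSpace ℝ (Fin n)) :
    ∫ v, (inner ℝ a (v - c) : ℝ) ∂P = inner ℝ a (∫ v, v ∂P - c) := by
  have hi : Integrable (fun v : EuclideanSpace ℝ (Fin n) => v) P := hP.integrable one_le_two
  have hs : Integrable (fun v : EuclideanSpace ℝ (Fin n) => v - c) P := hi.sub (integrable_const c)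
  rw [integral_inner hs a, integral_sub hi (integrable_const c)]
  simp

theorem integrable_inner_mul_inner (hP : MemLp (fun v : EuclideanSpace ℝ (Fin n) => v) 2 P)
    (a b c d : EuclideanSpace ℝ (Fin n)) :
    Integrable (fun v => (inner ℝ a (v - c) : ℝ) * inner ℝ b (v - d)) P :=
  (memLp_inner_sub hP a c).integrable_mul (memLp_inner_sub hP b d)

theorem integral_inner_mul_inner (hP : MemLp (fun v : EuclideanSpace ℝ (Fin n) => v) 2 P)
    (a b : EuclideanSpace ℝ (Fin n)) :
    ∫ v, (inner ℝ a (v - ∫ v, v ∂P) : ℝ) * inner ℝ b (v - ∫ v, v ∂P) ∂P =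
      a.ofLp ⬝ᵥ (varianceMatrix P).mulVec b.ofLp := by
  set μ := ∫ v, v ∂P with hμ
  have hi : Integrable (fun v : EuclideanSpace ℝ (Fin n) => v) P := hP.integrable one_le_two
  have hcoord : ∀ i : Fin n, MemLp (fun v : EuclideanSpace ℝ (Fin n) => v i - μ i) 2 P := fun i => by
    have := memLp_inner_sub hP (EuclideanSpace.single i (1 : ℝ)) μ
    simpa [EuclideanSpace.inner_single_left] using this
  have hmean : ∀ i : Fin n, ∫ v : EuclideanSpace ℝ (Fin n), v i ∂P = μ i := fun i => by
    have := integral_inner_sub_mean hP (EuclideanSpace.single i (1 : ℝ)) 0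
    simpa [EuclideanSpace.inner_single_left] using this
  have hcov : ∀ i j, varianceMatrix P i j =
      ∫ v : EuclideanSpace ℝ (Fin n), (v i - μ i) * (v j - μ j) ∂P := fun i j => by
    rw [← hmean i, ← hmean j]
    rfl
  have hint : ∀ i j, Integrable (fun v : EuclideanSpace ℝ (Fin n) =>
      a i * (b j * ((v i - μ i) * (v j - μ j)))) P := fun i j =>
    ((hcoord i).integrable_mul (hcoord j)).const_mul _ |>.const_mul _
  have hexp : ∀ v : EuclideanSpace ℝ (Fin n), (inner ℝ a (v - μ) : ℝ) * inner ℝ b (v - μ) =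
      ∑ i, ∑ j, a i * (b j * ((v i - μ i) * (v j - μ j))) := fun v => by
    rw [inner_eq_dotProduct, inner_eq_dotProduct, dotProduct, dotProduct, sum_mul_sum]
    refine sum_congr rfl fun i _ => sum_congr rfl fun j _ => ?_
    simp only [WithLp.ofLp_sub, Pi.sub_apply]
    ring
  simp only [hexp]
  rw [integral_finsetSum _ fun i _ => integrable_finsetSum _ fun j _ => hint i j, dotProduct]
  refine sum_congr rfl fun i _ => ?_
  rw [integral_finsetSum _ fun j _ => hint i j, Matrix.mulVec, dotProduct, mul_sum]
  refine sum_congr rfl fun j _ => ?_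
  rw [integral_const_mul, integral_const_mul, hcov]
  ring

theorem eigenvalue_varianceMatrix_nonneg
    (hP : MemLp (fun v : EuclideanSpace ℝ (Fin n) => v) 2 P) {τ : Fin m → ℝ}
    {w : Fin m → EuclideanSpace ℝ (Fin n)}
    (h : IsOrthonormalEigenseq (varianceMatrix P) τ w) (j : Fin m) : 0 ≤ τ j := by
  have h1 := integral_inner_mul_inner hP (w j) (w j)
  rw [h.2 j, ← WithLp.ofLp_smul, ← inner_eq_dotProduct, real_inner_smul_right,
    Orthonormal.inner_eq_ite h.1, if_pos rfl, mul_one] at h1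
  rw [← h1]
  exact integral_nonneg fun v => mul_self_nonneg _

theorem trace_varianceMatrix_eq (hP : MemLp (fun v : EuclideanSpace ℝ (Fin n) => v) 2 P)
    {σ : Fin m → ℝ} (hσ : List.ofFn σ = positiveEigenvalues (varianceMatrix P)) :
    (varianceMatrix P).trace = ∑ i, σ i := by
  obtain ⟨τ, w, hτ, hw⟩ := exists_sorted_eigenbasis (varianceMatrix_isSymm (P := P))
  obtain ⟨hmn, h1, h2⟩ := positiveEigenvalues_spec hw hτ hσ
  rw [trace_eq_sum hw, sum_univ_eq_sum_range_extendZero τ, sum_univ_eq_sum_range_extendZero σ]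
  refine (sum_subset_zero_on_sdiff (range_subset_range.2 hmn) (fun t ht => ?_)
    fun t ht => ?_).symm
  · simp only [mem_sdiff, mem_range] at ht
    rw [extendZero_of_lt _ ht.1]
    exact le_antisymm (not_lt.1 ((h1 ⟨t, ht.1⟩).not.2 ht.2))
      (eigenvalue_varianceMatrix_nonneg hP hw _)
  · have ht := mem_range.1 ht
    rw [extendZero_of_lt τ (show t < n by omega)]
    exact (h2 ⟨t, by omega⟩ ht).symm

theorem integral_norm_sq (hP : MemLp (fun v : EuclideanSpace ℝ (Fin n) => v) 2 P) :
    ∫ v, (inner ℝ (v - ∫ v, v ∂P) (v - ∫ v, v ∂P) : ℝ) ∂P = (varianceMatrix P).trace := by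
  have h1 : ∀ v : EuclideanSpace ℝ (Fin n), (inner ℝ (v - ∫ v, v ∂P) (v - ∫ v, v ∂P) : ℝ) =
      ∑ i, (inner ℝ (EuclideanSpace.single i (1 : ℝ)) (v - ∫ v, v ∂P) : ℝ) *
        inner ℝ (EuclideanSpace.single i (1 : ℝ)) (v - ∫ v, v ∂P) := fun v => by
    rw [inner_eq_dotProduct, dotProduct]
    simp [EuclideanSpace.inner_single_left]
  simp only [h1]
  rw [integral_finsetSum _ fun i _ =>
    integrable_inner_mul_inner hP _ _ _ _, Matrix.trace]
  refine sum_congr rfl fun i _ => ?_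
  rw [integral_inner_mul_inner hP]
  simp

section Eigenseq

variable {σ : Fin m → ℝ} {u : Fin m → EuclideanSpace ℝ (Fin n)}

theorem integral_eigen_mul (hP : MemLp (fun v : EuclideanSpace ℝ (Fin n) => v) 2 P)
    (hu : IsOrthonormalEigenseq (varianceMatrix P) σ u) (b : EuclideanSpace ℝ (Fin n)) (i : Fin m) :
    ∫ v, (inner ℝ b (v - ∫ v, v ∂P) : ℝ) * inner ℝ (u i) (v - ∫ v, v ∂P) ∂P =
      σ i * inner ℝ b (u i) := by
  rw [integral_inner_mul_inner hP, hu.2 i, ← WithLp.ofLp_smul, ← inner_eq_dotProduct,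
    real_inner_smul_right]

/-- Almost surely, `V - E[V]` lies in the span of the eigenvectors for positive eigenvalues. -/
theorem ae_eq_sum_eigen (hP : MemLp (fun v : EuclideanSpace ℝ (Fin n) => v) 2 P)
    (hσ : List.ofFn σ = positiveEigenvalues (varianceMatrix P))
    (hu : IsOrthonormalEigenseq (varianceMatrix P) σ u) :
    ∀ᵐ v ∂P, v - ∫ v, v ∂P = ∑ i, (inner ℝ (u i) (v - ∫ v, v ∂P) : ℝ) • u i := by
  set μ := ∫ v, v ∂P with hμ
  -- The squared norm of the component of `v - μ` orthogonal to the `u i`. Its integral is the trace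
  -- of the variance minus the sum of the positive eigenvalues, which is zero.
  set g : EuclideanSpace ℝ (Fin n) → ℝ := fun v => inner ℝ (v - μ) (v - μ) -
    ∑ i, (inner ℝ (u i) (v - μ) : ℝ) * inner ℝ (u i) (v - μ) with hg
  have hsq : ∀ v, g v = inner ℝ (v - μ - ∑ i, (inner ℝ (u i) (v - μ) : ℝ) • u i)
      (v - μ - ∑ i, (inner ℝ (u i) (v - μ) : ℝ) • u i) := fun v => by
    simp only [hg]
    generalize v - μ = y
    have h1 : (inner ℝ (∑ i, (inner ℝ (u i) y : ℝ) • u i) y : ℝ) =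
        ∑ i, (inner ℝ (u i) y : ℝ) * inner ℝ (u i) y := by
      simp only [sum_inner, real_inner_smul_left]
    have h2 : (inner ℝ (∑ i, (inner ℝ (u i) y : ℝ) • u i)
        (∑ i, (inner ℝ (u i) y : ℝ) • u i) : ℝ) =
        ∑ i, (inner ℝ (u i) y : ℝ) * inner ℝ (u i) y := by
      simp only [sum_inner, inner_sum, real_inner_smul_left, real_inner_smul_right,
        Orthonormal.inner_eq_ite hu.1]
      simp
    rw [inner_sub_left, inner_sub_right, inner_sub_right, h2, h1, (real_inner_comm _ _).trans h1]
    ring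
  have i1 : Integrable (fun v : EuclideanSpace ℝ (Fin n) => (inner ℝ (v - μ) (v - μ) : ℝ)) P := by
    have := (hP.sub (memLp_const μ)).integrable_norm_pow two_ne_zero
    refine this.congr (Filter.Eventually.of_forall fun v => ?_)
    simp
  have i2 : ∀ i ∈ univ, Integrable (fun v : EuclideanSpace ℝ (Fin n) =>
      (inner ℝ (u i) (v - μ) : ℝ) * inner ℝ (u i) (v - μ)) P := fun i _ =>
    integrable_inner_mul_inner hP _ _ _ _
  have hint : Integrable g P := i1.sub (integrable_finsetSum _ i2)
  have h0 : ∫ v, g v ∂P = 0 := by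
    rw [hg, integral_sub i1 (integrable_finsetSum _ i2), integral_finsetSum _ i2,
      integral_norm_sq hP, trace_varianceMatrix_eq hP hσ, sub_eq_zero]
    refine sum_congr rfl fun i _ => ?_
    rw [integral_eigen_mul hP hu, Orthonormal.inner_eq_ite hu.1, if_pos rfl, mul_one]
  have h1 := (integral_eq_zero_iff_of_nonneg (fun v => by
    rw [hsq v]; exact real_inner_self_nonneg) hint).1 h0
  filter_upwards [h1] with v hv
  rw [hsq v] at hv
  exact sub_eq_zero.1 (inner_self_eq_zero.1 hv)

/-- Since `V - μ` lies almost surely in the span of the `u i`, the variance acts only through them;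
the given `u` need not be extended to a full eigenbasis. -/
theorem varianceMatrix_mulVec (hP : MemLp (fun v : EuclideanSpace ℝ (Fin n) => v) 2 P)
    (hσ : List.ofFn σ = positiveEigenvalues (varianceMatrix P))
    (hu : IsOrthonormalEigenseq (varianceMatrix P) σ u) (b : EuclideanSpace ℝ (Fin n)) :
    (varianceMatrix P).mulVec b.ofLp = (∑ i, (σ i * (inner ℝ (u i) b : ℝ)) • u i).ofLp := by
  suffices h : WithLp.toLp 2 ((varianceMatrix P).mulVec b.ofLp) =
      ∑ i, (σ i * (inner ℝ (u i) b : ℝ)) • u i by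
    rw [← h]
  refine ext_inner_left ℝ fun a => ?_
  rw [inner_eq_dotProduct, ← integral_inner_mul_inner hP]
  have h1 := ae_eq_sum_eigen hP hσ hu
  have h2 : ∫ v, (inner ℝ a (v - ∫ v, v ∂P) : ℝ) * inner ℝ b (v - ∫ v, v ∂P) ∂P =
      ∫ v, ∑ i, (inner ℝ a (u i) : ℝ) * ((inner ℝ b (v - ∫ v, v ∂P) : ℝ) *
        inner ℝ (u i) (v - ∫ v, v ∂P)) ∂P := by
    refine integral_congr_ae ?_
    filter_upwards [h1] with v hv
    conv_lhs => enter [1]; rw [hv]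
    rw [inner_sum, sum_mul]
    refine sum_congr rfl fun i _ => ?_
    rw [real_inner_smul_right]
    ring
  rw [h2, integral_finsetSum _ fun i _ =>
    (integrable_inner_mul_inner hP _ _ _ _).const_mul _, inner_sum]
  refine sum_congr rfl fun i _ => ?_
  rw [integral_const_mul, integral_eigen_mul hP hu, real_inner_smul_right, real_inner_comm b]
  ring

end Eigenseq

/-! ### Projection of a scheme to the whitened coordinates -/

section Scheme

variable {σ : Fin m → ℝ} {u : Fin m → EuclideanSpace ℝ (Fin n)} {c : Fin m → ℝ}

/-- The normalized coordinates of `V - E[V]`. -/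
noncomputable def whitened (P : Measure (EuclideanSpace ℝ (Fin n))) (c : Fin m → ℝ)
    (u : Fin m → EuclideanSpace ℝ (Fin n)) (i : Fin m) (v : EuclideanSpace ℝ (Fin n)) : ℝ :=
  (c i)⁻¹ * inner ℝ (u i) (v - ∫ v, v ∂P)

/-- The coefficients of a scheme with respect to the normalized coordinates. -/
noncomputable def schemeCoeff (P : Measure (EuclideanSpace ℝ (Fin n))) (c : Fin m → ℝ)
    (u : Fin m → EuclideanSpace ℝ (Fin n))
    (f : EuclideanSpace ℝ (Fin n) → EuclideanSpace ℝ (Fin K)) (i : Fin m) (t : Fin K) : ℝ :=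
  ∫ v, whitened P c u i v * f v t ∂P

theorem memLp_whitened (hP : MemLp (fun v : EuclideanSpace ℝ (Fin n) => v) 2 P) (i : Fin m) :
    MemLp (whitened P c u i) 2 P :=
  (memLp_inner_sub hP _ _).const_mul _

theorem integral_whitened_mul (hP : MemLp (fun v : EuclideanSpace ℝ (Fin n) => v) 2 P)
    (hu : IsOrthonormalEigenseq (varianceMatrix P) σ u) (hc : ∀ i, 0 < c i)
    (hcσ : ∀ i, c i ^ 2 = σ i) (i j : Fin m) :
    ∫ v, whitened P c u i v * whitened P c u j v ∂P = if i = j then 1 else 0 := by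
  have : ∀ v, whitened P c u i v * whitened P c u j v = (c i)⁻¹ * (c j)⁻¹ *
      ((inner ℝ (u i) (v - ∫ v, v ∂P) : ℝ) * inner ℝ (u j) (v - ∫ v, v ∂P)) := fun v => by
    rw [whitened, whitened]; ring
  simp only [this]
  rw [integral_const_mul, integral_eigen_mul hP hu, Orthonormal.inner_eq_ite hu.1]
  split_ifs with h
  · subst h
    have := (hc i).ne'
    rw [← hcσ]
    field_simp
  · simp

/-- Multiply `V - c₀ = D f(V)` by a whitened coordinate and integrate. The whitened coordinates have
mean zero, so `μ - c₀` drops out, and the lower bound does not depend on the constant. -/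
theorem sum_schemeCoeff_smul (hP : MemLp (fun v : EuclideanSpace ℝ (Fin n) => v) 2 P)
    (hu : IsOrthonormalEigenseq (varianceMatrix P) σ u) (hc : ∀ i, 0 < c i)
    (hcσ : ∀ i, c i ^ 2 = σ i) {f : EuclideanSpace ℝ (Fin n) → EuclideanSpace ℝ (Fin K)}
    (hf : ∀ t, MemLp (fun v => f v t) 2 P) {c₀ : EuclideanSpace ℝ (Fin n)}
    {d : Fin K → EuclideanSpace ℝ (Fin n)} (hd : ∀ᵐ v ∂P, v - c₀ = ∑ t, f v t • d t) (i : Fin m) :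
    ∑ t, schemeCoeff P c u f i t • d t = c i • u i := by
  refine ext_inner_left ℝ fun a => ?_
  rw [inner_sum, real_inner_smul_right]
  have i1 : ∀ t ∈ univ, Integrable (fun v => whitened P c u i v * f v t * inner ℝ a (d t)) P :=
    fun t _ => ((memLp_whitened hP i).integrable_mul (hf t)).mul_const _
  have e1 : ∑ t, (inner ℝ a (schemeCoeff P c u f i t • d t) : ℝ) =
      ∫ v, whitened P c u i v * inner ℝ a (v - c₀) ∂P := by
    have : ∫ v, whitened P c u i v * inner ℝ a (v - c₀) ∂P =
        ∫ v, ∑ t, whitened P c u i v * f v t * inner ℝ a (d t) ∂P := by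
      refine integral_congr_ae ?_
      filter_upwards [hd] with v hv
      rw [hv, inner_sum, mul_sum]
      exact sum_congr rfl fun t _ => by rw [real_inner_smul_right]; ring
    rw [this, integral_finsetSum _ i1]
    refine sum_congr rfl fun t _ => ?_
    rw [integral_mul_const, real_inner_smul_right]
    rfl
  rw [e1]
  set μ := ∫ v, v ∂P with hμ
  have e2 : ∀ v, whitened P c u i v * inner ℝ a (v - c₀) =
      (c i)⁻¹ * ((inner ℝ a (v - μ) : ℝ) * inner ℝ (u i) (v - μ)) +
        (c i)⁻¹ * (inner ℝ a (μ - c₀) : ℝ) * inner ℝ (u i) (v - μ) := fun v => by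
    rw [whitened, ← hμ, ← sub_add_sub_cancel v μ c₀, inner_add_right]
    ring
  simp only [e2]
  rw [integral_add ((integrable_inner_mul_inner hP _ _ _ _).const_mul _)
    (((memLp_inner_sub hP _ _).integrable one_le_two).const_mul _), integral_const_mul,
    integral_const_mul, integral_eigen_mul hP hu, integral_inner_sub_mean hP, sub_self,
    inner_zero_right, mul_zero, add_zero, ← hcσ]
  have := (hc i).ne'
  field_simp

/-- The decomposition of the cost of a scheme. -/
theorem sum_integral_sq_eq (hP : MemLp (fun v : EuclideanSpace ℝ (Fin n) => v) 2 P)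
    (hu : IsOrthonormalEigenseq (varianceMatrix P) σ u) (hc : ∀ i, 0 < c i)
    (hcσ : ∀ i, c i ^ 2 = σ i) {f : EuclideanSpace ℝ (Fin n) → EuclideanSpace ℝ (Fin K)}
    (hf : ∀ t, MemLp (fun v => f v t) 2 P) :
    ∑ t, ∫ v, f v t ^ 2 ∂P = ∑ i, ∑ t, schemeCoeff P c u f i t ^ 2 +
      ∑ t, ∫ v, (f v t - ∑ i, schemeCoeff P c u f i t * whitened P c u i v) ^ 2 ∂P := by
  rw [sum_comm, ← sum_add_distrib]
  refine sum_congr rfl fun t _ => ?_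
  have := integral_sq_sub_sum (fun i => memLp_whitened (c := c) (u := u) hP i)
    (integral_whitened_mul hP hu hc hcσ) (hf t)
  simp only [schemeCoeff]
  rw [this]
  ring

theorem ae_eq_of_sum_integral_sq_eq (hP : MemLp (fun v : EuclideanSpace ℝ (Fin n) => v) 2 P)
    {f : EuclideanSpace ℝ (Fin n) → EuclideanSpace ℝ (Fin K)}
    (hf : ∀ t, MemLp (fun v => f v t) 2 P)
    (h0 : ∑ t, ∫ v, (f v t - ∑ i, schemeCoeff P c u f i t * whitened P c u i v) ^ 2 ∂P = 0) :
    ∀ᵐ v ∂P, ∀ t, f v t = ∑ i, schemeCoeff P c u f i t * whitened P c u i v := by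
  rw [ae_all_iff]
  intro t
  have h1 := (sum_eq_zero_iff_of_nonneg fun t _ => integral_nonneg fun v => sq_nonneg _).1 h0 t
    (mem_univ t)
  have hL : MemLp (fun v => f v t - ∑ i, schemeCoeff P c u f i t * whitened P c u i v) 2 P :=
    (hf t).sub (memLp_finsetSum _ fun i _ => (memLp_whitened hP i).const_mul _)
  have h2 := (integral_eq_zero_iff_of_nonneg (fun v => sq_nonneg _) hL.integrable_sq).1 h1
  filter_upwards [h2] with v hv
  exact sub_eq_zero.1 (pow_eq_zero_iff two_ne_zero |>.1 hv)

end Scheme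

end Probability

end L2Dictionary

namespace L2Dictionary

open Finset

/-! ## Dictionaries with a prescribed Gram matrix -/

section Pinv

variable {n K m : ℕ} {d : Fin K → EuclideanSpace ℝ (Fin n)} {lam : Fin m → ℝ}
  {u : Fin m → EuclideanSpace ℝ (Fin n)}

theorem sum_smul_vecMulVec_mulVec (lam : Fin m → ℝ) (u : Fin m → EuclideanSpace ℝ (Fin n))
    (v : EuclideanSpace ℝ (Fin n)) :
    (∑ i, lam i • Matrix.vecMulVec (u i).ofLp (u i).ofLp).mulVec v.ofLp =
      (∑ i, (lam i * (inner ℝ (u i) v : ℝ)) • u i).ofLp := by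
  rw [Matrix.sum_mulVec]
  simp only [Matrix.smul_mulVec, Matrix.vecMulVec_mulVec, WithLp.ofLp_sum, WithLp.ofLp_smul,
    inner_eq_dotProduct]
  refine sum_congr rfl fun t _ => ?_
  ext i
  simp only [Pi.smul_apply, MulOpposite.smul_eq_mul_unop, MulOpposite.unop_op, smul_eq_mul]
  ring

theorem isOrthonormalEigenseq_gram (hu : Orthonormal ℝ u)
    (hg : gram d = ∑ i, lam i • Matrix.vecMulVec (u i).ofLp (u i).ofLp) :
    IsOrthonormalEigenseq (gram d) lam u := by
  refine ⟨hu, fun i => ?_⟩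
  rw [hg, sum_smul_vecMulVec_mulVec]
  simp [Orthonormal.inner_eq_ite hu]

theorem sum_inner_smul (hg : gram d = ∑ i, lam i • Matrix.vecMulVec (u i).ofLp (u i).ofLp)
    (v : EuclideanSpace ℝ (Fin n)) :
    ∑ t, (inner ℝ (d t) v : ℝ) • d t = ∑ i, (lam i * (inner ℝ (u i) v : ℝ)) • u i := by
  refine WithLp.ofLp_injective 2 ?_
  rw [← gram_mulVec, hg, sum_smul_vecMulVec_mulVec]

theorem sum_inner_mul_inner_of_gram (hu : Orthonormal ℝ u)
    (hg : gram d = ∑ i, lam i • Matrix.vecMulVec (u i).ofLp (u i).ofLp) (i j : Fin m) :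
    ∑ t, (inner ℝ (d t) (u i) : ℝ) * inner ℝ (d t) (u j) = if i = j then lam i else 0 := by
  have h1 := congrArg (fun v => (inner ℝ v (u j) : ℝ))
    (sum_inner_smul_eq_of_gram (isOrthonormalEigenseq_gram hu hg) i)
  simp only [sum_inner, real_inner_smul_left, Orthonormal.inner_eq_ite hu] at h1
  rw [h1]
  split_ifs <;> simp

/-- The residual `z` is orthogonal to all `u i`, so `⟨z, D Dᵀ z⟩ = ∑ ⟨d t, z⟩² = 0`. Hence `z` is
orthogonal to `d s` and to its projection, that is, to itself. -/
theorem eq_sum_inner_smul_of_gram (hu : Orthonormal ℝ u)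
    (hg : gram d = ∑ i, lam i • Matrix.vecMulVec (u i).ofLp (u i).ofLp) (s : Fin K) :
    d s = ∑ i, (inner ℝ (d s) (u i) : ℝ) • u i := by
  set z := d s - ∑ i, (inner ℝ (d s) (u i) : ℝ) • u i with hz
  have h1 : ∀ i, (inner ℝ (u i) z : ℝ) = 0 := fun i => by
    rw [hz, inner_sub_right, inner_sum]
    simp [real_inner_smul_right, Orthonormal.inner_eq_ite hu, real_inner_comm]
  have h2 : ∑ t, (inner ℝ (d t) z : ℝ) * inner ℝ (d t) z = 0 := by
    have := congrArg (fun v => (inner ℝ v z : ℝ)) (sum_inner_smul hg z)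
    simpa [sum_inner, real_inner_smul_left, h1] using this
  have h3 : (inner ℝ (d s) z : ℝ) = 0 := mul_self_eq_zero.1
    ((sum_eq_zero_iff_of_nonneg fun t _ => mul_self_nonneg _).1 h2 s (mem_univ s))
  have h4 : (inner ℝ z z : ℝ) = 0 := by
    conv_lhs => enter [2]; rw [hz]
    rw [inner_sub_left, h3, sum_inner]
    simp [real_inner_smul_left, h1]
  exact sub_eq_zero.1 (inner_self_eq_zero.1 h4)

/-- The pseudo-inverse of a dictionary with `∑ dₜ dₜᵀ = ∑ λᵢ uᵢ uᵢᵀ`. -/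
noncomputable def pseudoInverse (d : Fin K → EuclideanSpace ℝ (Fin n)) (lam : Fin m → ℝ)
    (u : Fin m → EuclideanSpace ℝ (Fin n)) : Matrix (Fin K) (Fin n) ℝ :=
  Matrix.of fun t j => ∑ i, (inner ℝ (d t) (u i) : ℝ) / lam i * u i j

theorem affineScheme_pseudoInverse (c v : EuclideanSpace ℝ (Fin n)) (t : Fin K) :
    affineScheme (pseudoInverse d lam u) c v t =
      ∑ i, (inner ℝ (d t) (u i) : ℝ) / lam i * inner ℝ (u i) (v - c) := by
  simp only [affineScheme, pseudoInverse, Matrix.mulVec, dotProduct, Matrix.of_apply, sum_mul]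
  rw [sum_comm]
  refine sum_congr rfl fun i _ => ?_
  rw [inner_eq_dotProduct (u i) (v - c), dotProduct, mul_sum]
  exact sum_congr rfl fun j _ => by ring

theorem dictionaryMatrix_mul_pseudoInverse (hu : Orthonormal ℝ u) (hlam : ∀ i, 0 < lam i)
    (hg : gram d = ∑ i, lam i • Matrix.vecMulVec (u i).ofLp (u i).ofLp) (j k : Fin n) :
    (dictionaryMatrix d * pseudoInverse d lam u) j k = ∑ i, u i j * u i k := by
  have h := fun i => congrArg (fun v : EuclideanSpace ℝ (Fin n) => v j)
    (sum_inner_smul_eq_of_gram (isOrthonormalEigenseq_gram hu hg) i)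
  simp only [WithLp.ofLp_sum, Finset.sum_apply, WithLp.ofLp_smul, Pi.smul_apply, smul_eq_mul] at h
  simp only [Matrix.mul_apply, dictionaryMatrix, pseudoInverse, Matrix.of_apply, mul_sum]
  rw [sum_comm]
  refine sum_congr rfl fun i _ => ?_
  have h1 : ∀ t, d t j * ((inner ℝ (d t) (u i) : ℝ) / lam i * u i k) =
      inner ℝ (d t) (u i) * d t j * (u i k / lam i) := fun t => by ring
  simp only [h1]
  rw [← sum_mul, h i]
  have := (hlam i).ne'
  field_simp

theorem isMoorePenroseInverse_pseudoInverse (hu : Orthonormal ℝ u) (hlam : ∀ i, 0 < lam i)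
    (hg : gram d = ∑ i, lam i • Matrix.vecMulVec (u i).ofLp (u i).ofLp) :
    IsMoorePenroseInverse (dictionaryMatrix d) (pseudoInverse d lam u) := by
  have hDG := dictionaryMatrix_mul_pseudoInverse hu hlam hg
  have hd := eq_sum_inner_smul_of_gram hu hg
  refine ⟨?_, ?_, ?_, ?_⟩
  · ext j t
    rw [Matrix.mul_apply]
    simp only [hDG, sum_mul]
    rw [sum_comm]
    have h1 : ∀ i, ∑ k, u i j * u i k * dictionaryMatrix d k t = inner ℝ (d t) (u i) * u i j :=
      fun i => by
        rw [inner_eq_dotProduct, dotProduct, sum_mul]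
        exact sum_congr rfl fun k _ => by simp only [dictionaryMatrix, Matrix.of_apply]; ring
    simp only [h1]
    have := congrArg (fun v : EuclideanSpace ℝ (Fin n) => v j) (hd t)
    simp only [WithLp.ofLp_sum, Finset.sum_apply, WithLp.ofLp_smul, Pi.smul_apply, smul_eq_mul] at this
    exact this.symm
  · ext t k
    rw [Matrix.mul_assoc, Matrix.mul_apply]
    simp only [hDG]
    simp only [pseudoInverse, Matrix.of_apply, sum_mul_sum]
    rw [sum_comm]
    refine sum_congr rfl fun i _ => ?_
    rw [sum_comm]
    have h1 : ∀ i', ∑ j, (inner ℝ (d t) (u i) : ℝ) / lam i * u i j * (u i' j * u i' k) =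
        (inner ℝ (d t) (u i) : ℝ) / lam i * (inner ℝ (u i) (u i') : ℝ) * u i' k := fun i' => by
      rw [inner_eq_dotProduct, inner_eq_dotProduct, dotProduct, dotProduct, mul_sum, sum_mul]
      exact sum_congr rfl fun j _ => by ring
    simp only [h1, Orthonormal.inner_eq_ite hu]
    simp
  · ext j k
    rw [Matrix.transpose_apply, hDG, hDG]
    exact sum_congr rfl fun i _ => mul_comm _ _
  · have h1 : ∀ s t, (pseudoInverse d lam u * dictionaryMatrix d) s t =
        ∑ i, (inner ℝ (d s) (u i) : ℝ) * inner ℝ (d t) (u i) / lam i := fun s t => by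
      simp only [Matrix.mul_apply, pseudoInverse, dictionaryMatrix, Matrix.of_apply, sum_mul]
      rw [sum_comm]
      refine sum_congr rfl fun i _ => ?_
      rw [inner_eq_dotProduct (d t), dotProduct, mul_sum, sum_div]
      exact sum_congr rfl fun j _ => by ring
    ext s t
    rw [Matrix.transpose_apply, h1, h1]
    exact sum_congr rfl fun i _ => by ring

theorem sum_affineScheme_smul (hu : Orthonormal ℝ u) (hlam : ∀ i, 0 < lam i)
    (hg : gram d = ∑ i, lam i • Matrix.vecMulVec (u i).ofLp (u i).ofLp)
    (c v : EuclideanSpace ℝ (Fin n)) :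
    ∑ t, affineScheme (pseudoInverse d lam u) c v t • d t =
      ∑ i, (inner ℝ (u i) (v - c) : ℝ) • u i := by
  simp only [affineScheme_pseudoInverse, sum_smul]
  rw [sum_comm]
  refine sum_congr rfl fun i _ => ?_
  have h1 := sum_inner_smul_eq_of_gram (isOrthonormalEigenseq_gram hu hg) i
  have h2 : ∀ t, ((inner ℝ (d t) (u i) : ℝ) / lam i * inner ℝ (u i) (v - c)) • d t =
      ((inner ℝ (u i) (v - c) : ℝ) / lam i) • (inner ℝ (d t) (u i) : ℝ) • d t := fun t => by
    rw [smul_smul]; congr 1; ring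
  simp only [h2]
  rw [← smul_sum, h1, smul_smul, div_mul_cancel₀ _ (hlam i).ne']

theorem sum_affineScheme_sq (hu : Orthonormal ℝ u) (hlam : ∀ i, 0 < lam i)
    (hg : gram d = ∑ i, lam i • Matrix.vecMulVec (u i).ofLp (u i).ofLp)
    (c v : EuclideanSpace ℝ (Fin n)) :
    ∑ t, affineScheme (pseudoInverse d lam u) c v t ^ 2 =
      ∑ i, (inner ℝ (u i) (v - c) : ℝ) ^ 2 / lam i := by
  simp only [affineScheme_pseudoInverse, sq, sum_mul_sum]
  rw [sum_comm]
  refine sum_congr rfl fun i _ => ?_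
  rw [sum_comm]
  have h2 : ∀ j, ∑ t, (inner ℝ (d t) (u i) : ℝ) / lam i * inner ℝ (u i) (v - c) *
      ((inner ℝ (d t) (u j) : ℝ) / lam j * inner ℝ (u j) (v - c)) =
      (inner ℝ (u i) (v - c) : ℝ) * inner ℝ (u j) (v - c) / (lam i * lam j) *
        if i = j then lam i else 0 := fun j => by
    rw [← sum_inner_mul_inner_of_gram hu hg i j, mul_sum]
    exact sum_congr rfl fun t _ => by ring
  simp only [h2, mul_ite, mul_zero, sum_ite_eq, mem_univ, if_true]
  have := (hlam i).ne'
  field_simp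

end Pinv

/-! ## Optimality -/

/-- The data which determine the optimal dictionaries: `c i = √σᵢ` for the positive eigenvalues
`σᵢ` of the variance matrix, and the solution `x` of the quadratic program. -/
structure OptimalityData {n K m : ℕ} (P : Measure (EuclideanSpace ℝ (Fin n))) (len : Fin K → ℝ)
    (σ c x : Fin m → ℝ) : Prop where
  le_length : n ≤ K
  memLp : MemLp (fun v : EuclideanSpace ℝ (Fin n) => v) 2 P
  pos : 0 < m
  le_dim : m ≤ n
  eigenvalues : List.ofFn σ = positiveEigenvalues (varianceMatrix P)
  eq_sqrt : ∀ i, c i = √(σ i)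
  sqrt_pos : ∀ i, 0 < c i
  sqrt_anti : Antitone c
  sqrt_sq : ∀ i, c i ^ 2 = σ i
  kkt : KKT (extendZero c) (extendZero (foldedLengths len m)) (extendZero x) 0 m

namespace OptimalityData

variable {n K m : ℕ} {P : Measure (EuclideanSpace ℝ (Fin n))}
  {len : Fin K → ℝ} {σ c x : Fin m → ℝ}

theorem x_pos (S : OptimalityData P len σ c x) (i : Fin m) : 0 < x i := by
  rw [← extendZero_apply x]
  exact S.kkt.pos i (Nat.zero_le _) i.2

theorem lam_pos (S : OptimalityData P len σ c x) (i : Fin m) : 0 < c i / x i :=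
  div_pos (S.sqrt_pos i) (S.x_pos i)

theorem exists_eigenseq (S : OptimalityData P len σ c x) :
    ∃ u, IsOrthonormalEigenseq (varianceMatrix P) σ u := by
  obtain ⟨τ, w, hτ, hw⟩ := exists_sorted_eigenbasis (varianceMatrix_isSymm (P := P))
  obtain ⟨hmn, -, h2⟩ := positiveEigenvalues_spec hw hτ S.eigenvalues
  refine ⟨fun i => w (i.castLE hmn), hw.1.comp _ (Fin.castLE_injective hmn), fun i => ?_⟩
  rw [hw.2, h2 _ i.2, Fin.val_castLE, extendZero_apply]

theorem value_nonneg (S : OptimalityData P len σ c x) : 0 ≤ ∑ i, c i * x i :=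
  sum_nonneg fun i _ => mul_nonneg (S.sqrt_pos i).le (S.x_pos i).le

theorem isOrthonormalEigenseq_castLE (S : OptimalityData P len σ c x)
    {w : Fin n → EuclideanSpace ℝ (Fin n)}
    (hw : IsOrthonormalEigenseq (varianceMatrix P) (fun j => extendZero σ j) w) :
    IsOrthonormalEigenseq (varianceMatrix P) σ fun i => w (i.castLE S.le_dim) := by
  refine ⟨hw.1.comp _ (Fin.castLE_injective S.le_dim), fun i => ?_⟩
  rw [hw.2]
  simp only [Fin.val_castLE, extendZero_apply]

variable [IsProbabilityMeasure P]

theorem isFeasible_affineScheme (S : OptimalityData P len σ c x)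
    {d : Fin K → EuclideanSpace ℝ (Fin n)} (hd : ∀ t, inner ℝ (d t) (d t) = len t)
    {u : Fin m → EuclideanSpace ℝ (Fin n)} (hu : IsOrthonormalEigenseq (varianceMatrix P) σ u)
    {lam : Fin m → ℝ} (hlam : ∀ i, 0 < lam i)
    (hg : gram d = ∑ i, lam i • Matrix.vecMulVec (u i).ofLp (u i).ofLp) :
    IsFeasible P len (∫ v, v ∂P) d (affineScheme (pseudoInverse d lam u) (∫ v, v ∂P)) := by
  set μ := ∫ v, v ∂P with hμ
  have hae : ∀ᵐ v ∂P, v - μ = ∑ t, affineScheme (pseudoInverse d lam u) μ v t • d t := by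
    filter_upwards [ae_eq_sum_eigen S.memLp S.eigenvalues hu] with v hv
    rw [sum_affineScheme_smul hu.1 hlam hg]
    exact hv
  refine ⟨⟨hd, fun v hv => ?_⟩, ?_, hae⟩
  -- The span is closed and contains `V - μ` almost surely, so its translate contains the support.
  · have hcl : IsClosed ((fun v => v - μ) ⁻¹'
        (Submodule.span ℝ (Set.range d) : Set (EuclideanSpace ℝ (Fin n)))) :=
      (Submodule.closed_of_finiteDimensional _).preimage (continuous_id.sub continuous_const)
    have h1 := Measure.support_subset_of_isClosed (μ := P) hcl (by
      filter_upwards [hae] with v hv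
      change v - μ ∈ Submodule.span ℝ (Set.range d)
      rw [hv]
      exact Submodule.sum_mem _ fun t _ =>
        Submodule.smul_mem _ _ (Submodule.subset_span ⟨t, rfl⟩)) hv
    simpa using h1
  · refine Continuous.aemeasurable ?_
    unfold affineScheme
    fun_prop

/-- Each direction costs `σ_i / λ_i = c_i² / (c_i / x_i) = c_i x_i`. -/
theorem cost_affineScheme (S : OptimalityData P len σ c x)
    {d : Fin K → EuclideanSpace ℝ (Fin n)} {u : Fin m → EuclideanSpace ℝ (Fin n)}
    (hu : IsOrthonormalEigenseq (varianceMatrix P) σ u)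
    (hg : gram d = ∑ i, (c i / x i) • Matrix.vecMulVec (u i).ofLp (u i).ofLp) :
    cost P (affineScheme (pseudoInverse d (fun i => c i / x i) u) (∫ v, v ∂P)) =
      ENNReal.ofReal (∑ i, c i * x i) := by
  have hL : ∀ t, MemLp (fun v =>
      affineScheme (pseudoInverse d (fun i => c i / x i) u) (∫ v, v ∂P) v t) 2 P := fun t => by
    simp only [affineScheme_pseudoInverse]
    exact memLp_finsetSum _ fun i _ => (memLp_inner_sub S.memLp _ _).const_mul _
  have hi : ∀ i ∈ univ, Integrable (fun v =>
      (inner ℝ (u i) (v - ∫ v, v ∂P) : ℝ) ^ 2 / (c i / x i)) P := fun i _ =>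
    (memLp_inner_sub S.memLp _ _).integrable_sq.div_const _
  rw [cost_eq_of_memLp hL, ← integral_finsetSum _ fun t _ => (hL t).integrable_sq]
  simp only [sum_affineScheme_sq hu.1 S.lam_pos hg]
  rw [integral_finsetSum _ hi]
  congr 1
  refine sum_congr rfl fun i _ => ?_
  have h1 := integral_eigen_mul S.memLp hu (u i) i
  rw [Orthonormal.inner_eq_ite hu.1, if_pos rfl, mul_one, ← S.sqrt_sq] at h1
  simp only [sq] at h1 ⊢
  rw [integral_div, h1]
  have h2 := (S.x_pos i).ne'
  have h3 := (S.sqrt_pos i).ne'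
  field_simp

theorem le_cost (S : OptimalityData P len σ c x) {c₀ : EuclideanSpace ℝ (Fin n)}
    {d : Fin K → EuclideanSpace ℝ (Fin n)} {f : EuclideanSpace ℝ (Fin n) → EuclideanSpace ℝ (Fin K)}
    (hf : IsFeasible P len c₀ d f) : ENNReal.ofReal (∑ i, c i * x i) ≤ cost P f := by
  by_cases hcost : cost P f = ⊤
  · rw [hcost]; exact le_top
  obtain ⟨u, hu⟩ := S.exists_eigenseq
  have hL := memLp_of_cost_ne_top hf.2.1 hcost
  rw [cost_eq_of_memLp hL, sum_integral_sq_eq S.memLp hu S.sqrt_pos S.sqrt_sq hL]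
  refine ENNReal.ofReal_le_ofReal ?_
  have h1 := lower_bound S.kkt S.pos S.le_dim S.le_length hf.1.1 hu.1 S.sqrt_pos S.sqrt_anti
    (sum_schemeCoeff_smul S.memLp hu S.sqrt_pos S.sqrt_sq hL hf.2.2)
  have h2 : 0 ≤ ∑ t, ∫ v, (f v t - ∑ i, schemeCoeff P c u f i t * whitened P c u i v) ^ 2 ∂P :=
    sum_nonneg fun t _ => integral_nonneg fun v => sq_nonneg _
  linarith

/-- If the lower bound for the cost is attained, then the coefficients of the scheme attain the
lower bound, and the scheme is linear. -/
theorem coeff_of_cost_eq (S : OptimalityData P len σ c x) {c₀ : EuclideanSpace ℝ (Fin n)}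
    {d : Fin K → EuclideanSpace ℝ (Fin n)} {f : EuclideanSpace ℝ (Fin n) → EuclideanSpace ℝ (Fin K)}
    (hf : IsFeasible P len c₀ d f) (hcost : cost P f = ENNReal.ofReal (∑ i, c i * x i))
    {u : Fin m → EuclideanSpace ℝ (Fin n)} (hu : IsOrthonormalEigenseq (varianceMatrix P) σ u) :
    (∀ i, ∑ t, schemeCoeff P c u f i t • d t = c i • u i) ∧
      ∑ i, ∑ t, schemeCoeff P c u f i t ^ 2 = ∑ i, c i * x i ∧
      ∀ᵐ v ∂P, ∀ t, f v t = ∑ i, schemeCoeff P c u f i t * whitened P c u i v := by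
  have hL := memLp_of_cost_ne_top hf.2.1 (hcost ▸ ENNReal.ofReal_ne_top)
  have h0 := sum_schemeCoeff_smul S.memLp hu S.sqrt_pos S.sqrt_sq hL hf.2.2
  have h1 := lower_bound S.kkt S.pos S.le_dim S.le_length hf.1.1 hu.1 S.sqrt_pos S.sqrt_anti h0
  have h2 : 0 ≤ ∑ t, ∫ v, (f v t - ∑ i, schemeCoeff P c u f i t * whitened P c u i v) ^ 2 ∂P :=
    sum_nonneg fun t _ => integral_nonneg fun v => sq_nonneg _
  rw [cost_eq_of_memLp hL, sum_integral_sq_eq S.memLp hu S.sqrt_pos S.sqrt_sq hL,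
    ENNReal.ofReal_eq_ofReal_iff (by linarith [S.value_nonneg]) S.value_nonneg] at hcost
  exact ⟨h0, by linarith, ae_eq_of_sum_integral_sq_eq S.memLp hL (by linarith)⟩

/-- At equality the scheme is linear in the whitened coordinates, so `D f(V)` equals both `V - c₀`
and `V - μ`. A single point at which all the almost sure identities hold is enough. -/
theorem constant_eq_of_cost_eq (S : OptimalityData P len σ c x) {c₀ : EuclideanSpace ℝ (Fin n)}
    {d : Fin K → EuclideanSpace ℝ (Fin n)} {f : EuclideanSpace ℝ (Fin n) → EuclideanSpace ℝ (Fin K)}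
    (hf : IsFeasible P len c₀ d f) (hcost : cost P f = ENNReal.ofReal (∑ i, c i * x i)) :
    c₀ = ∫ v, v ∂P := by
  obtain ⟨u, hu⟩ := S.exists_eigenseq
  obtain ⟨h0, -, h1⟩ := S.coeff_of_cost_eq hf hcost hu
  obtain ⟨v, h1, h2, h3⟩ := (h1.and (hf.2.2.and
    (ae_eq_sum_eigen S.memLp S.eigenvalues hu))).exists
  have h4 : v - c₀ = v - ∫ v, v ∂P := by
    rw [h2, h3]
    simp only [h1, sum_smul]
    rw [sum_comm]
    refine sum_congr rfl fun i _ => ?_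
    have h5 : ∀ t, (schemeCoeff P c u f i t * whitened P c u i v) • d t =
        whitened P c u i v • schemeCoeff P c u f i t • d t := fun t => by
      rw [smul_smul, mul_comm]
    simp only [h5]
    rw [← smul_sum, h0, smul_smul, whitened, mul_right_comm, inv_mul_cancel₀ (S.sqrt_pos i).ne',
      one_mul]
  exact sub_right_injective h4

theorem eigenbasis_of_cost_eq (S : OptimalityData P len σ c x) {c₀ : EuclideanSpace ℝ (Fin n)}
    {d : Fin K → EuclideanSpace ℝ (Fin n)} {f : EuclideanSpace ℝ (Fin n) → EuclideanSpace ℝ (Fin K)}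
    (hf : IsFeasible P len c₀ d f) (hcost : cost P f = ENNReal.ofReal (∑ i, c i * x i)) :
    ∃ w : Fin n → EuclideanSpace ℝ (Fin n),
      IsOrthonormalEigenseq (varianceMatrix P) (fun j => extendZero σ j) w ∧
      gram d = ∑ i : Fin m, (c i / x i) • Matrix.vecMulVec (w (i.castLE S.le_dim)).ofLp
        (w (i.castLE S.le_dim)).ofLp := by
  obtain ⟨u, hu⟩ := S.exists_eigenseq
  obtain ⟨h0, h1, -⟩ := S.coeff_of_cost_eq hf hcost hu
  refine eigenbasis_of_lower_bound_eq S.kkt S.pos S.le_length hf.1.1 hu.1 S.sqrt_pos S.sqrt_anti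
    h0 h1 (fun v => ?_) S.eq_sqrt S.eigenvalues S.le_dim
  simp only [S.sqrt_sq]
  exact varianceMatrix_mulVec S.memLp S.eigenvalues hu v

/-- Because `D F_i = c_i u_i` and `D Dᵀ u_i = (c_i / x_i) u_i`, the squared distance of `F_i` from
`x_i Dᵀ u_i` is `|F_i|² - c_i x_i`. These nonnegative numbers sum to zero, which determines every
coefficient. -/
theorem scheme_eq_of_cost_eq (S : OptimalityData P len σ c x) {c₀ : EuclideanSpace ℝ (Fin n)}
    {d : Fin K → EuclideanSpace ℝ (Fin n)} {f : EuclideanSpace ℝ (Fin n) → EuclideanSpace ℝ (Fin K)}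
    (hf : IsFeasible P len c₀ d f) (hcost : cost P f = ENNReal.ofReal (∑ i, c i * x i))
    {u : Fin m → EuclideanSpace ℝ (Fin n)} (hu : IsOrthonormalEigenseq (varianceMatrix P) σ u)
    (hg : gram d = ∑ i, (c i / x i) • Matrix.vecMulVec (u i).ofLp (u i).ofLp) :
    f =ᵐ[P] affineScheme (pseudoInverse d (fun i => c i / x i) u) (∫ v, v ∂P) := by
  obtain ⟨h0, h1, h2⟩ := S.coeff_of_cost_eq hf hcost hu
  set F := schemeCoeff P c u f with hF
  have e1 : ∀ i, ∑ t, F i t * (inner ℝ (d t) (u i) : ℝ) = c i := fun i => by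
    have := congrArg (fun v => (inner ℝ v (u i) : ℝ)) (h0 i)
    simpa only [sum_inner, real_inner_smul_left, Orthonormal.inner_eq_ite hu.1, if_true,
      mul_one] using this
  have e2 : ∀ i, ∑ t, (inner ℝ (d t) (u i) : ℝ) * inner ℝ (d t) (u i) = c i / x i := fun i => by
    rw [sum_inner_mul_inner_of_gram hu.1 hg, if_pos rfl]
  have e3 : ∀ i, ∑ t, (F i t - x i * inner ℝ (d t) (u i)) ^ 2 = ∑ t, F i t ^ 2 - c i * x i :=
    fun i => by
      have : ∀ t, (F i t - x i * inner ℝ (d t) (u i)) ^ 2 = F i t ^ 2 -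
          2 * x i * (F i t * inner ℝ (d t) (u i)) +
          x i ^ 2 * ((inner ℝ (d t) (u i) : ℝ) * inner ℝ (d t) (u i)) := fun t => by ring
      simp only [this]
      rw [sum_add_distrib, sum_sub_distrib, ← mul_sum, ← mul_sum, e1, e2]
      have := (S.x_pos i).ne'
      field_simp
      ring
  have e4 : ∑ i, ∑ t, (F i t - x i * inner ℝ (d t) (u i)) ^ 2 = 0 := by
    simp only [e3]
    rw [sum_sub_distrib, h1, sub_self]
  have e5 : ∀ i t, F i t = x i * inner ℝ (d t) (u i) := fun i t => by
    have h3 := (sum_eq_zero_iff_of_nonneg fun i _ => sum_nonneg fun t _ => sq_nonneg _).1 e4 i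
      (mem_univ i)
    have h4 := (sum_eq_zero_iff_of_nonneg fun t _ => sq_nonneg _).1 h3 t (mem_univ t)
    exact sub_eq_zero.1 (pow_eq_zero_iff two_ne_zero |>.1 h4)
  filter_upwards [h2] with v hv
  ext t
  rw [hv t, affineScheme_pseudoInverse]
  refine sum_congr rfl fun i _ => ?_
  rw [e5, whitened]
  have h3 := (S.x_pos i).ne'
  have h4 := (S.sqrt_pos i).ne'
  field_simp

/-- There is a dictionary which attains the lower bound for the cost. -/
def HasMinimizer (P : Measure (EuclideanSpace ℝ (Fin n))) (len : Fin K → ℝ) (p : ℝ) : Prop :=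
  ∃ c₀, ∃ d : Fin K → EuclideanSpace ℝ (Fin n), ∃ f,
    IsFeasible P len c₀ d f ∧ cost P f = ENNReal.ofReal p

theorem isOptimal_of_cost_eq (S : OptimalityData P len σ c x) {c₀ : EuclideanSpace ℝ (Fin n)}
    {d : Fin K → EuclideanSpace ℝ (Fin n)} {f : EuclideanSpace ℝ (Fin n) → EuclideanSpace ℝ (Fin K)}
    (hf : IsFeasible P len c₀ d f) (hcost : cost P f = ENNReal.ofReal (∑ i, c i * x i)) :
    IsOptimal P len c₀ d f :=
  ⟨hf, fun _ _ _ hf' => hcost ▸ S.le_cost hf'⟩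

theorem isOptimal_affineScheme (S : OptimalityData P len σ c x)
    {d : Fin K → EuclideanSpace ℝ (Fin n)} (hd : ∀ t, inner ℝ (d t) (d t) = len t)
    {u : Fin m → EuclideanSpace ℝ (Fin n)} (hu : IsOrthonormalEigenseq (varianceMatrix P) σ u)
    (hg : gram d = ∑ i, (c i / x i) • Matrix.vecMulVec (u i).ofLp (u i).ofLp) :
    IsOptimal P len (∫ v, v ∂P) d
      (affineScheme (pseudoInverse d (fun i => c i / x i) u) (∫ v, v ∂P)) :=
  S.isOptimal_of_cost_eq (S.isFeasible_affineScheme hd hu S.lam_pos hg) (S.cost_affineScheme hu hg)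

/-- Attainment is kept as a hypothesis in these lemmas, since it is supplied only later by the
output of the algorithm. -/
theorem cost_eq_of_isOptimal (S : OptimalityData P len σ c x)
    (hex : HasMinimizer P len (∑ i, c i * x i)) {c₀ : EuclideanSpace ℝ (Fin n)}
    {d : Fin K → EuclideanSpace ℝ (Fin n)} {f : EuclideanSpace ℝ (Fin n) → EuclideanSpace ℝ (Fin K)}
    (hf : IsOptimal P len c₀ d f) : cost P f = ENNReal.ofReal (∑ i, c i * x i) := by
  obtain ⟨c₁, d₁, f₁, h1, h2⟩ := hex
  exact le_antisymm (h2 ▸ hf.2 _ _ _ h1) (S.le_cost hf.1)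

theorem isOptimalDictionary_iff (S : OptimalityData P len σ c x)
    (hex : HasMinimizer P len (∑ i, c i * x i)) {d : Fin K → EuclideanSpace ℝ (Fin n)}
    (hd : ∀ t, inner ℝ (d t) (d t) = len t) :
    IsOptimalDictionary P len d ↔ ∃ u, IsOrthonormalEigenseq (varianceMatrix P) σ u ∧
      gram d = ∑ i, (c i / x i) • Matrix.vecMulVec (u i).ofLp (u i).ofLp := by
  constructor
  · rintro ⟨c₀, f, hf⟩
    obtain ⟨w, hw, hg⟩ := S.eigenbasis_of_cost_eq hf.1 (S.cost_eq_of_isOptimal hex hf)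
    exact ⟨_, S.isOrthonormalEigenseq_castLE hw, hg⟩
  · rintro ⟨u, hu, hg⟩
    exact ⟨_, _, S.isOptimal_affineScheme hd hu hg⟩

theorem optimal_scheme_iff (S : OptimalityData P len σ c x)
    (hex : HasMinimizer P len (∑ i, c i * x i)) {d : Fin K → EuclideanSpace ℝ (Fin n)}
    (hd : ∀ t, inner ℝ (d t) (d t) = len t)
    {u : Fin m → EuclideanSpace ℝ (Fin n)} (hu : IsOrthonormalEigenseq (varianceMatrix P) σ u)
    (hg : gram d = ∑ i, (c i / x i) • Matrix.vecMulVec (u i).ofLp (u i).ofLp)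
    (c₀ : EuclideanSpace ℝ (Fin n)) (f : EuclideanSpace ℝ (Fin n) → EuclideanSpace ℝ (Fin K)) :
    IsOptimal P len c₀ d f ↔ c₀ = ∫ v, v ∂P ∧
      f =ᵐ[P] affineScheme (pseudoInverse d (fun i => c i / x i) u) (∫ v, v ∂P) := by
  constructor
  · intro hf
    have hcost := S.cost_eq_of_isOptimal hex hf
    exact ⟨S.constant_eq_of_cost_eq hf.1 hcost, S.scheme_eq_of_cost_eq hf.1 hcost hu hg⟩
  · rintro ⟨rfl, hf⟩
    have h1 := S.isFeasible_affineScheme hd hu S.lam_pos hg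
    refine S.isOptimal_of_cost_eq ⟨h1.1, h1.2.1.congr hf.symm, ?_⟩ ?_
    · filter_upwards [h1.2.2, hf] with v hv hfv
      rw [hv, hfv]
    · rw [← S.cost_affineScheme hu hg]
      refine lintegral_congr_ae ?_
      filter_upwards [hf] with v hfv
      rw [hfv]

end OptimalityData

end L2Dictionary

namespace L2Dictionary

open Finset

/-! ## Correctness and running time of the algorithm -/

namespace Algo

variable {n K m : ℕ} (E : EigSolver)

theorem ofFn_eq_map_range' (f : Fin m → ℝ) :
    List.ofFn f = (List.range' 0 m).map (extendZero f) := by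
  apply List.ext_getElem
  · simp
  · intro i h1 h2
    simp only [List.getElem_ofFn, List.getElem_map, List.getElem_range', zero_add, one_mul]
    rw [extendZero_of_lt]

theorem solveQP_ofFn {c a : Fin m → ℝ} (hc : ∀ i, 0 < c i) (ha : ∀ i, 0 < a i) :
    (solveQP (List.ofFn c) (List.ofFn a)).steps E ≤ m * (6 * m + 1) + 3 * m ∧
      ∃ x : Fin m → ℝ, (solveQP (List.ofFn c) (List.ofFn a)).value E = List.ofFn x ∧
        KKT (extendZero c) (extendZero a) (extendZero x) 0 m := by
  obtain ⟨h1, x, h2, h3⟩ := solveQP_spec E (c := extendZero c) (a := extendZero a) (m := m)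
    (fun t ht => by rw [extendZero_of_lt _ ht]; exact hc _)
    (fun t ht => by rw [extendZero_of_lt _ ht]; exact ha _)
  rw [ofFn_eq_map_range', ofFn_eq_map_range']
  refine ⟨h1, fun i => x i, ?_, h3.congr (fun _ _ _ => rfl) (fun _ _ _ => rfl)
    fun t _ ht => extendZero_fin x ht⟩
  rw [h2, ofFn_eq_map_range']
  exact List.map_congr_left fun t ht => (extendZero_fin x (by simpa using ht)).symm

theorem lambdaStar_ofFn {c a x : Fin m → ℝ} (ha : ∀ i, 0 < a i)
    (h : KKT (extendZero c) (extendZero a) (extendZero x) 0 m) :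
    (lambdaStar (List.ofFn x) (List.ofFn c) (List.ofFn a)).steps E ≤ 16 * m ∧
      (lambdaStar (List.ofFn x) (List.ofFn c) (List.ofFn a)).value E =
        List.ofFn fun i => c i / x i := by
  obtain ⟨h1, h2⟩ := lambdaStar_spec E
    (fun t ht => by rw [extendZero_of_lt _ ht]; exact ha _) h
  simp only [← ofFn_eq_map_range'] at h1 h2
  refine ⟨h1, ?_⟩
  rw [h2, ofFn_eq_map_range']
  refine List.map_congr_left fun t ht => ?_
  have ht : t < m := by simpa using ht
  rw [extendZero_of_lt c ht, extendZero_of_lt x ht, extendZero_of_lt _ ht]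

theorem value_pad_ofFn (f : Fin m → ℝ) (hmK : m ≤ K) :
    (pad K (List.ofFn f)).value E = List.ofFn fun k : Fin K => extendZero f k := by
  rw [value_pad E K _ (by simpa using hmK)]
  apply List.ext_getElem
  · simp; omega
  · intro i h1 h2
    simp only [List.getElem_ofFn]
    by_cases hi : i < m
    · rw [List.getElem_append_left (by simpa using hi), extendZero_of_lt _ hi]
      simp
    · rw [List.getElem_append_right (by simpa using hi), extendZero_of_le _ (not_lt.1 hi)]
      simp

/-- The padded sequence `λ*` majorizes the sequence of lengths. -/
theorem majorized_of_kkt {len : Fin K → ℝ} (hlen : ∀ i, 0 < len i) (hanti : Antitone len)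
    (hm : 0 < m) (hmK : m ≤ K) {c x : Fin m → ℝ}
    (h : KKT (extendZero c) (extendZero (foldedLengths len m)) (extendZero x) 0 m) :
    Majorized (List.ofFn len)
      (List.ofFn fun k : Fin K => extendZero (fun i => c i / x i) k) := by
  set lam : Fin m → ℝ := fun i => c i / x i with hlam
  have e0 : ∀ k ≤ m, ∑ t ∈ range k, extendZero lam t =
      ∑ t ∈ range k, extendZero c t / extendZero x t := fun k hk =>
    sum_congr rfl fun t ht => by
      have ht : t < m := (mem_range.1 ht).trans_le hk
      rw [extendZero_of_lt c ht, extendZero_of_lt x ht, extendZero_of_lt _ ht]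
  have e1 : ∀ k ≤ K, ∑ t ∈ range k, extendZero (fun k : Fin K => extendZero lam k) t =
      ∑ t ∈ range k, extendZero lam t := fun k hk =>
    sum_congr rfl fun t ht => extendZero_fin _ ((mem_range.1 ht).trans_le hk)
  -- Once all `m` nonzero terms are included, the sum of `λ*` is the sum of all lengths, because
  -- folding preserves the total.
  have e2 : ∀ k, m ≤ k → ∑ t ∈ range k, extendZero lam t =
      ∑ t ∈ range K, extendZero len t := fun k hk => by
    rw [← sum_foldedLengths len hm hmK, h.sum_eq_sum_div, ← e0 m le_rfl]
    refine (sum_subset_zero_on_sdiff (range_subset_range.2 hk) (fun t ht => ?_)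
      fun t _ => rfl).symm
    simp only [mem_sdiff, mem_range, not_lt] at ht
    exact extendZero_of_le _ ht.2
  refine majorized_ofFn hanti (fun k hk => ?_) (by rw [e1 K le_rfl, e2 K hmK])
  rw [e1 k hk]
  rcases lt_or_ge k m with hkm | hkm
  · rw [e0 k hkm.le, ← sum_foldedLengths_of_lt len hkm]
    exact h.sum_le_sum_div hkm.le
  · rw [e2 k hkm]
    refine sum_le_sum_of_subset_of_nonneg (range_subset_range.2 hk) fun t ht _ => ?_
    rw [extendZero_of_lt _ (mem_range.1 ht)]
    exact (hlen _).le

theorem sum_zipWith_smul (hmK : m ≤ K) (a : Fin K → ℝ) (w : Fin m → Fin n → ℝ) :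
    (List.zipWith (fun t w => t • w) (List.ofFn a) (List.ofFn w)).sum =
      ∑ i, a (i.castLE hmK) • w i := by
  have h1 : List.zipWith (fun (t : ℝ) (w : Fin n → ℝ) => t • w) (List.ofFn a) (List.ofFn w) =
      List.ofFn fun i : Fin m => a (i.castLE hmK) • w i := by
    apply List.ext_getElem
    · simpa using hmK
    · simp
  rw [h1, List.sum_ofFn]

theorem value_linComb_ofFn (hmK : m ≤ K) (a : Fin K → ℝ)
    (w : Fin m → EuclideanSpace ℝ (Fin n)) :
    (linComb n (List.ofFn a) (List.ofFn fun i => List.ofFn (w i).ofLp)).value E =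
      List.ofFn (∑ i, a (i.castLE hmK) • w i).ofLp := by
  have h1 : (List.ofFn fun i => List.ofFn (w i).ofLp) =
      (List.ofFn fun i => (w i).ofLp).map List.ofFn := by
    rw [List.map_ofFn]; rfl
  rw [h1, value_linComb, sum_zipWith_smul hmK]
  simp

theorem value_pinvRow (lam : Fin m → ℝ) (u : Fin m → EuclideanSpace ℝ (Fin n))
    (v : EuclideanSpace ℝ (Fin n)) :
    (pinvRow n (List.ofFn lam) (List.ofFn fun i => List.ofFn (u i).ofLp) (List.ofFn v.ofLp)).value E =
      List.ofFn (∑ i, ((inner ℝ v (u i) : ℝ) / lam i) • u i).ofLp := by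
  simp only [pinvRow, Prog.value_bind, value_mapP, value_dot, value_zipP, value_div, List.map_ofFn]
  have h1 : List.zipWith (fun x y : ℝ => x / y)
      (List.ofFn ((fun u => (List.zipWith (fun x1 x2 : ℝ => x1 * x2) (List.ofFn v.ofLp) u).sum) ∘
        fun i => List.ofFn (u i).ofLp)) (List.ofFn lam) =
      List.ofFn fun i => (inner ℝ v (u i) : ℝ) / lam i := by
    rw [zipWith_ofFn]
    congr 1
    funext i
    simp only [Function.comp_apply, zipWith_ofFn, List.sum_ofFn]
    rw [inner_eq_dotProduct]
    rfl
  rw [h1, value_linComb_ofFn E le_rfl]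
  rfl

theorem steps_pinvRow_le (lam : Fin m → ℝ) (u : Fin m → EuclideanSpace ℝ (Fin n))
    (v : EuclideanSpace ℝ (Fin n)) :
    (pinvRow n (List.ofFn lam) (List.ofFn fun i => List.ofFn (u i).ofLp)
      (List.ofFn v.ofLp)).steps E ≤ m * (8 * n + 5) + 2 * n := by
  have h1 := steps_mapP_le E (g := fun u => dot (List.ofFn v.ofLp) u)
    (xs := List.ofFn fun i => List.ofFn (u i).ofLp) (s := 4 * n + 1)
    (fun u _ => (steps_dot_le E _ _).trans (by simp))
  simp only [pinvRow, Prog.steps_bind]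
  set ss := (mapP (fun u => dot (List.ofFn v.ofLp) u)
    (List.ofFn fun i => List.ofFn (u i).ofLp)).value E with hss
  have hl : ss.length = m := by simp [hss]
  have h2 := steps_zipP_le E (g := div) (xs := ss) (ys := List.ofFn lam) (s := 1) (by simp)
  set ts := (zipP div ss (List.ofFn lam)).value E with hts
  have hl2 : ts.length = m := by simp [hts, hl]
  have h3 := steps_linComb_le E n n ts (List.ofFn fun i => List.ofFn (u i).ofLp) (by
    intro w hw
    obtain ⟨i, rfl⟩ := (List.mem_ofFn' _ _).1 hw
    simp)
  rw [hl] at h2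
  rw [hl2] at h3
  rw [List.length_ofFn] at h1
  nlinarith

/-- A rank-one decomposition of `∑ λᵢ uᵢ uᵢᵀ` with prescribed lengths. -/
theorem rankOneDecomposition_spec {len : Fin K → ℝ} (hlen : Antitone len) (hmK : m ≤ K)
    {lam : Fin m → ℝ} (hlam : ∀ i, 0 < lam i)
    (hmaj : Majorized (List.ofFn len) (List.ofFn fun k : Fin K => extendZero lam k))
    {u : Fin m → EuclideanSpace ℝ (Fin n)} (hu : Orthonormal ℝ u) :
    (rankOneDecomposition n K (List.ofFn lam) (List.ofFn fun i => List.ofFn (u i).ofLp)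
      (List.ofFn len)).steps E ≤
        m * (2 * n + 3) + 2 * K + K * (2 * K ^ 2 + 32 * K + 31) +
          K * (K * (4 * n + 1) + 2 * n + 1) ∧
    ∃ d : Fin K → EuclideanSpace ℝ (Fin n),
      (rankOneDecomposition n K (List.ofFn lam) (List.ofFn fun i => List.ofFn (u i).ofLp)
        (List.ofFn len)).value E = (List.ofFn fun t => List.ofFn (d t).ofLp) ∧
      (∀ t, inner ℝ (d t) (d t) = len t) ∧
      gram d = ∑ i, lam i • Matrix.vecMulVec (u i).ofLp (u i).ofLp := by
  obtain ⟨h1, y, h2, h3, h4⟩ := orthonormalBasis_spec E hlen hmaj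
  have hrs : (mapP sqrt (List.ofFn lam)).value E = List.ofFn fun i => √(lam i) := by
    rw [value_mapP, List.map_ofFn]
    simp [Function.comp_def]
  have hC : (zipP scale (List.ofFn fun i => √(lam i)) (List.ofFn fun i =>
      List.ofFn (u i).ofLp)).value E = List.ofFn fun i => List.ofFn (√(lam i) • u i).ofLp := by
    rw [value_zipP, zipWith_ofFn]
    congr 1
    funext i
    rw [value_scale, List.map_ofFn]
    rfl
  have hpad := value_pad_ofFn E lam hmK
  constructor
  · have s1 := steps_mapP_le E (g := sqrt) (xs := List.ofFn lam) (s := 1) (by simp)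
    have s2 := steps_zipP_le E (g := scale) (xs := List.ofFn fun i => √(lam i))
      (ys := List.ofFn fun i => List.ofFn (u i).ofLp) (s := 2 * n) (by
        intro r _ w hw
        obtain ⟨i, rfl⟩ := (List.mem_ofFn' _ _).1 hw
        exact (steps_scale_le E _ _).trans (by simp))
    have s3 := steps_pad_le E K (List.ofFn lam)
    have s4 := steps_mapP_le E (g := fun x => linComb n x
        (List.ofFn fun i => List.ofFn (√(lam i) • u i).ofLp))
      (xs := List.ofFn fun t => List.ofFn (y t)) (s := K * (4 * n + 1) + 2 * n) (by
        intro x hx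
        obtain ⟨t, rfl⟩ := (List.mem_ofFn' _ _).1 hx
        refine (steps_linComb_le E n n _ _ ?_).trans (by simp)
        intro w hw
        obtain ⟨i, rfl⟩ := (List.mem_ofFn' _ _).1 hw
        simp)
    simp only [rankOneDecomposition, Prog.steps_bind, hrs, hC, hpad, h2]
    simp only [List.length_ofFn] at s1 s2 s4
    nlinarith
  -- The image of `y t` under `e_i ↦ √λ_i u_i`, where the basis vectors beyond `m` are sent to zero;
  -- its squared length is therefore `⟨y t, Λ y t⟩`.
  · refine ⟨fun t => ∑ i : Fin m, y t (i.castLE hmK) • √(lam i) • u i, ?_, fun t => ?_, ?_⟩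
    · simp only [rankOneDecomposition, Prog.value_bind, hrs, hC, hpad, h2, value_mapP,
        List.map_ofFn]
      congr 1
      funext t
      exact value_linComb_ofFn E hmK (y t) fun i => √(lam i) • u i
    · rw [← h3 t, sum_inner]
      simp only [inner_sum, real_inner_smul_left, real_inner_smul_right,
        Orthonormal.inner_eq_ite hu, mul_ite, mul_one, mul_zero, sum_ite_eq, mem_univ, if_true]
      rw [dotProduct]
      have e1 : ∀ k : Fin K, y t k * ((fun k : Fin K => extendZero lam k) * y t) k =
          (fun k : ℕ => extendZero lam k * extendZero (y t) k ^ 2) k := fun k => by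
        simp only [Pi.mul_apply, extendZero_apply]; ring
      simp only [e1]
      rw [Fin.sum_univ_eq_sum_range (fun k : ℕ => extendZero lam k * extendZero (y t) k ^ 2),
        ← sum_subset_zero_on_sdiff (range_subset_range.2 hmK) (fun k hk => ?_) fun k _ => rfl,
        ← Fin.sum_univ_eq_sum_range (fun k : ℕ => extendZero lam k * extendZero (y t) k ^ 2)]
      · refine sum_congr rfl fun i _ => ?_
        rw [extendZero_apply, extendZero_of_lt (y t) (show (i : ℕ) < K by omega)]
        have := Real.mul_self_sqrt (hlam i).le
        calc _ = (√(lam i) * √(lam i)) * y t (i.castLE hmK) ^ 2 := by ring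
          _ = _ := by rw [this]; rfl
      · simp only [mem_sdiff, mem_range, not_lt] at hk
        rw [extendZero_of_le _ hk.2, zero_mul]
    -- The rows of the square matrix `y` are orthonormal, hence so are its columns; this kills the
    -- mixed terms `u i (u j)ᵀ`.
    · have hY : (Matrix.of y).transpose * Matrix.of y = 1 := by
        refine mul_eq_one_comm.1 ?_
        ext s t
        rw [Matrix.mul_apply, Matrix.one_apply, ← h4 s t]
        rfl
      have hcol : ∀ i j : Fin m, ∑ t, y t (i.castLE hmK) * y t (j.castLE hmK) =
          if i = j then 1 else 0 := fun i j => by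
        have := congrFun (congrFun hY (i.castLE hmK)) (j.castLE hmK)
        rw [Matrix.mul_apply, Matrix.one_apply] at this
        simpa [Matrix.transpose_apply] using this
      ext a b
      simp only [gram, Matrix.sum_apply, Matrix.vecMulVec_apply, WithLp.ofLp_sum,
        WithLp.ofLp_smul, Finset.sum_apply, Pi.smul_apply, smul_eq_mul, sum_mul_sum,
        Matrix.smul_apply]
      rw [sum_comm]
      refine sum_congr rfl fun i _ => ?_
      rw [sum_comm]
      have e1 : ∀ j, ∑ t, y t (i.castLE hmK) * (√(lam i) * u i a) *
          (y t (j.castLE hmK) * (√(lam j) * u j b)) =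
          (√(lam i) * u i a) * (√(lam j) * u j b) * if i = j then 1 else 0 := fun j => by
        rw [← hcol i j, mul_sum]
        exact sum_congr rfl fun t _ => by ring
      simp only [e1, mul_ite, mul_one, mul_zero, sum_ite_eq, mem_univ, if_true]
      have := Real.mul_self_sqrt (hlam i).le
      calc _ = (√(lam i) * √(lam i)) * (u i a * u i b) := by ring
        _ = _ := by rw [this]

/-- The algorithm, for a subroutine which returns the decomposition `(τ, w)` of the matrix. -/
theorem optimalDictionary_spec {A : Matrix (Fin n) (Fin n) ℝ} {τ : Fin n → ℝ}
    {w : Fin n → EuclideanSpace ℝ (Fin n)} (hτ : Antitone τ) (hw : IsOrthonormalEigenseq A τ w)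
    (hE : E.out (toRows A) = List.ofFn fun i => (τ i, List.ofFn (w i).ofLp))
    {σ c x : Fin m → ℝ} (hσ : List.ofFn σ = positiveEigenvalues A) (hm : 0 < m) (hmn : m ≤ n)
    (hnK : n ≤ K) (hcσ : ∀ i, c i = √(σ i)) (hc : ∀ i, 0 < c i) {len : Fin K → ℝ}
    (hlen : ∀ i, 0 < len i) (hanti : Antitone len)
    (h : KKT (extendZero c) (extendZero (foldedLengths len m)) (extendZero x) 0 m) :
    (optimalDictionary n K (toRows A) (List.ofFn len)).steps E ≤ E.time n + 200 * (K + 1) ^ 3 ∧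
    ∃ d : Fin K → EuclideanSpace ℝ (Fin n),
      (optimalDictionary n K (toRows A) (List.ofFn len)).value E =
        (toRows (dictionaryMatrix d).transpose, toRows (pseudoInverse d (fun i => c i / x i)
          fun i => w (i.castLE hmn))) ∧
      (∀ t, inner ℝ (d t) (d t) = len t) ∧
      gram d = ∑ i : Fin m, (c i / x i) •
        Matrix.vecMulVec (w (i.castLE hmn)).ofLp (w (i.castLE hmn)).ofLp := by
  obtain ⟨-, hpos, hτσ⟩ := positiveEigenvalues_spec hw hτ hσ
  have hmK := hmn.trans hnK
  set a := foldedLengths len m with ha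
  have ha0 : ∀ i, 0 < a i := foldedLengths_pos hlen hmK
  set u : Fin m → EuclideanSpace ℝ (Fin n) := fun i => w (i.castLE hmn) with hu
  have hu1 : Orthonormal ℝ u := hw.1.comp _ (Fin.castLE_injective hmn)
  set lam : Fin m → ℝ := fun i => c i / x i with hlam
  have hlam0 : ∀ i, 0 < lam i := fun i =>
    div_pos (hc i) (by rw [← extendZero_apply x]; exact h.pos i (Nat.zero_le _) i.2)
  have hps : (takePositive (List.ofFn fun i => (τ i, List.ofFn (w i).ofLp))).value E =
      List.ofFn fun i : Fin m => (σ i, List.ofFn (u i).ofLp) := by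
    rw [value_takePositive, takeWhile_ofFn hmn _ _ (fun i => by simpa using hpos i)]
    congr 1
    funext i
    rw [hτσ ⟨i, _⟩ i.2, extendZero_apply]
    rfl
  have hcs : (mapP (fun p : ℝ × List ℝ => sqrt p.1)
      (List.ofFn fun i : Fin m => (σ i, List.ofFn (u i).ofLp))).value E = List.ofFn c := by
    rw [value_mapP, List.map_ofFn]
    congr 1
    funext i
    simp [hcσ]
  have hus : (mapP (fun p : ℝ × List ℝ => (pure p.2 : Prog ℝ (List ℝ)))
      (List.ofFn fun i : Fin m => (σ i, List.ofFn (u i).ofLp))).value E =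
      List.ofFn fun i => List.ofFn (u i).ofLp := by
    rw [value_mapP, List.map_ofFn]
    congr 1
  have has : (foldLengths (List.ofFn c) (List.ofFn len)).value E = List.ofFn a :=
    value_foldLengths_ofFn E len _ (by simp) hm hmK
  obtain ⟨hq1, x', hq2, hq3⟩ := solveQP_ofFn E hc ha0
  -- The computed point satisfies the optimality conditions too, so it is the given solution by
  -- uniqueness.
  obtain rfl : x' = x := h.eq_of_isQPSolution ha0 (hq3.isQPSolution ha0)
  obtain ⟨hl1, hl2⟩ := lambdaStar_ofFn E ha0 h
  change _ = List.ofFn lam at hl2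
  obtain ⟨hr1, d, hr2, hr3, hr4⟩ := rankOneDecomposition_spec E hanti hmK hlam0
    (majorized_of_kkt hlen hanti hm hmK h) hu1
  have hrow : ∀ t, List.ofFn (∑ i, ((inner ℝ (d t) (u i) : ℝ) / lam i) • u i).ofLp =
      List.ofFn fun j => pseudoInverse d lam u t j := fun t => by
    congr 1
    funext j
    simp [pseudoInverse]
  refine ⟨?_, d, ?_, hr3, hr4⟩
  · have s1 := steps_takePositive_le E (List.ofFn fun i => (τ i, List.ofFn (w i).ofLp))
    have s2 := steps_mapP_le E (g := fun p : ℝ × List ℝ => sqrt p.1)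
      (xs := List.ofFn fun i : Fin m => (σ i, List.ofFn (u i).ofLp)) (s := 1) (by simp)
    have s3 := steps_mapP_le E (g := fun p : ℝ × List ℝ => (pure p.2 : Prog ℝ (List ℝ)))
      (xs := List.ofFn fun i : Fin m => (σ i, List.ofFn (u i).ofLp)) (s := 0) (by simp)
    have s4 := steps_foldLengths_le E (List.ofFn c) (List.ofFn len)
    have s5 := steps_mapP_le E (g := fun d => pinvRow n (List.ofFn lam)
        (List.ofFn fun i => List.ofFn (u i).ofLp) d)
      (xs := List.ofFn fun t => List.ofFn (d t).ofLp) (s := m * (8 * n + 5) + 2 * n) (by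
        intro v hv
        obtain ⟨t, rfl⟩ := (List.mem_ofFn' _ _).1 hv
        exact steps_pinvRow_le E lam u (d t))
    simp only [List.length_ofFn] at s1 s2 s3 s4 s5
    have hlenA : (toRows A).length = n := by simp [toRows]
    simp only [optimalDictionary, Prog.steps_bind, steps_eig, value_eig, hE, hps, hcs, hus, has,
      hq2, hl2, hr2, Prog.steps_pure, hlenA]
    -- All bounds are made uniform in `K` by `m ≤ n ≤ K`; the constant `200` is generous.
    have b1 : m * (6 * m + 1) ≤ K * (6 * K + 1) := by gcongr
    have b2 : m * (2 * n + 3) ≤ K * (2 * K + 3) := by gcongr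
    have b3 : K * (K * (4 * n + 1) + 2 * n + 1) ≤ K * (K * (4 * K + 1) + 2 * K + 1) := by gcongr
    have b4 : K * (m * (8 * n + 5) + 2 * n + 1) ≤ K * (K * (8 * K + 5) + 2 * K + 1) := by gcongr
    have b5 : 3 * K + K * 2 + K + (K + 2 * K + 1) + (K * (6 * K + 1) + 3 * K) + 16 * K +
        (K * (2 * K + 3) + 2 * K + K * (2 * K ^ 2 + 32 * K + 31) +
          K * (K * (4 * K + 1) + 2 * K + 1)) + K * (K * (8 * K + 5) + 2 * K + 1) ≤
        200 * (K + 1) ^ 3 := by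
      ring_nf
      nlinarith [Nat.zero_le K, Nat.zero_le (K ^ 2), Nat.zero_le (K ^ 3)]
    omega
  · simp only [optimalDictionary, Prog.value_bind, value_eig, hE, hps, hcs, hus, has,
      hq2, hl2, hr2, Prog.value_pure, value_mapP, List.map_ofFn, Prod.mk.injEq]
    refine ⟨rfl, ?_⟩
    rw [toRows]
    congr 1
    funext t
    rw [← hrow t]
    exact value_pinvRow E lam u (d t)

end Algo

/-! ## Subroutines for spectral decompositions -/

theorem toRows_injective {n n' : ℕ} {A : Matrix (Fin n) (Fin n) ℝ} {B : Matrix (Fin n') (Fin n') ℝ}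
    (h : toRows A = toRows B) : ∃ e : n = n', B = e ▸ A := by
  have hn : n = n' := by simpa [toRows] using congrArg List.length h
  subst hn
  refine ⟨rfl, ?_⟩
  ext i j
  have h1 := congrFun (List.ofFn_injective h) i
  exact (congrFun (List.ofFn_injective h1) j).symm

/-- Every sorted orthonormal spectral decomposition is the output of a correct subroutine. -/
theorem exists_eigSolver {n : ℕ} {A : Matrix (Fin n) (Fin n) ℝ} {τ : Fin n → ℝ}
    {w : Fin n → EuclideanSpace ℝ (Fin n)} (hτ : Antitone τ) (hw : IsOrthonormalEigenseq A τ w) :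
    ∃ E : EigSolver, E.IsCorrect ∧
      E.out (toRows A) = List.ofFn fun i => (τ i, List.ofFn (w i).ofLp) := by
  classical
  -- A subroutine acts on bare row lists. Since a list determines its square matrix, a decomposition
  -- may be chosen for each list separately and then overridden at `A`.
  have hex : ∀ L : List (List ℝ), ∃ r : List (ℝ × List ℝ),
      ∀ (n' : ℕ) (B : Matrix (Fin n') (Fin n') ℝ), B.IsSymm → toRows B = L →
      ∃ (τ : Fin n' → ℝ) (u : Fin n' → EuclideanSpace ℝ (Fin n')), Antitone τ ∧
        IsOrthonormalEigenseq B τ u ∧ r = List.ofFn fun i => (τ i, List.ofFn fun j => u i j) := by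
    intro L
    by_cases h : ∃ (n' : ℕ) (B : Matrix (Fin n') (Fin n') ℝ), B.IsSymm ∧ toRows B = L
    · obtain ⟨n', B, hB, rfl⟩ := h
      obtain ⟨τ, u, h1, h2⟩ := exists_sorted_eigenbasis hB
      refine ⟨List.ofFn fun i => (τ i, List.ofFn fun j => u i j), fun n'' C hC hCB => ?_⟩
      obtain ⟨rfl, rfl⟩ := toRows_injective hCB
      exact ⟨τ, u, h1, h2, rfl⟩
    · push Not at h
      exact ⟨[], fun n' B hB hL => absurd hL (h n' B hB)⟩
  choose r hr using hex
  refine ⟨⟨fun L => if L = toRows A then List.ofFn fun i => (τ i, List.ofFn (w i).ofLp) else r L,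
    fun _ => 0⟩, fun n' B hB => ?_, if_pos rfl⟩
  by_cases h : toRows B = toRows A
  · obtain ⟨rfl, rfl⟩ := toRows_injective h
    exact ⟨τ, w, hτ, hw, if_pos rfl⟩
  · obtain ⟨τ', u', h1, h2, h3⟩ := hr (toRows B) n' B hB rfl
    exact ⟨τ', u', h1, h2, (if_neg h).trans h3⟩

end L2Dictionary

namespace L2Dictionary

/-- A distribution whose variance matrix has no positive eigenvalue is a point mass. -/
theorem positiveEigenvalues_ne_nil {n : ℕ} {P : Measure (EuclideanSpace ℝ (Fin n))}
    [IsProbabilityMeasure P] (hP : MemLp (fun v : EuclideanSpace ℝ (Fin n) => v) 2 P)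
    (hdirac : ∀ c, P ≠ Measure.dirac c) : positiveEigenvalues (varianceMatrix P) ≠ [] := by
  intro h
  -- With the empty eigensequence, `ae_eq_sum_eigen` says that `V - μ` is almost surely an empty
  -- sum.
  have hσ : List.ofFn (Fin.elim0 : Fin 0 → ℝ) = positiveEigenvalues (varianceMatrix P) := by
    rw [h, List.ofFn_zero]
  have hu : IsOrthonormalEigenseq (varianceMatrix P) (Fin.elim0 : Fin 0 → ℝ) Fin.elim0 :=
    ⟨⟨fun i => i.elim0, fun i => i.elim0⟩, fun i => i.elim0⟩
  refine hdirac (∫ v, v ∂P) ?_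
  have h1 : (fun v => v) =ᵐ[P] fun _ => ∫ v, v ∂P := by
    filter_upwards [ae_eq_sum_eigen hP hσ hu] with v hv
    simpa [sub_eq_zero] using hv
  have h2 : P.map (fun v => v) = P.map fun _ => ∫ v, v ∂P := Measure.map_congr h1
  rw [Measure.map_id', Measure.map_const, measure_univ, one_smul] at h2
  exact h2

/-! ### Attainment of the bound and assembly of the theorem -/

theorem exists_optimalityData {n K m : ℕ} (hnK : n ≤ K) {len : Fin K → ℝ}
    (hlen : ∀ i, 0 < len i) {P : Measure (EuclideanSpace ℝ (Fin n))} [IsProbabilityMeasure P]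
    (hP : MemLp (fun v : EuclideanSpace ℝ (Fin n) => v) 2 P)
    (hdirac : ∀ c, P ≠ Measure.dirac c) {σ : Fin m → ℝ}
    (hσ : List.ofFn σ = positiveEigenvalues (varianceMatrix P)) :
    ∃ x, OptimalityData P len σ (fun i => √(σ i)) x := by
  obtain ⟨τ, w, hτ, hw⟩ := exists_sorted_eigenbasis (varianceMatrix_isSymm (P := P))
  obtain ⟨hmn, hpos, hτσ⟩ := positiveEigenvalues_spec hw hτ hσ
  have hm : 0 < m := Nat.pos_of_ne_zero fun h => by
    subst h
    exact positiveEigenvalues_ne_nil hP hdirac (by rw [← hσ, List.ofFn_zero])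
  have e : ∀ i : Fin m, τ (i.castLE hmn) = σ i := fun i => by
    rw [hτσ _ i.2, Fin.val_castLE, extendZero_apply]
  have hσ0 : ∀ i, 0 < σ i := fun i => by
    rw [← e]; exact (hpos _).2 i.2
  have hc : ∀ i, 0 < √(σ i) := fun i => Real.sqrt_pos.2 (hσ0 i)
  -- The solution of the quadratic program is taken from the pooling procedure. That procedure never
  -- calls the spectral subroutine, so any `E` serves to evaluate it.
  obtain ⟨E, -, -⟩ := exists_eigSolver hτ hw
  obtain ⟨-, x, -, hx⟩ := Algo.solveQP_ofFn E hc (foldedLengths_pos hlen (hmn.trans hnK))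
  exact ⟨x, hnK, hP, hm, hmn, hσ, fun _ => rfl, hc, fun i j hij => Real.sqrt_le_sqrt (by
    rw [← e, ← e]; exact hτ hij), fun i => Real.sq_sqrt (hσ0 i).le, hx⟩

namespace OptimalityData

variable {n K m : ℕ} {P : Measure (EuclideanSpace ℝ (Fin n))}
  {len : Fin K → ℝ} {σ c x : Fin m → ℝ}

theorem antitone_lam (S : OptimalityData P len σ c x) : Antitone fun i => c i / x i := by
  intro i j hij
  refine div_le_div₀ (S.sqrt_pos i).le (S.sqrt_anti hij) (S.x_pos i) ?_
  rw [← extendZero_apply x, ← extendZero_apply x j]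
  exact S.kkt.mono_le (Nat.zero_le _) hij j.2

theorem antitone_extendZero (S : OptimalityData P len σ c x) :
    Antitone fun j : Fin n => extendZero σ j := by
  intro i j hij
  have hij : (i : ℕ) ≤ j := hij
  change extendZero σ j ≤ extendZero σ i
  have h0 : ∀ k, 0 ≤ σ k := fun k => by rw [← S.sqrt_sq]; exact sq_nonneg _
  by_cases hj : (j : ℕ) < m
  · rw [extendZero_of_lt _ hj, extendZero_of_lt _ (hij.trans_lt hj), ← S.sqrt_sq, ← S.sqrt_sq]
    exact pow_le_pow_left₀ (S.sqrt_pos _).le (S.sqrt_anti hij) 2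
  · rw [extendZero_of_le _ (not_lt.1 hj)]
    by_cases hi : (i : ℕ) < m
    · rw [extendZero_of_lt _ hi]; exact h0 _
    · rw [extendZero_of_le _ (not_lt.1 hi)]

variable [IsProbabilityMeasure P]

/-- Correctness and running time of the algorithm, for a subroutine which returns the given
decomposition of the variance matrix. -/
theorem algorithm_spec (S : OptimalityData P len σ c x) (hlen : ∀ i, 0 < len i)
    (hanti : Antitone len) (E : EigSolver) {τ : Fin n → ℝ}
    {w : Fin n → EuclideanSpace ℝ (Fin n)} (hτ : Antitone τ)
    (hw : IsOrthonormalEigenseq (varianceMatrix P) τ w)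
    (hE : E.out (toRows (varianceMatrix P)) = List.ofFn fun i => (τ i, List.ofFn (w i).ofLp)) :
    (Algo.optimalDictionary n K (toRows (varianceMatrix P)) (List.ofFn len)).steps E ≤
      E.time n + 200 * (K + 1) ^ 3 ∧
    ∃ (d : Fin K → EuclideanSpace ℝ (Fin n)) (G : Matrix (Fin K) (Fin n) ℝ),
      (Algo.optimalDictionary n K (toRows (varianceMatrix P)) (List.ofFn len)).value E =
        (toRows (dictionaryMatrix d).transpose, toRows G) ∧
      IsMoorePenroseInverse (dictionaryMatrix d) G ∧
      IsFeasible P len (∫ v, v ∂P) d (affineScheme G (∫ v, v ∂P)) ∧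
      cost P (affineScheme G (∫ v, v ∂P)) = ENNReal.ofReal (∑ i, c i * x i) ∧
      gram d = ∑ i : Fin m, (c i / x i) • Matrix.vecMulVec (w (i.castLE S.le_dim)).ofLp
        (w (i.castLE S.le_dim)).ofLp := by
  obtain ⟨h1, d, h2, h3, h4⟩ := Algo.optimalDictionary_spec E hτ hw hE S.eigenvalues S.pos S.le_dim
    S.le_length S.eq_sqrt S.sqrt_pos hlen hanti S.kkt
  obtain ⟨-, -, hτσ⟩ := positiveEigenvalues_spec hw hτ S.eigenvalues
  have hu : IsOrthonormalEigenseq (varianceMatrix P) σ fun i => w (i.castLE S.le_dim) := by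
    refine ⟨hw.1.comp _ (Fin.castLE_injective S.le_dim), fun i => ?_⟩
    rw [hw.2, hτσ _ i.2, Fin.val_castLE, extendZero_apply]
  exact ⟨h1, d, _, h2, isMoorePenroseInverse_pseudoInverse hu.1 S.lam_pos h4,
    S.isFeasible_affineScheme h3 hu S.lam_pos h4, S.cost_affineScheme hu h4, h4⟩

/-- Existence needs no compactness: the output of the algorithm, run with some correct subroutine,
attains the lower bound. -/
theorem hasMinimizer (S : OptimalityData P len σ c x) (hlen : ∀ i, 0 < len i)
    (hanti : Antitone len) : HasMinimizer P len (∑ i, c i * x i) := by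
  obtain ⟨τ, w, hτ, hw⟩ := exists_sorted_eigenbasis (varianceMatrix_isSymm (P := P))
  obtain ⟨E, -, hE⟩ := exists_eigSolver hτ hw
  obtain ⟨-, d, G, -, -, h1, h2, -⟩ := S.algorithm_spec hlen hanti E hτ hw hE
  exact ⟨_, d, _, h1, h2⟩

end OptimalityData

end L2Dictionary

theorem theorem2 :
    ∃ p : Polynomial ℕ,
    ∀ (n K : ℕ) (_ : n ≤ K)
      (len : Fin K → ℝ) (_ : ∀ i, 0 < len i) (_ : Antitone len)
      (P : Measure (EuclideanSpace ℝ (Fin n))) [IsProbabilityMeasure P]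
      (_ : MemLp (fun v : EuclideanSpace ℝ (Fin n) => v) 2 P)
      (_ : ∀ c, P ≠ Measure.dirac c)
      (m : ℕ) (σ : Fin m → ℝ) (_ : List.ofFn σ = positiveEigenvalues (varianceMatrix P)),
    -- the quadratic program has a unique solution
    (∃! x, IsQPSolution (fun i => Real.sqrt (σ i)) (foldedLengths len m) x) ∧
    ∀ x, IsQPSolution (fun i => Real.sqrt (σ i)) (foldedLengths len m) x →
    ∀ lam : Fin m → ℝ,
      lam = lambdaMap (fun i => Real.sqrt (σ i)) (foldedLengths len m)
        (numBlocks x) (breakpoint x) →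
      (∀ i, 0 < lam i) ∧ Antitone lam ∧
      -- an optimal solution exists, and the optimal constant is the mean
      (∃ c, ∃ (d : Fin K → EuclideanSpace ℝ (Fin n)), ∃ f, IsOptimal P len c d f) ∧
      (∀ c (d : Fin K → EuclideanSpace ℝ (Fin n)) f, IsOptimal P len c d f → c = ∫ v, v ∂P) ∧
      -- the optimal dictionaries
      (∀ d : Fin K → EuclideanSpace ℝ (Fin n), (∀ i, inner ℝ (d i) (d i) = len i) →
        (IsOptimalDictionary P len d ↔
          ∃ u, IsOrthonormalEigenseq (varianceMatrix P) σ u ∧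
            gram d = ∑ i, lam i • Matrix.vecMulVec (u i).ofLp (u i).ofLp)) ∧
      -- the optimal scheme for an optimal dictionary
      (∀ d : Fin K → EuclideanSpace ℝ (Fin n), IsOptimalDictionary P len d →
        ∃ G, IsMoorePenroseInverse (dictionaryMatrix d) G ∧
          ∀ c f, IsOptimal P len c d f ↔
            c = ∫ v, v ∂P ∧ f =ᵐ[P] affineScheme G (∫ v, v ∂P)) ∧
      -- the optimal value
      IsLeast {w | ∃ c, ∃ (d : Fin K → EuclideanSpace ℝ (Fin n)), ∃ f,
          IsFeasible P len c d f ∧ w = cost P f}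
        (ENNReal.ofReal (valueMap (fun i => Real.sqrt (σ i)) (foldedLengths len m)
          (numBlocks x) (breakpoint x))) ∧
      valueMap (fun i => Real.sqrt (σ i)) (foldedLengths len m) (numBlocks x) (breakpoint x) =
        -qpObjective (fun i => Real.sqrt (σ i)) (foldedLengths len m) x ∧
      -- the algorithm computes an optimal dictionary and its scheme in polynomial time
      (∀ E : EigSolver, E.IsCorrect →
        (Algo.optimalDictionary n K (toRows (varianceMatrix P)) (List.ofFn len)).steps E
          ≤ E.time n + p.eval K ∧
        ∃ (d : Fin K → EuclideanSpace ℝ (Fin n)) (G : Matrix (Fin K) (Fin n) ℝ),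
          (Algo.optimalDictionary n K (toRows (varianceMatrix P)) (List.ofFn len)).value E =
            (toRows (dictionaryMatrix d).transpose, toRows G) ∧
          IsMoorePenroseInverse (dictionaryMatrix d) G ∧
          IsOptimal P len (∫ v, v ∂P) d (affineScheme G (∫ v, v ∂P))) ∧
      -- every optimal matrix `∑ i, dᵢ dᵢᵀ` arises from the algorithm
      (∀ d : Fin K → EuclideanSpace ℝ (Fin n), IsOptimalDictionary P len d →
        ∃ E : EigSolver, E.IsCorrect ∧
        ∃ d' : Fin K → EuclideanSpace ℝ (Fin n),
          ((Algo.optimalDictionary n K (toRows (varianceMatrix P)) (List.ofFn len)).value E).1 =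
            toRows (dictionaryMatrix d').transpose ∧
          gram d' = gram d) := by
  refine ⟨200 * (Polynomial.X + 1) ^ 3, ?_⟩
  intro n K hnK len hlen hanti P _ hP hdirac m σ hσ
  obtain ⟨x, S⟩ := exists_optimalityData hnK hlen hP hdirac hσ
  have ha := foldedLengths_pos hlen (S.le_dim.trans hnK)
  have hsol := S.kkt.isQPSolution ha
  have hex := S.hasMinimizer hlen hanti
  have halg := fun (E : EigSolver) {τ : Fin n → ℝ} {w : Fin n → EuclideanSpace ℝ (Fin n)} =>
    S.algorithm_spec hlen hanti E (τ := τ) (w := w)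
  refine ⟨⟨x, hsol, fun y hy => S.kkt.eq_of_isQPSolution ha hy⟩, fun y hy lam hlam => ?_⟩
  -- Uniqueness transfers the optimality conditions to the given solution; after that `lambdaMap`
  -- and `valueMap` become `c / x` and `∑ c x`.
  obtain rfl : y = x := S.kkt.eq_of_isQPSolution ha hy
  rw [S.kkt.lambdaMap_eq ha] at hlam
  subst hlam
  rw [S.kkt.valueMap_eq ha]
  have hlen_of : ∀ {d : Fin K → EuclideanSpace ℝ (Fin n)}, IsOptimalDictionary P len d →
      ∀ t, inner ℝ (d t) (d t) = len t := fun ⟨_, _, h⟩ => h.1.1.1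
  refine ⟨S.lam_pos, S.antitone_lam, ?_, ?_, ?_, ?_, ?_, S.kkt.sum_eq_neg_qpObjective, ?_, ?_⟩
  · obtain ⟨c, d, f, h1, h2⟩ := hex
    exact ⟨c, d, f, S.isOptimal_of_cost_eq h1 h2⟩
  · intro c d f hf
    exact S.constant_eq_of_cost_eq hf.1 (S.cost_eq_of_isOptimal hex hf)
  · intro d hd
    exact S.isOptimalDictionary_iff hex hd
  · intro d hd
    obtain ⟨u, hu, hg⟩ := (S.isOptimalDictionary_iff hex (hlen_of hd)).1 hd
    exact ⟨_, isMoorePenroseInverse_pseudoInverse hu.1 S.lam_pos hg,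
      S.optimal_scheme_iff hex (hlen_of hd) hu hg⟩
  · refine ⟨?_, ?_⟩
    · obtain ⟨c, d, f, h1, h2⟩ := hex
      exact ⟨c, d, f, h1, h2.symm⟩
    · rintro _ ⟨c, d, f, h1, rfl⟩
      exact S.le_cost h1
  · intro E hE
    obtain ⟨τ, w, hτ, hw, hout⟩ := hE n (varianceMatrix P) varianceMatrix_isSymm
    obtain ⟨h1, d, G, h2, h3, h4, h5, -⟩ := halg E hτ hw hout
    refine ⟨?_, d, G, h2, h3, S.isOptimal_of_cost_eq h4 h5⟩
    simpa using h1
  · intro d hd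
    obtain ⟨c, f, hf⟩ := hd
    obtain ⟨w, hw, hg⟩ := S.eigenbasis_of_cost_eq hf.1 (S.cost_eq_of_isOptimal hex hf)
    -- The equality case provides an eigenbasis of the variance matrix that diagonalizes the Gram
    -- matrix of the given dictionary; a subroutine returning this basis makes the algorithm
    -- reproduce that matrix.
    obtain ⟨E, hE, hout⟩ := exists_eigSolver S.antitone_extendZero hw
    obtain ⟨-, d', G, h1, -, -, -, h2⟩ := halg E S.antitone_extendZero hw hout
    exact ⟨E, hE, d', by rw [h1], h2.trans hg.symm⟩
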